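/- Let $d\ge 2$ and let $\mathcal S$ be a finite system of closed straight-line segments in $\mathbb R^d$. The disjointness graph $G$ of $\mathcal S$ has the members of $\mathcal S$ as its vertices, and two of them are adjacent if and only if they have no point in common. Let $\chi(G)$, $\omega(G)$ and $\alpha(G)$ be the chromatic number, the clique number and the independence number of $G$. (i) $\chi(G)\le \omega(G)^4+\omega(G)^3$. (ii) There is a polynomial-time algorithm that, given the coordinates of the endpoints of $n$ segments in $\mathbb R^d$, finds a complete subgraph $K$ of their disjointness graph $G$ and a proper coloring of $G$ with at most $|V(K)|^4+|V(K)|^3$ colors. Here polynomial time means that one fixed program for a random access machine with natural-number and real memory cells (exact addition, subtraction, multiplication, division and comparison of reals, with no rounding and no constants other than natural numbers) works for all $n$ and all $d\ge2$, and that its running time is bounded by a polynomial in $n+d$ when operations on reals have unit cost and, for rational coordinates, also by a polynomial in $n+d$ plus the total binary length of the coordinates when writing a number is charged by its binary length. (iii) Consequently $\max(\alpha(G),\omega(G))=\Omega(n^{1/5})$ for the disjointness graph $G$ of any $n$ segments in $\mathbb R^d$, $d\ge 2$, with an absolute implied constant; more precisely, $\max(\alpha(G),\omega(G))\ge(1-o(1))\,n^{1/5}$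 as $n\to\infty$, where the $o(1)$ term depends only on $n$. -/

import Mathlib

open Finset Filter Topology

/-! ### Disjointness graphs of segments -/

/-- The disjointness graph of the family of closed segments with endpoints `a i` and `b i`:
two indices are adjacent when the corresponding segments have no point in common. -/
def disjointnessGraph {ι : Type*} {d : ℕ} (a b : ι → EuclideanSpace ℝ (Fin d)) :
    SimpleGraph ι where
  Adj i j := Disjoint (segment ℝ (a i) (b i)) (segment ℝ (a j) (b j))
  symm := ⟨fun _ _ h => h.symm⟩
  loopless := ⟨fun i h =>
    Set.disjoint_left.mp h (left_mem_segment ℝ (a i) (b i)) (left_mem_segment ℝ (a i) (b i))⟩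

/-! ### A real random access machine with a step count

The memory consists of arrays of natural numbers and of arrays of real numbers. An array has a
fixed name (a natural number occurring literally in the program) and its cells are addressed
indirectly, by the value of an expression. The real numbers can only be added, subtracted,
multiplied, divided and compared: there is no rounding, and no conversion to natural numbers. -/

namespace RealRAM

/-- The memory: `σ.nat k i` and `σ.real k i` are the cells with address `i` of the `k`-th array of
natural numbers and of the `k`-th array of real numbers. -/
structure Store where
  /-- the arrays of natural numbers -/
  nat : ℕ → ℕ → ℕ
  /-- the arrays of real numbers -/
  real : ℕ → ℕ → ℝ

/-- Expressions whose values are natural numbers; `get k e` reads the cell with address `e` of the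
`k`-th array, `sub` is truncated subtraction. -/
inductive NatExpr : Type
  | const (c : ℕ)
  | get (k : ℕ) (e : NatExpr)
  | add (e₁ e₂ : NatExpr)
  | sub (e₁ e₂ : NatExpr)
  | mul (e₁ e₂ : NatExpr)

/-- Expressions whose values are real numbers; the only constants are natural numbers. -/
inductive RealExpr : Type
  | const (c : ℕ)
  | get (k : ℕ) (e : NatExpr)
  | add (e₁ e₂ : RealExpr)
  | sub (e₁ e₂ : RealExpr)
  | mul (e₁ e₂ : RealExpr)
  | div (e₁ e₂ : RealExpr)

/-- Tests for branching. -/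
inductive Test : Type
  | natLt (e₁ e₂ : NatExpr)
  | realLt (e₁ e₂ : RealExpr)
  | not (c : Test)
  | and (c₁ c₂ : Test)

/-- Programs. A program is a finite text that depends neither on the input nor on its size. -/
inductive Program : Type
  | skip
  | natSet (k : ℕ) (addr : NatExpr) (e : NatExpr)
  | realSet (k : ℕ) (addr : NatExpr) (e : RealExpr)
  | seq (P Q : Program)
  | ite (c : Test) (P Q : Program)
  | loop (c : Test) (P : Program)

/-- The value of an expression for natural numbers. -/
def NatExpr.eval (σ : Store) : NatExpr → ℕ
  | .const c => c
  | .get k e => σ.nat k (e.eval σ)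
  | .add e₁ e₂ => e₁.eval σ + e₂.eval σ
  | .sub e₁ e₂ => e₁.eval σ - e₂.eval σ
  | .mul e₁ e₂ => e₁.eval σ * e₂.eval σ

/-- The value of an expression for real numbers (a quotient by zero is zero). -/
noncomputable def RealExpr.eval (σ : Store) : RealExpr → ℝ
  | .const c => (c : ℝ)
  | .get k e => σ.real k (e.eval σ)
  | .add e₁ e₂ => e₁.eval σ + e₂.eval σ
  | .sub e₁ e₂ => e₁.eval σ - e₂.eval σ
  | .mul e₁ e₂ => e₁.eval σ * e₂.eval σ
  | .div e₁ e₂ => e₁.eval σ / e₂.eval σ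

/-- The truth value of a test. -/
def Test.Holds (σ : Store) : Test → Prop
  | .natLt e₁ e₂ => e₁.eval σ < e₂.eval σ
  | .realLt e₁ e₂ => e₁.eval σ < e₂.eval σ
  | .not c => ¬ c.Holds σ
  | .and c₁ c₂ => c₁.Holds σ ∧ c₂.Holds σ

/-- Write `v` into the cell with address `i` of the `k`-th array of natural numbers. -/
def Store.setNat (σ : Store) (k i v : ℕ) : Store :=
  { σ with nat := Function.update σ.nat k (Function.update (σ.nat k) i v) }

/-- Write `x` into the cell with address `i` of the `k`-th array of real numbers. -/
noncomputable def Store.setReal (σ : Store) (k i : ℕ) (x : ℝ) : Store :=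
  { σ with real := Function.update σ.real k (Function.update (σ.real k) i x) }

/-- `Exec w P σ t τ`: started with memory `σ`, the program `P` halts with memory `τ`, and the
execution has cost `t`. Each executed assignment and each evaluated branching test costs one.
Writing a natural number costs in addition its number of binary digits, and writing a real number
`x` costs in addition `w x`. (Expressions and tests have bounded length for a given program, and
every number they read is part of the input or was written, and paid for, earlier.) -/
inductive Exec (w : ℝ → ℕ) : Program → Store → ℕ → Store → Prop
  | skip (σ : Store) : Exec w .skip σ 0 σ
  | natSet (σ : Store) (k : ℕ) (addr e : NatExpr) :
      Exec w (.natSet k addr e) σ (1 + Nat.size (e.eval σ)) (σ.setNat k (addr.eval σ) (e.eval σ))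
  | realSet (σ : Store) (k : ℕ) (addr : NatExpr) (e : RealExpr) :
      Exec w (.realSet k addr e) σ (1 + w (e.eval σ)) (σ.setReal k (addr.eval σ) (e.eval σ))
  | seq {P Q : Program} {σ τ υ : Store} {s t : ℕ} :
      Exec w P σ s τ → Exec w Q τ t υ → Exec w (.seq P Q) σ (s + t) υ
  | ite_true {c : Test} {P Q : Program} {σ τ : Store} {t : ℕ} :
      c.Holds σ → Exec w P σ t τ → Exec w (.ite c P Q) σ (1 + t) τ
  | ite_false {c : Test} {P Q : Program} {σ τ : Store} {t : ℕ} :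
      ¬ c.Holds σ → Exec w Q σ t τ → Exec w (.ite c P Q) σ (1 + t) τ
  | loop_true {c : Test} {P : Program} {σ τ υ : Store} {s t : ℕ} :
      c.Holds σ → Exec w P σ s τ → Exec w (.loop c P) τ t υ →
        Exec w (.loop c P) σ (1 + s + t) υ
  | loop_false {c : Test} {P : Program} {σ : Store} :
      ¬ c.Holds σ → Exec w (.loop c P) σ 1 σ

/-- `P`, started with memory `σ`, halts with memory `τ` at a cost of at most `T`. -/
def RunsWithin (w : ℝ → ℕ) (P : Program) (σ τ : Store) (T : ℕ) : Prop :=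
  ∃ t ≤ T, Exec w P σ t τ

/-- The unit cost of real arithmetic: nothing is charged for the size of a real number. -/
def unitCost : ℝ → ℕ := fun _ => 0

open Classical in
/-- The binary length of a rational number: the number of binary digits of the numerator and of the
denominator in lowest terms. (Irrational numbers get the value zero; the bit cost is only used for
rational inputs, where all numbers in the memory are rational.) -/
noncomputable def bitLength (x : ℝ) : ℕ :=
  if h : ∃ q : ℚ, (q : ℝ) = x then Nat.size h.choose.num.natAbs + Nat.size h.choose.den else 0

/-- The memory that holds the input: `n` segments in `ℝ^d`. The cells `0` and `1` of array `0` of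
natural numbers hold `n` and `d`; the cell `i * d + j` of array `0` (array `1`) of real numbers
holds the `j`-th coordinate of the first (second) endpoint of the `i`-th segment.
All other cells are zero. -/
noncomputable def inputStore {n d : ℕ} (a b : Fin n → EuclideanSpace ℝ (Fin d)) : Store where
  nat k i := if k = 0 ∧ i = 0 then n else if k = 0 ∧ i = 1 then d else 0
  real k m :=
    if h : m / d < n ∧ m % d < d then
      if k = 0 then a ⟨m / d, h.1⟩ ⟨m % d, h.2⟩
      else if k = 1 then b ⟨m / d, h.1⟩ ⟨m % d, h.2⟩
      else 0
    else 0

/-- All coordinates of all endpoints are rational. -/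
def IsRationalInput {n d : ℕ} (a b : Fin n → EuclideanSpace ℝ (Fin d)) : Prop :=
  ∀ i j, (∃ q : ℚ, (q : ℝ) = a i j) ∧ (∃ q : ℚ, (q : ℝ) = b i j)

/-- The total binary length of the coordinates of the endpoints. -/
noncomputable def inputBits {n d : ℕ} (a b : Fin n → EuclideanSpace ℝ (Fin d)) : ℕ :=
  ∑ i, ∑ j, (bitLength (a i j) + bitLength (b i j))

/-- The output set: `i` belongs to it when cell `i` of array `1` of natural numbers is nonzero. -/
def outputSet (n : ℕ) (τ : Store) : Finset (Fin n) :=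
  Finset.univ.filter fun i => τ.nat 1 i ≠ 0

/-- The output coloring: the color of `i` is the content of cell `i` of array `2` of natural
numbers. -/
def outputColor (n : ℕ) (τ : Store) (i : Fin n) : ℕ := τ.nat 2 i

end RealRAM

/-! The segments are colored according to the way in which they meet a clique `K` with k members.
Each color class consists of pairwise intersecting segments. The number of colors is within the
bound unless one of the selections made on the way is a clique larger than `K`.

A segment that meets only `u` in `K` gets a color for `u`: two disjoint segments of this kind could
replace `u`. A segment that meets two members of `K` and contains an endpoint of a member gets a
color for this endpoint. All others (`Gen`) are transversal to the members that they meet.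

Suppose that such a segment lies in the plane of two coplanar members of `K`. If it also meets a
member w outside the plane, it passes through the point where w pierces the plane, and the plane and
w form its color (`meets_of_not_inPl`). Otherwise it is assigned to the first of its planes.
Disjoint segments of a plane are comparable in one of four partial orders (`exists_lt`, `Lt.trans`),
so if m is the largest size of a chain, the four heights of a segment give at most m^4 colors. The
chains are selected plane by plane among the segments disjoint from all earlier chains (`Free`).
Hence the union of the chains is a clique, the sizes m add up to at most k, and their fourth powers
to at most k^4. A segment that meets a member x of an earlier chain is colored by its plane and x
(`Fst.meets`).

A generic segment in none of these planes meets a skew pair of members of `K`. Two transversals of a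
skew pair can meet only on the pair (`shared_of_skew`). So a maximal set of transversals without
common points on the pair is a clique, and every transversal of the pair is colored by a point of
the pair that it shares with a selected one: at most 2k colors for each pair. With a coplanar and b
skew pairs, 2(a + b) ≤ k(k - 1), and the colors add up to at most k^4 + k^3 (`count_le`).

The algorithm starts with the empty clique, computes these selections, and replaces the clique
whenever a selection or an exchange of one segment for two gives a larger one; there are at most n
such improvements. It is written in a small language of terms with bounded sums and of bounded loops
over arrays of bits, which is compiled to the machine once and for all (`Term.exists_spec`,
`Stmt.exists_spec`). Since the arrays hold bits, all numbers stay polynomial in n + d. Real numbers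
are only read and compared, never written, so one run has the same cost in both cost models.
Existential quantifiers over reals are removed by Cramer's rule (`onSeg_iff`, `meets_iff`,
`shared_iff`, `inPl_iff`, `lt_iff`). The bounds on the chromatic number and on max(α, ω) are read
off from the output. -/

namespace SegAlg
open RealRAM

/-! ### Runs whose cost does not depend on the charge for real numbers -/

/-- `P` halts on `σ` at a cost of at most `T`, whatever the charge for real numbers is, in a memory
that satisfies `Post`. -/
def Runs (P : Program) (σ : Store) (T : ℕ) (Post : Store → Prop) : Prop :=
  ∃ t ≤ T, ∃ τ, (∀ w, Exec w P σ t τ) ∧ Post τ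

theorem Runs.mono {P : Program} {σ : Store} {T T' : ℕ} {Q Q' : Store → Prop}
    (h : Runs P σ T Q) (hT : T ≤ T') (hQ : ∀ τ, Q τ → Q' τ) : Runs P σ T' Q' := by
  obtain ⟨t, ht, τ, he, hq⟩ := h
  exact ⟨t, ht.trans hT, τ, he, hQ τ hq⟩

theorem Runs.seq {P R : Program} {σ : Store} {T₁ T₂ : ℕ} {Q Q' : Store → Prop}
    (h : Runs P σ T₁ Q) (h' : ∀ τ, Q τ → Runs R τ T₂ Q') : Runs (.seq P R) σ (T₁ + T₂) Q' := by
  obtain ⟨t, ht, τ, he, hq⟩ := h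
  obtain ⟨s, hs, υ, he', hq'⟩ := h' τ hq
  exact ⟨t + s, by omega, υ, fun w => .seq (he w) (he' w), hq'⟩

/-- All numbers that get written are polynomially bounded in value, so it is affordable to charge
the value instead of the binary length. -/
theorem size_le_self (v : ℕ) : Nat.size v ≤ v := Nat.size_le.2 Nat.lt_two_pow_self

theorem Runs.natSet {σ : Store} {k : ℕ} {addr e : NatExpr} {Q : Store → Prop} {T : ℕ}
    (h : Q (σ.setNat k (addr.eval σ) (e.eval σ))) (hT : 1 + e.eval σ ≤ T) :
    Runs (.natSet k addr e) σ T Q :=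
  ⟨_, le_trans (Nat.add_le_add_left (size_le_self _) 1) hT, _, fun _ => .natSet σ k addr e, h⟩

theorem Runs.ite_true {c : Test} {P R : Program} {σ : Store} {T : ℕ} {Q : Store → Prop}
    (hc : c.Holds σ) (h : Runs P σ T Q) : Runs (.ite c P R) σ (T + 1) Q := by
  obtain ⟨t, ht, τ, he, hq⟩ := h
  exact ⟨1 + t, by omega, τ, fun w => .ite_true hc (he w), hq⟩

theorem Runs.ite_false {c : Test} {P R : Program} {σ : Store} {T : ℕ} {Q : Store → Prop}
    (hc : ¬ c.Holds σ) (h : Runs R σ T Q) : Runs (.ite c P R) σ (T + 1) Q := by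
  obtain ⟨t, ht, τ, he, hq⟩ := h
  exact ⟨1 + t, by omega, τ, fun w => .ite_false hc (he w), hq⟩

/-- `Inv i` describes the memory after `i` passes. Each pass pays for its test and its body, and one
more test ends the loop. -/
theorem Runs.loop {c : Test} {P : Program} {m T : ℕ} (Inv : ℕ → Store → Prop)
    (hend : ∀ σ, Inv m σ → ¬ c.Holds σ)
    (hstep : ∀ i σ, i < m → Inv i σ → c.Holds σ ∧ Runs P σ T (Inv (i + 1))) {σ : Store}
    (h0 : Inv 0 σ) : Runs (.loop c P) σ (m * (T + 1) + 1) (Inv m) := by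
  have key : ∀ r i σ, i + r = m → Inv i σ → Runs (.loop c P) σ (r * (T + 1) + 1) (Inv m) := by
    intro r
    induction r with
    | zero =>
      intro i σ hi h
      have hi' : i = m := by omega
      subst hi'
      exact ⟨1, by omega, σ, fun _ => .loop_false (hend σ h), h⟩
    | succ r ih =>
      intro i σ hi h
      obtain ⟨hc, t, ht, τ, he, hτ⟩ := hstep i σ (by omega) h
      obtain ⟨s, hs, υ, he', hυ⟩ := ih (i + 1) τ (by omega) hτ
      refine ⟨1 + t + s, ?_, υ, fun w => .loop_true hc (he w) (he' w), hυ⟩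
      calc 1 + t + s ≤ 1 + T + (r * (T + 1) + 1) := by omega
        _ = (r + 1) * (T + 1) + 1 := by ring
  exact key m 0 σ (by omega) h0

/-! ### Memory updates -/

theorem setNat_nat (σ : Store) (k i v k' i' : ℕ) :
    (σ.setNat k i v).nat k' i' = if k' = k ∧ i' = i then v else σ.nat k' i' := by
  unfold Store.setNat
  by_cases hk : k' = k
  · subst hk
    by_cases hi : i' = i
    · subst hi; simp
    · simp [hi]
  · simp [hk]

theorem setNat_nat_ne (σ : Store) {k k' : ℕ} (i v : ℕ) (h : k' ≠ k) :
    (σ.setNat k i v).nat k' = σ.nat k' := by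
  funext i'; simp [setNat_nat, h]

@[simp] theorem setNat_real (σ : Store) (k i v : ℕ) : (σ.setNat k i v).real = σ.real := rfl

/-! ### Terms with bounded sums -/

/-- An input: the number of segments, the dimension, the real memory. The cell after the last
coordinate is zero. -/
structure Inp where
  n : ℕ
  d : ℕ
  R : ℕ → ℕ → ℝ
  zero_fst : R 0 (n * d) = 0
  zero_snd : R 1 (n * d) = 0

/-- The coordinates of the first endpoints, continued by zeros. -/
noncomputable def Inp.a (I : Inp) (i r : ℕ) : ℝ := if r < I.d then I.R 0 (i * I.d + r) else 0

/-- The coordinates of the second endpoints, continued by zeros. -/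
noncomputable def Inp.b (I : Inp) (i r : ℕ) : ℝ := if r < I.d then I.R 1 (i * I.d + r) else 0

/-- Real terms: `fst x y` and `snd x y` are the `y`-th coordinates of the endpoints of the segment
with index `x`, where `x` and `y` are names of variables. -/
inductive RTerm : Type
  | const (c : ℕ)
  | fst (x y : ℕ)
  | snd (x y : ℕ)
  | add (e₁ e₂ : RTerm)
  | sub (e₁ e₂ : RTerm)
  | mul (e₁ e₂ : RTerm)
  | div (e₁ e₂ : RTerm)

/-- The value of a real term. -/
noncomputable def RTerm.eval (I : Inp) (ρ : ℕ → ℕ) : RTerm → ℝ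
  | .const c => c
  | .fst x y => I.a (ρ x) (ρ y)
  | .snd x y => I.b (ρ x) (ρ y)
  | .add e₁ e₂ => e₁.eval I ρ + e₂.eval I ρ
  | .sub e₁ e₂ => e₁.eval I ρ - e₂.eval I ρ
  | .mul e₁ e₂ => e₁.eval I ρ * e₂.eval I ρ
  | .div e₁ e₂ => e₁.eval I ρ / e₂.eval I ρ

/-- Terms for natural numbers, with variables, three-dimensional arrays of bits, bounded sums
and comparisons of real terms. -/
inductive Term : Type
  | const (c : ℕ)
  | var (x : ℕ)
  | size
  | dim
  | arr (A : ℕ) (e₁ e₂ e₃ : Term)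
  | add (e₁ e₂ : Term)
  | sub (e₁ e₂ : Term)
  | mul (e₁ e₂ : Term)
  | sum (x : ℕ) (b e : Term)
  | rlt (r₁ r₂ : RTerm)

/-- The contents of the arrays. -/
abbrev Arrays := ℕ → ℕ → ℕ → ℕ → ℕ

open Classical in
/-- The value of a term. -/
noncomputable def Term.eval (I : Inp) (α : Arrays) : (ℕ → ℕ) → Term → ℕ
  | _, .const c => c
  | ρ, .var x => ρ x
  | _, .size => I.n
  | _, .dim => I.d
  | ρ, .arr A e₁ e₂ e₃ => α A (e₁.eval I α ρ) (e₂.eval I α ρ) (e₃.eval I α ρ)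
  | ρ, .add e₁ e₂ => e₁.eval I α ρ + e₂.eval I α ρ
  | ρ, .sub e₁ e₂ => e₁.eval I α ρ - e₂.eval I α ρ
  | ρ, .mul e₁ e₂ => e₁.eval I α ρ * e₂.eval I α ρ
  | ρ, .sum x b e => ∑ i ∈ range (b.eval I α ρ), e.eval I α (Function.update ρ x i)
  | ρ, .rlt r₁ r₂ => if r₁.eval I ρ < r₂.eval I ρ then 1 else 0

/-- An injective pairing. -/
def pr (i j : ℕ) : ℕ := (i + j) * (i + j) + i

/-- The value lies between the squares of `i + j` and `i + j + 1`, so it determines the sum, and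
then `i`. -/
theorem pr_inj {i j i' j' : ℕ} (h : pr i j = pr i' j') : i = i' ∧ j = j' := by
  unfold pr at h
  have h1 : i + j = i' + j' := by
    rcases lt_trichotomy (i + j) (i' + j') with h2 | h2 | h2
    · exfalso; nlinarith
    · exact h2
    · exfalso; nlinarith
  rw [h1] at h
  omega

/-- The address of an entry of a three-dimensional array. -/
def adr (i j k : ℕ) : ℕ := pr (pr i j) k

theorem adr_inj {i j k i' j' k' : ℕ} (h : adr i j k = adr i' j' k') : i = i' ∧ j = j' ∧ k = k' := by
  obtain ⟨h1, h2⟩ := pr_inj h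
  obtain ⟨h3, h4⟩ := pr_inj h1
  exact ⟨h3, h4, h2⟩

/-- The pairing as an expression of the machine. -/
def prE (e f : NatExpr) : NatExpr := .add (.mul (.add e f) (.add e f)) e

theorem prE_eval (σ : Store) (e f : NatExpr) : (prE e f).eval σ = pr (e.eval σ) (f.eval σ) := rfl

/-- A stack cell. -/
def stk (s : ℕ) : NatExpr := .get 4 (.const s)

/-- A cell holding a variable. -/
def cell (x : ℕ) : NatExpr := .get 3 (.const x)

/-- Increment the cell of a variable. -/
def incr (x : ℕ) : Program := .natSet 3 (.const x) (.add (cell x) (.const 1))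

/-- The address of a coordinate, or of the cell after the last coordinate. -/
def coordAddr (x y : ℕ) : NatExpr :=
  .add (.mul (.sub (.const 1) (.sub (.const 1) (.sub (.get 0 (.const 1)) (cell y))))
    (.add (.mul (cell x) (.get 0 (.const 1))) (cell y)))
  (.mul (.sub (.const 1) (.sub (.get 0 (.const 1)) (cell y)))
    (.mul (.get 0 (.const 0)) (.get 0 (.const 1))))

/-- The real expression of the machine for a real term. -/
def RTerm.toExpr : RTerm → RealExpr
  | .const c => .const c
  | .fst x y => .get 0 (coordAddr x y)
  | .snd x y => .get 1 (coordAddr x y)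
  | .add e₁ e₂ => .add e₁.toExpr e₂.toExpr
  | .sub e₁ e₂ => .sub e₁.toExpr e₂.toExpr
  | .mul e₁ e₂ => .mul e₁.toExpr e₂.toExpr
  | .div e₁ e₂ => .div e₁.toExpr e₂.toExpr

/-- The program that evaluates a term and puts the value into the stack cell `s`. -/
def Term.comp : ℕ → Term → Program
  | s, .const c => .natSet 4 (.const s) (.const c)
  | s, .var x => .natSet 4 (.const s) (cell x)
  | s, .size => .natSet 4 (.const s) (.get 0 (.const 0))
  | s, .dim => .natSet 4 (.const s) (.get 0 (.const 1))
  | s, .arr A e₁ e₂ e₃ => .seq (e₁.comp s) <| .seq (e₂.comp (s + 1)) <| .seq (e₃.comp (s + 2)) <|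
      .natSet 4 (.const s) (.get (A + 10) (prE (prE (stk s) (stk (s + 1))) (stk (s + 2))))
  | s, .add e₁ e₂ => .seq (e₁.comp s) <| .seq (e₂.comp (s + 1)) <|
      .natSet 4 (.const s) (.add (stk s) (stk (s + 1)))
  | s, .sub e₁ e₂ => .seq (e₁.comp s) <| .seq (e₂.comp (s + 1)) <|
      .natSet 4 (.const s) (.sub (stk s) (stk (s + 1)))
  | s, .mul e₁ e₂ => .seq (e₁.comp s) <| .seq (e₂.comp (s + 1)) <|
      .natSet 4 (.const s) (.mul (stk s) (stk (s + 1)))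
  | s, .sum x b e => .seq (b.comp s) <| .seq (.natSet 4 (.const (s + 1)) (.const 0)) <|
      .seq (.natSet 4 (.const (s + 2)) (cell x)) <| .seq (.natSet 3 (.const x) (.const 0)) <|
      .seq (.loop (.natLt (cell x) (stk s)) <| .seq (e.comp (s + 3)) <|
        .seq (.natSet 4 (.const (s + 1)) (.add (stk (s + 1)) (stk (s + 3)))) (incr x)) <|
      .seq (.natSet 3 (.const x) (stk (s + 2))) (.natSet 4 (.const s) (stk (s + 1)))
  | s, .rlt r₁ r₂ => .ite (.realLt r₁.toExpr r₂.toExpr) (.natSet 4 (.const s) (.const 1))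
      (.natSet 4 (.const s) (.const 0))

/-- The memory `σ` represents the input, the variables and the arrays. -/
structure Rep (σ : Store) (I : Inp) (ρ : ℕ → ℕ) (α : Arrays) : Prop where
  size : σ.nat 0 0 = I.n
  dim : σ.nat 0 1 = I.d
  real : σ.real = I.R
  var : ∀ x, σ.nat 3 x = ρ x
  arr : ∀ A i j k, σ.nat (A + 10) (adr i j k) = α A i j k

/-- All numbers in sight are bounded by `B`. -/
structure Small (I : Inp) (ρ : ℕ → ℕ) (α : Arrays) (B : ℕ) : Prop where
  size : I.n ≤ B
  dim : I.d ≤ B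
  var : ∀ x, ρ x ≤ B
  arr : ∀ A i j k, α A i j k ≤ 1

/-- Only the stack above `s` has changed. -/
structure Keep (s : ℕ) (σ τ : Store) : Prop where
  real : τ.real = σ.real
  nat : ∀ k, k ≠ 4 → τ.nat k = σ.nat k
  stk : ∀ i < s, τ.nat 4 i = σ.nat 4 i

theorem Keep.refl (s : ℕ) (σ : Store) : Keep s σ σ := ⟨rfl, fun _ _ => rfl, fun _ _ => rfl⟩

theorem Keep.trans {s s' : ℕ} {σ τ υ : Store} (h : Keep s σ τ) (h' : Keep s' τ υ) (hs : s ≤ s') :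
    Keep s σ υ :=
  ⟨h'.real.trans h.real, fun k hk => (h'.nat k hk).trans (h.nat k hk),
    fun i hi => (h'.stk i (by omega)).trans (h.stk i hi)⟩

theorem Keep.setNat {s s' : ℕ} {σ τ : Store} (h : Keep s σ τ) (hs : s ≤ s') (v : ℕ) :
    Keep s σ (τ.setNat 4 s' v) :=
  ⟨h.real, fun k hk => by rw [setNat_nat_ne _ _ _ hk, h.nat k hk], fun i hi => by
    rw [setNat_nat, if_neg (by omega), h.stk i hi]⟩

theorem Keep.rep {s : ℕ} {σ τ : Store} {I : Inp} {ρ : ℕ → ℕ} {α : Arrays} (h : Keep s σ τ)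
    (hr : Rep σ I ρ α) : Rep τ I ρ α := by
  obtain ⟨h1, h2, h3, h4, h5⟩ := hr
  refine ⟨?_, ?_, h.real.trans h3, ?_, ?_⟩
  · rw [h.nat 0 (by omega), h1]
  · rw [h.nat 0 (by omega), h2]
  · intro x; rw [h.nat 3 (by omega), h4]
  · intro A i j k; rw [h.nat _ (by omega), h5]

/-- With truncated subtraction, `1 - (1 - (d - y))` is the indicator of `y < d`. A coordinate out of
range is thus read from the zero cell behind the input. -/
theorem coordAddr_eval {σ : Store} {I : Inp} {ρ : ℕ → ℕ} {α : Arrays} (hr : Rep σ I ρ α)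
    (x y : ℕ) : (coordAddr x y).eval σ = if ρ y < I.d then ρ x * I.d + ρ y else I.n * I.d := by
  simp only [coordAddr, NatExpr.eval, cell, hr.var, hr.dim, hr.size]
  split_ifs with h
  · rw [show 1 - (1 - (I.d - ρ y)) = 1 by omega, show 1 - (I.d - ρ y) = 0 by omega]; ring
  · rw [show 1 - (1 - (I.d - ρ y)) = 0 by omega, show 1 - (I.d - ρ y) = 1 by omega]; ring

theorem RTerm.toExpr_eval {σ : Store} {I : Inp} {ρ : ℕ → ℕ} {α : Arrays} (hr : Rep σ I ρ α)
    (r : RTerm) : r.toExpr.eval σ = r.eval I ρ := by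
  induction r with
  | const c => rfl
  | fst x y =>
    simp only [toExpr, RealExpr.eval, eval, coordAddr_eval hr, hr.real, Inp.a]
    split_ifs <;> simp [I.zero_fst]
  | snd x y =>
    simp only [toExpr, RealExpr.eval, eval, coordAddr_eval hr, hr.real, Inp.b]
    split_ifs <;> simp [I.zero_snd]
  | add e f he hf => simp [toExpr, RealExpr.eval, eval, he, hf]
  | sub e f he hf => simp [toExpr, RealExpr.eval, eval, he, hf]
  | mul e f he hf => simp [toExpr, RealExpr.eval, eval, he, hf]
  | div e f he hf => simp [toExpr, RealExpr.eval, eval, he, hf]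

/-! ### Polynomial bounds as powers of `B + 2` -/

theorem pow_le_pow_of_le (B : ℕ) {c c' : ℕ} (h : c ≤ c') : (B + 2) ^ c ≤ (B + 2) ^ c' :=
  Nat.pow_le_pow_right (by omega) h

theorem one_le_bpow (B c : ℕ) : 1 ≤ (B + 2) ^ c := Nat.one_le_pow _ _ (by omega)

theorem le_bpow (B c : ℕ) (hc : 1 ≤ c) : B + 2 ≤ (B + 2) ^ c :=
  calc B + 2 = (B + 2) ^ 1 := (pow_one _).symm
    _ ≤ _ := pow_le_pow_of_le B hc

/-- The base is at least 2, so a constant factor can be absorbed into the exponent. -/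
theorem const_mul_le_bpow (B c a j : ℕ) : 2 ^ a * ((B + 2) ^ c) ^ j ≤ (B + 2) ^ (a + c * j) := by
  rw [pow_add, pow_mul]
  exact Nat.mul_le_mul_right _ (Nat.pow_le_pow_left (by omega) _)

/-- A polynomial bound after a polynomial increase of the numbers in sight. -/
theorem bpow_comp (B c₁ c₂ : ℕ) :
    ((B + 2) ^ (c₁ + 1) + 2) ^ c₂ ≤ (B + 2) ^ ((c₁ + 2) * c₂) := by
  rw [pow_mul]
  refine Nat.pow_le_pow_left ?_ _
  have h1 := le_bpow B (c₁ + 1) (by omega)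
  calc (B + 2) ^ (c₁ + 1) + 2 ≤ (B + 2) ^ (c₁ + 1) * 2 := by omega
    _ ≤ (B + 2) ^ (c₁ + 1) * (B + 2) := Nat.mul_le_mul_left _ (by omega)
    _ = _ := by ring

/-- The body of a bounded sum or loop sees a variable as large as the bound of the sum. The bound
for the numbers in sight is raised accordingly, and `bpow_comp` brings the result back to a power of
`B + 2`. -/
theorem Small.update {I : Inp} {ρ : ℕ → ℕ} {α : Arrays} {B c : ℕ} (h : Small I ρ α B) (x : ℕ)
    {i : ℕ} (hi : i ≤ (B + 2) ^ c) :
    Small I (Function.update ρ x i) α ((B + 2) ^ (c + 1)) := by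
  have h1 := le_bpow B (c + 1) (by omega)
  refine ⟨h.size.trans (by omega), h.dim.trans (by omega), fun y => ?_, h.arr⟩
  by_cases hy : y = x
  · subst hy
    rw [Function.update_self]
    exact hi.trans (pow_le_pow_of_le B (by omega))
  · rw [Function.update_of_ne hy]
    exact (h.var y).trans (by omega)

theorem Rep.setVar {σ : Store} {I : Inp} {ρ : ℕ → ℕ} {α : Arrays} (h : Rep σ I ρ α) (x v : ℕ) :
    Rep (σ.setNat 3 x v) I (Function.update ρ x v) α := by
  obtain ⟨h1, h2, h3, h4, h5⟩ := h
  refine ⟨?_, ?_, h3, ?_, ?_⟩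
  · rw [setNat_nat_ne _ _ _ (by omega), h1]
  · rw [setNat_nat_ne _ _ _ (by omega), h2]
  · intro y
    rw [setNat_nat]
    by_cases hy : y = x
    · subst hy; simp
    · simp [hy, h4]
  · intro A i j k; rw [setNat_nat_ne _ _ _ (by omega), h5]

/-- What the compiled term does. -/
def Term.Spec (e : Term) (c : ℕ) : Prop :=
  ∀ (I : Inp) (ρ : ℕ → ℕ) (α : Arrays) (B : ℕ), Small I ρ α B →
    e.eval I α ρ ≤ (B + 2) ^ c ∧
    ∀ (s : ℕ) (σ : Store), Rep σ I ρ α →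
      Runs (e.comp s) σ ((B + 2) ^ c) fun τ => Keep s σ τ ∧ τ.nat 4 s = e.eval I α ρ

theorem spec_set {σ : Store} {s : ℕ} {e : NatExpr} {v T : ℕ} (hv : e.eval σ = v)
    (hT : 1 + v ≤ T) :
    Runs (.natSet 4 (.const s) e) σ T fun τ => Keep s σ τ ∧ τ.nat 4 s = v := by
  refine Runs.natSet ⟨(Keep.refl s σ).setNat le_rfl _, ?_⟩ (by omega)
  simp [setNat_nat, NatExpr.eval, hv]

/-- A common proof for sum, difference and product. The second argument is evaluated one cell higher
on the stack, so the first value survives. -/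
theorem spec_binary {e₁ e₂ e : Term} {c₁ c₂ : ℕ} (h₁ : e₁.Spec c₁) (h₂ : e₂.Spec c₂)
    (F : ℕ → ℕ → ℕ) (E : NatExpr → NatExpr → NatExpr)
    (hF : ∀ x y, F x y ≤ (x + 1) * (y + 1))
    (hE : ∀ σ f g, (E f g).eval σ = F (f.eval σ) (g.eval σ))
    (he : ∀ I α ρ, e.eval I α ρ = F (e₁.eval I α ρ) (e₂.eval I α ρ))
    (hc : ∀ s, e.comp s = .seq (e₁.comp s) (.seq (e₂.comp (s + 1))
      (.natSet 4 (.const s) (E (stk s) (stk (s + 1)))))) :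
    e.Spec (3 + (c₁ + c₂) * 2) := by
  intro I ρ α B hB
  obtain ⟨v₁, r₁⟩ := h₁ I ρ α B hB
  obtain ⟨v₂, r₂⟩ := h₂ I ρ α B hB
  have q₁ := pow_le_pow_of_le B (show c₁ ≤ c₁ + c₂ by omega)
  have q₂ := pow_le_pow_of_le B (show c₂ ≤ c₁ + c₂ by omega)
  have q₀ := one_le_bpow B (c₁ + c₂)
  have hbig := const_mul_le_bpow B (c₁ + c₂) 3 2
  have hval : F (e₁.eval I α ρ) (e₂.eval I α ρ) ≤ 4 * ((B + 2) ^ (c₁ + c₂)) ^ 2 := by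
    refine (hF _ _).trans ?_
    calc _ ≤ (2 * (B + 2) ^ (c₁ + c₂)) * (2 * (B + 2) ^ (c₁ + c₂)) :=
          Nat.mul_le_mul (by omega) (by omega)
      _ = _ := by ring
  have hsq : (B + 2) ^ (c₁ + c₂) ≤ ((B + 2) ^ (c₁ + c₂)) ^ 2 := by nlinarith
  refine ⟨by rw [he]; omega, fun s σ hr => ?_⟩
  rw [hc, he]
  refine (Runs.seq (r₁ s σ hr) fun τ hτ => Runs.seq (r₂ (s + 1) τ (hτ.1.rep hr)) fun υ hυ =>
    Runs.natSet (Q := fun τ => Keep s σ τ ∧ τ.nat 4 s = F (e₁.eval I α ρ) (e₂.eval I α ρ))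
      (T := 1 + 4 * ((B + 2) ^ (c₁ + c₂)) ^ 2) ?_ ?_).mono ?_ fun _ h => h
  · refine ⟨(hτ.1.trans hυ.1 (by omega)).setNat le_rfl _, ?_⟩
    simp [setNat_nat, hE, NatExpr.eval, stk, hυ.2, hυ.1.stk s (by omega), hτ.2]
  · simp only [hE, NatExpr.eval, stk, hυ.2, hυ.1.stk s (by omega), hτ.2]
    omega
  · omega

/-- The entries are bits, so the value is at most one however large the indices are. -/
theorem Term.spec_arr {A : ℕ} {e₁ e₂ e₃ : Term} {c₁ c₂ c₃ : ℕ} (h₁ : e₁.Spec c₁)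
    (h₂ : e₂.Spec c₂) (h₃ : e₃.Spec c₃) : (Term.arr A e₁ e₂ e₃).Spec (3 + (c₁ + c₂ + c₃) * 1) := by
  intro I ρ α B hB
  obtain ⟨v₁, r₁⟩ := h₁ I ρ α B hB
  obtain ⟨v₂, r₂⟩ := h₂ I ρ α B hB
  obtain ⟨v₃, r₃⟩ := h₃ I ρ α B hB
  have q₁ := pow_le_pow_of_le B (show c₁ ≤ c₁ + c₂ + c₃ by omega)
  have q₂ := pow_le_pow_of_le B (show c₂ ≤ c₁ + c₂ + c₃ by omega)
  have q₃ := pow_le_pow_of_le B (show c₃ ≤ c₁ + c₂ + c₃ by omega)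
  have q₀ := one_le_bpow B (c₁ + c₂ + c₃)
  have hbig := const_mul_le_bpow B (c₁ + c₂ + c₃) 3 1
  rw [pow_one] at hbig
  have hval := hB.arr A (e₁.eval I α ρ) (e₂.eval I α ρ) (e₃.eval I α ρ)
  refine ⟨by simp only [eval]; omega, fun s σ hr => ?_⟩
  simp only [eval, comp]
  refine (Runs.seq (r₁ s σ hr) fun τ hτ => Runs.seq (r₂ (s + 1) τ (hτ.1.rep hr)) fun υ hυ =>
    Runs.seq (r₃ (s + 2) υ (hυ.1.rep (hτ.1.rep hr))) fun φ hφ =>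
    Runs.natSet (Q := fun τ => Keep s σ τ ∧
      τ.nat 4 s = α A (e₁.eval I α ρ) (e₂.eval I α ρ) (e₃.eval I α ρ)) (T := 2) ?_ ?_).mono ?_
      fun _ h => h
  · have hφr := hφ.1.rep (hυ.1.rep (hτ.1.rep hr))
    refine ⟨((hτ.1.trans hυ.1 (by omega)).trans hφ.1 (by omega)).setNat le_rfl _, ?_⟩
    simp only [setNat_nat, NatExpr.eval, prE_eval, stk, hφ.2, hφ.1.stk (s + 1) (by omega), hυ.2,
      hφ.1.stk s (by omega), hυ.1.stk s (by omega), hτ.2, and_self, if_true]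
    exact hφr.arr _ _ _ _
  · have hφr := hφ.1.rep (hυ.1.rep (hτ.1.rep hr))
    simp only [NatExpr.eval, prE_eval, stk, hφ.2, hφ.1.stk (s + 1) (by omega), hυ.2,
      hφ.1.stk s (by omega), hυ.1.stk s (by omega), hτ.2]
    have := hφr.arr A (e₁.eval I α ρ) (e₂.eval I α ρ) (e₃.eval I α ρ)
    rw [adr] at this
    omega
  · omega

/-- The stack cells `s`, `s + 1`, `s + 2` hold the upper limit, the partial sum and the saved value
of `x`; the body works from `s + 3` on. There are at most `M` passes, each of cost of order `M ^ 2`,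
which explains the cube. -/
theorem Term.spec_sum {x : ℕ} {b e : Term} {c₁ c₂ : ℕ} (h₁ : b.Spec c₁) (h₂ : e.Spec c₂) :
    ∃ c, (Term.sum x b e).Spec c := by
  refine ⟨5 + (c₁ + (c₁ + 2) * c₂ + 1) * 3, ?_⟩
  intro I ρ α B hB
  obtain ⟨v₁, r₁⟩ := h₁ I ρ α B hB
  have h₂' : ∀ i < b.eval I α ρ, _ := fun i hi =>
    h₂ I (Function.update ρ x i) α _ (hB.update x (c := c₁) (i := i) (by omega))
  have hcomp := bpow_comp B c₁ c₂
  set M := (B + 2) ^ (c₁ + (c₁ + 2) * c₂ + 1) with hM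
  have q₁ : (B + 2) ^ c₁ ≤ M := pow_le_pow_of_le B (by omega)
  have q₂ : ((B + 2) ^ (c₁ + 1) + 2) ^ c₂ ≤ M := hcomp.trans (pow_le_pow_of_le B (by omega))
  have q₃ : B + 2 ≤ M := le_bpow B _ (by omega)
  have hbig := const_mul_le_bpow B (c₁ + (c₁ + 2) * c₂ + 1) 5 3
  rw [← hM] at hbig
  set N := b.eval I α ρ with hN
  have hpart : ∀ i ≤ N, ∑ j ∈ range i, e.eval I α (Function.update ρ x j) ≤ M * M := by
    intro i hi
    calc _ ≤ ∑ j ∈ range i, M := sum_le_sum fun j hj =>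
          (h₂' j (lt_of_lt_of_le (mem_range.1 hj) hi)).1.trans q₂
      _ = i * M := by simp
      _ ≤ M * M := Nat.mul_le_mul_right _ (by omega)
  have hM2 : M ≤ M * M := Nat.le_mul_self M
  have hM3 : M * M ≤ M ^ 3 := by
    calc M * M = M * M * 1 := by ring
      _ ≤ M * M * M := Nat.mul_le_mul_left _ (by omega)
      _ = M ^ 3 := by ring
  refine ⟨by simp only [eval]; exact (hpart N le_rfl).trans (by omega), fun s σ hr => ?_⟩
  simp only [eval, comp]
  let Inv : ℕ → Store → Prop := fun i τ => τ.real = σ.real ∧ Rep τ I (Function.update ρ x i) α ∧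
    (∀ k, k ≠ 4 → k ≠ 3 → τ.nat k = σ.nat k) ∧ (∀ j < s, τ.nat 4 j = σ.nat 4 j) ∧
    τ.nat 4 s = N ∧ τ.nat 4 (s + 1) = ∑ j ∈ range i, e.eval I α (Function.update ρ x j) ∧
    τ.nat 4 (s + 2) = ρ x ∧ (∀ y, y ≠ x → τ.nat 3 y = σ.nat 3 y)
  refine (Runs.seq (r₁ s σ hr) fun τ hτ => Runs.seq (T₁ := 1) (Q := fun υ => Keep s σ υ ∧
      υ.nat 4 s = N ∧ υ.nat 4 (s + 1) = 0)
      (Runs.natSet ⟨hτ.1.setNat (Nat.le_succ s) _, ?_, ?_⟩ ?_) fun υ hυ =>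
    Runs.seq (T₁ := 1 + B) (Q := fun υ => Keep s σ υ ∧
      υ.nat 4 s = N ∧ υ.nat 4 (s + 1) = 0 ∧ υ.nat 4 (s + 2) = ρ x)
      (Runs.natSet ⟨hυ.1.setNat (Nat.le_add_right s 2) _, ?_, ?_, ?_⟩ ?_) fun φ hφ =>
    Runs.seq (T₁ := 1) (Q := Inv 0) (Runs.natSet ?_ ?_) fun ψ hψ =>
    Runs.seq (Runs.loop (m := N) (T := M + (1 + M * M + (M + 1))) Inv ?_ ?_ hψ) fun χ hχ =>
    Runs.seq (T₁ := 1 + B) (Q := fun υ => Keep s σ υ ∧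
        υ.nat 4 (s + 1) = ∑ j ∈ range N, e.eval I α (Function.update ρ x j)) (Runs.natSet ?_ ?_)
      fun ω hω => Runs.natSet (T := 1 + M * M) (Q := fun υ => Keep s σ υ ∧
        υ.nat 4 s = ∑ j ∈ range N, e.eval I α (Function.update ρ x j))
        ⟨hω.1.setNat le_rfl _, ?_⟩ ?_).mono ?_ fun _ h => h
  · simp [setNat_nat, NatExpr.eval, hτ.2, hN]
  · simp [setNat_nat, NatExpr.eval]
  · simp [NatExpr.eval]
  · simp [setNat_nat, NatExpr.eval, hυ.2]
  · simp [setNat_nat, NatExpr.eval, hυ.2]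
  · simp [setNat_nat, NatExpr.eval, cell, (hυ.1.rep hr).var]
  · simp only [NatExpr.eval, cell, (hυ.1.rep hr).var]; have := hB.var x; omega
  · have hφr := (hφ.1.rep hr).setVar x 0
    refine ⟨hφ.1.real, hφr, fun k hk hk' => ?_, fun j hj => ?_, ?_, ?_, ?_, fun y hy => ?_⟩
    · rw [setNat_nat_ne _ _ _ hk', hφ.1.nat k hk]
    · rw [setNat_nat_ne _ _ _ (by omega), hφ.1.stk j hj]
    · rw [setNat_nat_ne _ _ _ (by omega), hφ.2.1]
    · rw [setNat_nat_ne _ _ _ (by omega), hφ.2.2.1]; simp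
    · rw [setNat_nat_ne _ _ _ (by omega), hφ.2.2.2]
    · rw [setNat_nat, if_neg (by simp [NatExpr.eval, hy]), hφ.1.nat 3 (by omega)]
  · simp [NatExpr.eval]
  · rintro τ ⟨-, h2, -, -, h5, -⟩
    simp [Test.Holds, NatExpr.eval, cell, stk, h2.var, h5]
  · rintro i τ hi ⟨h1, h2, h3, h4, h5, h6, h7, h8⟩
    refine ⟨by simp [Test.Holds, NatExpr.eval, cell, stk, h2.var, h5, hi], ?_⟩
    refine Runs.seq (((h₂' i hi).2 (s + 3) τ h2).mono q₂ fun _ h => h) fun υ hυ =>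
      Runs.seq (Q := fun φ => Keep (s + 1) υ φ ∧ φ.nat 4 (s + 2) = υ.nat 4 (s + 2) ∧
        φ.nat 4 (s + 1) = ∑ j ∈ range (i + 1), e.eval I α (Function.update ρ x j))
      (Runs.natSet ⟨(Keep.refl (s + 1) υ).setNat le_rfl _, ?_, ?_⟩ ?_) fun φ hφ => Runs.natSet ?_ ?_
    · simp [setNat_nat, NatExpr.eval]
    · simp [setNat_nat, NatExpr.eval, stk, hυ.2, hυ.1.stk (s + 1) (by omega), h6, sum_range_succ]
    · simp only [NatExpr.eval, stk, hυ.2, hυ.1.stk (s + 1) (by omega), h6]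
      have := hpart (i + 1) (by omega)
      rw [sum_range_succ] at this
      omega
    · have hr' := hφ.1.rep (hυ.1.rep h2)
      have h9 := hr'.setVar x (i + 1)
      rw [Function.update_idem] at h9
      simp only [NatExpr.eval, cell, hr'.var, Function.update_self]
      refine ⟨?_, h9, fun k hk hk' => ?_, fun j hj => ?_, ?_, ?_, ?_, fun y hy => ?_⟩
      · rw [setNat_real, hφ.1.real, hυ.1.real, h1]
      · rw [setNat_nat_ne _ _ _ hk', hφ.1.nat k hk, hυ.1.nat k hk, h3 k hk hk']
      · rw [setNat_nat_ne _ _ _ (by omega), hφ.1.stk j (by omega), hυ.1.stk j (by omega), h4 j hj]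
      · rw [setNat_nat_ne _ _ _ (by omega), hφ.1.stk s (by omega), hυ.1.stk s (by omega), h5]
      · rw [setNat_nat_ne _ _ _ (by omega), hφ.2.2]
      · rw [setNat_nat_ne _ _ _ (by omega), hφ.2.1, hυ.1.stk (s + 2) (by omega), h7]
      · rw [setNat_nat, if_neg (by simp [hy]), hφ.1.nat 3 (by omega),
          hυ.1.nat 3 (by omega), h8 y hy]
    · have hr' := hφ.1.rep (hυ.1.rep h2)
      simp only [NatExpr.eval, cell, hr'.var, Function.update_self]
      omega
  · obtain ⟨h1, h2, h3, h4, h5, h6, h7, h8⟩ := hχ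
    simp only [NatExpr.eval, stk, h7]
    refine ⟨⟨h1, fun k hk => ?_, fun j hj => ?_⟩, ?_⟩
    · by_cases hk' : k = 3
      · subst hk'
        funext y
        rw [setNat_nat]
        by_cases hy : y = x
        · subst hy; simp [hr.var]
        · simp [hy, h8]
      · rw [setNat_nat_ne _ _ _ hk', h3 k hk hk']
    · rw [setNat_nat_ne _ _ _ (by omega), h4 j hj]
    · rw [setNat_nat_ne _ _ _ (by omega), h6]
  · obtain ⟨h1, h2, h3, h4, h5, h6, h7, h8⟩ := hχ
    simp only [NatExpr.eval, stk, h7]; have := hB.var x; omega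
  · simp [setNat_nat, NatExpr.eval, stk, hω.2]
  · simp only [NatExpr.eval, stk, hω.2]; have := hpart N le_rfl; omega
  · have h1 : N * (M + (1 + M * M + (M + 1)) + 1) ≤ M * (M + (1 + M * M + (M + 1)) + 1) :=
      Nat.mul_le_mul_right _ (by omega)
    have h2 : M * (M + (1 + M * M + (M + 1)) + 1) = 2 * (M * M) + M ^ 3 + 3 * M := by ring
    omega

theorem Term.exists_spec (e : Term) : ∃ c, e.Spec c := by
  induction e with
  | const k =>
    refine ⟨k + 1, fun I ρ α B hB => ?_⟩
    have h : 1 + k ≤ (B + 2) ^ (k + 1) := by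
      have h1 : k + 1 < 2 ^ (k + 1) := Nat.lt_two_pow_self
      have h2 : 2 ^ (k + 1) ≤ (B + 2) ^ (k + 1) := Nat.pow_le_pow_left (by omega) _
      omega
    exact ⟨by simp only [eval]; omega, fun s σ hr => spec_set rfl h⟩
  | var x =>
    refine ⟨1, fun I ρ α B hB => ?_⟩
    have h := hB.var x
    rw [pow_one]
    exact ⟨by simp only [eval]; omega, fun s σ hr => spec_set (hr.var x)
      (by simp only [eval]; omega)⟩
  | size =>
    refine ⟨1, fun I ρ α B hB => ?_⟩
    have h := hB.size
    rw [pow_one]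
    exact ⟨by simp only [eval]; omega, fun s σ hr => spec_set hr.size
      (by simp only [eval]; omega)⟩
  | dim =>
    refine ⟨1, fun I ρ α B hB => ?_⟩
    have h := hB.dim
    rw [pow_one]
    exact ⟨by simp only [eval]; omega, fun s σ hr => spec_set hr.dim
      (by simp only [eval]; omega)⟩
  | arr A e₁ e₂ e₃ h₁ h₂ h₃ =>
    obtain ⟨c₁, h₁⟩ := h₁
    obtain ⟨c₂, h₂⟩ := h₂
    obtain ⟨c₃, h₃⟩ := h₃
    exact ⟨_, spec_arr h₁ h₂ h₃⟩
  | add e₁ e₂ h₁ h₂ =>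
    obtain ⟨c₁, h₁⟩ := h₁
    obtain ⟨c₂, h₂⟩ := h₂
    exact ⟨_, spec_binary h₁ h₂ (fun x y => x + y) .add (fun x y => by nlinarith)
      (fun _ _ _ => rfl) (fun _ _ _ => rfl) (fun _ => rfl)⟩
  | sub e₁ e₂ h₁ h₂ =>
    obtain ⟨c₁, h₁⟩ := h₁
    obtain ⟨c₂, h₂⟩ := h₂
    exact ⟨_, spec_binary h₁ h₂ (fun x y => x - y) .sub
      (fun x y => (Nat.sub_le x y).trans (by nlinarith))
      (fun _ _ _ => rfl) (fun _ _ _ => rfl) (fun _ => rfl)⟩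
  | mul e₁ e₂ h₁ h₂ =>
    obtain ⟨c₁, h₁⟩ := h₁
    obtain ⟨c₂, h₂⟩ := h₂
    exact ⟨_, spec_binary h₁ h₂ (fun x y => x * y) .mul (fun x y => by nlinarith)
      (fun _ _ _ => rfl) (fun _ _ _ => rfl) (fun _ => rfl)⟩
  | sum x b e h₁ h₂ =>
    obtain ⟨c₁, h₁⟩ := h₁
    obtain ⟨c₂, h₂⟩ := h₂
    exact spec_sum h₁ h₂
  | rlt r₁ r₂ =>
    refine ⟨2, fun I ρ α B hB => ?_⟩
    have h : 4 ≤ (B + 2) ^ 2 := by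
      rw [pow_two]; exact Nat.mul_le_mul (by omega : 2 ≤ B + 2) (by omega : 2 ≤ B + 2)
    refine ⟨by simp only [eval]; split_ifs <;> omega, fun s σ hr => ?_⟩
    by_cases hlt : r₁.eval I ρ < r₂.eval I ρ
    · refine (Runs.ite_true (T := 2) ?_ (spec_set (v := 1) rfl (by omega))).mono (by omega) ?_
      · simpa [Test.Holds, RTerm.toExpr_eval hr] using hlt
      · simp [eval, hlt]
    · refine (Runs.ite_false (T := 2) ?_ (spec_set (v := 0) rfl (by omega))).mono (by omega) ?_
      · simpa [Test.Holds, RTerm.toExpr_eval hr] using hlt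
      · simp [eval, hlt]

end SegAlg

namespace SegAlg
open RealRAM

/-! ### Statements with bounded loops -/

/-- Statements: assign to the entries `k < b` of a row of an array, sequences, bounded loops, and
conditional execution. -/
inductive Stmt : Type
  | row (A : ℕ) (e₁ e₂ : Term) (x : ℕ) (b v : Term)
  | seq (S T : Stmt)
  | rep (x : ℕ) (b : Term) (S : Stmt)
  | cond (c : Term) (S : Stmt)

/-- Assign `f k`, for all `k < m`, to the entries of a row. -/
def rowSet (α : Arrays) (A i j m : ℕ) (f : ℕ → ℕ) : Arrays := fun A' i' j' k =>
  if A' = A ∧ i' = i ∧ j' = j ∧ k < m then f k else α A' i' j' k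

/-- Apply `f 0`, …, `f (m - 1)` in this order. -/
def iter {β : Type*} (f : ℕ → β → β) : ℕ → β → β
  | 0, a => a
  | m + 1, a => f m (iter f m a)

theorem iter_induction {β : Type*} {f : ℕ → β → β} {a : β} (P : ℕ → β → Prop) (h0 : P 0 a) (m : ℕ)
    (hs : ∀ i b, i < m → P i b → P (i + 1) (f i b)) : P m (iter f m a) := by
  induction m with
  | zero => exact h0
  | succ m ih => exact hs m _ (by omega) (ih fun i b hi => hs i b (by omega))

open Classical in
/-- The effect of a statement. -/
noncomputable def Stmt.run (I : Inp) : Stmt → (ℕ → ℕ) → Arrays → Arrays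
  | .row A e₁ e₂ x b v, ρ, α => rowSet α A (e₁.eval I α ρ) (e₂.eval I α ρ) (b.eval I α ρ)
      fun k => 1 - (1 - v.eval I α (Function.update ρ x k))
  | .seq S T, ρ, α => T.run I ρ (S.run I ρ α)
  | .rep x b S, ρ, α => iter (fun i => S.run I (Function.update ρ x i)) (b.eval I α ρ) α
  | .cond c S, ρ, α => if c.eval I α ρ = 0 then α else S.run I ρ α

/-- The program that executes a statement, with the stack cells from `s` on at its disposal. -/
def Stmt.comp : ℕ → Stmt → Program
  | s, .row A e₁ e₂ x b v => .seq (e₁.comp s) <| .seq (e₂.comp (s + 1)) <| .seq (b.comp (s + 2)) <|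
      .seq (.natSet 4 (.const (s + 3)) (cell x)) <| .seq (.natSet 3 (.const x) (.const 0)) <|
      .seq (.loop (.natLt (cell x) (stk (s + 2))) <| .seq (v.comp (s + 4)) <|
        .seq (.natSet 5 (cell x) (stk (s + 4))) (incr x)) <|
      .seq (.natSet 3 (.const x) (.const 0)) <|
      .seq (.loop (.natLt (cell x) (stk (s + 2))) <|
        .seq (.natSet (A + 10) (prE (prE (stk s) (stk (s + 1))) (cell x))
          (.sub (.const 1) (.sub (.const 1) (.get 5 (cell x))))) (incr x)) <|
      .natSet 3 (.const x) (stk (s + 3))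
  | s, .seq S T => .seq (S.comp s) (T.comp s)
  | s, .rep x b S => .seq (b.comp s) <| .seq (.natSet 4 (.const (s + 1)) (cell x)) <|
      .seq (.natSet 3 (.const x) (.const 0)) <|
      .seq (.loop (.natLt (cell x) (stk s)) <| .seq (S.comp (s + 2)) (incr x)) <|
      .natSet 3 (.const x) (stk (s + 1))
  | s, .cond c S => .seq (c.comp s) <| .ite (.natLt (.const 0) (stk s)) (S.comp s) .skip

/-- The memory `τ` represents the data, and the stack below `s` is the one of `σ`. -/
def Post (s : ℕ) (σ : Store) (I : Inp) (ρ : ℕ → ℕ) (α : Arrays) (τ : Store) : Prop :=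
  Rep τ I ρ α ∧ ∀ j < s, τ.nat 4 j = σ.nat 4 j

/-- What the compiled statement does. -/
def Stmt.Spec (S : Stmt) (c : ℕ) : Prop :=
  ∀ (I : Inp) (ρ : ℕ → ℕ) (α : Arrays) (B : ℕ), Small I ρ α B →
    (∀ A i j k, S.run I ρ α A i j k ≤ 1) ∧
    ∀ (s : ℕ) (σ : Store), Rep σ I ρ α →
      Runs (S.comp s) σ ((B + 2) ^ c) (Post s σ I ρ (S.run I ρ α))

/-- The output arrays 1 and 2, the stack 4 and the buffer 5 are not part of the represented data. -/
theorem Rep.setOther {σ : Store} {I : Inp} {ρ : ℕ → ℕ} {α : Arrays} (h : Rep σ I ρ α) {k : ℕ}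
    (hk : k ≠ 0 ∧ k ≠ 3 ∧ k < 10) (i v : ℕ) : Rep (σ.setNat k i v) I ρ α := by
  obtain ⟨h1, h2, h3, h4, h5⟩ := h
  refine ⟨?_, ?_, h3, ?_, ?_⟩
  · rw [setNat_nat_ne _ _ _ (by omega), h1]
  · rw [setNat_nat_ne _ _ _ (by omega), h2]
  · intro y; rw [setNat_nat_ne _ _ _ (by omega), h4]
  · intro A i j k; rw [setNat_nat_ne _ _ _ (by omega), h5]

theorem Rep.setRow {σ : Store} {I : Inp} {ρ : ℕ → ℕ} {α : Arrays} {A i j m : ℕ} {f : ℕ → ℕ}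
    (h : Rep σ I ρ (rowSet α A i j m f)) :
    Rep (σ.setNat (A + 10) (adr i j m) (f m)) I ρ (rowSet α A i j (m + 1) f) := by
  obtain ⟨h1, h2, h3, h4, h5⟩ := h
  refine ⟨?_, ?_, h3, ?_, ?_⟩
  · rw [setNat_nat_ne _ _ _ (by omega), h1]
  · rw [setNat_nat_ne _ _ _ (by omega), h2]
  · intro y; rw [setNat_nat_ne _ _ _ (by omega), h4]
  · intro A' i' j' k
    rw [setNat_nat]
    by_cases hA : A' = A ∧ i' = i ∧ j' = j ∧ k = m
    · obtain ⟨rfl, rfl, rfl, rfl⟩ := hA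
      simp [rowSet]
    · rw [if_neg, h5]
      · unfold rowSet
        by_cases h' : A' = A ∧ i' = i ∧ j' = j
        · obtain ⟨rfl, rfl, rfl⟩ := h'
          have hk : k ≠ m := fun h => hA ⟨rfl, rfl, rfl, h⟩
          by_cases hkm : k < m
          · simp [hkm, (show k < m + 1 by omega)]
          · simp [hkm, (show ¬ k < m + 1 by omega)]
        · rw [if_neg (fun h => h' ⟨h.1, h.2.1, h.2.2.1⟩),
            if_neg (fun h => h' ⟨h.1, h.2.1, h.2.2.1⟩)]
      · rintro ⟨h6, h7⟩
        obtain ⟨h8, h9, h10⟩ := adr_inj h7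
        exact hA ⟨by omega, h8, h9, h10⟩

theorem update_self_eq (ρ : ℕ → ℕ) (x i : ℕ) :
    Function.update (Function.update ρ x i) x (ρ x) = ρ := by
  rw [Function.update_idem, Function.update_eq_self]

theorem runs_incr {σ : Store} {I : Inp} {ρ : ℕ → ℕ} {α : Arrays} {x i T : ℕ} {Q : Store → Prop}
    (h : Rep σ I (Function.update ρ x i) α) (hT : i + 2 ≤ T)
    (hQ : ∀ τ, Rep τ I (Function.update ρ x (i + 1)) α → (∀ k, k ≠ 3 → τ.nat k = σ.nat k) → Q τ) :
    Runs (incr x) σ T Q := by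
  have h9 := h.setVar x (i + 1)
  rw [Function.update_idem] at h9
  refine Runs.natSet ?_ ?_
  · simp only [NatExpr.eval, cell, h.var, Function.update_self]
    exact hQ _ h9 fun k hk => setNat_nat_ne _ _ _ hk
  · simp only [NatExpr.eval, cell, h.var, Function.update_self]; omega

/-- The new values may depend on the row that is overwritten. So a first loop collects them in the
buffer 5, and a second one copies them, cut down to bits. -/
theorem Stmt.spec_row {A x : ℕ} {e₁ e₂ b v : Term} {c₁ c₂ c₃ c₄ : ℕ} (h₁ : e₁.Spec c₁)
    (h₂ : e₂.Spec c₂) (h₃ : b.Spec c₃) (h₄ : v.Spec c₄) :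
    ∃ c, (Stmt.row A e₁ e₂ x b v).Spec c := by
  refine ⟨6 + (c₁ + c₂ + c₃ + (c₃ + 2) * c₄ + 1) * 2, fun I ρ α B hB => ?_⟩
  refine ⟨fun A' i j k => ?_, ?_⟩
  · simp only [run, rowSet]
    split_ifs
    · omega
    · exact hB.arr _ _ _ _
  intro s σ hr
  obtain ⟨v₁, r₁⟩ := h₁ I ρ α B hB
  obtain ⟨v₂, r₂⟩ := h₂ I ρ α B hB
  obtain ⟨v₃, r₃⟩ := h₃ I ρ α B hB
  have h₄' : ∀ i < b.eval I α ρ, _ := fun i hi =>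
    h₄ I (Function.update ρ x i) α _ (hB.update x (c := c₃) (i := i) (by omega))
  have hcomp := bpow_comp B c₃ c₄
  have hbig := const_mul_le_bpow B (c₁ + c₂ + c₃ + (c₃ + 2) * c₄ + 1) 6 2
  set M := (B + 2) ^ (c₁ + c₂ + c₃ + (c₃ + 2) * c₄ + 1) with hM
  have q₁ : (B + 2) ^ c₁ ≤ M := pow_le_pow_of_le B (by omega)
  have q₂ : (B + 2) ^ c₂ ≤ M := pow_le_pow_of_le B (by omega)
  have q₃ : (B + 2) ^ c₃ ≤ M := pow_le_pow_of_le B (by omega)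
  have q₄ : ((B + 2) ^ (c₃ + 1) + 2) ^ c₄ ≤ M := hcomp.trans (pow_le_pow_of_le B (by omega))
  have q₅ : B + 2 ≤ M := le_bpow B _ (by omega)
  have hx := hB.var x
  set N := b.eval I α ρ with hN
  set a₁ := e₁.eval I α ρ with ha₁
  set a₂ := e₂.eval I α ρ with ha₂
  let f : ℕ → ℕ := fun k => v.eval I α (Function.update ρ x k)
  let g : ℕ → ℕ := fun k => 1 - (1 - f k)
  let St : Store → Prop := fun τ => (∀ j < s, τ.nat 4 j = σ.nat 4 j) ∧ τ.nat 4 s = a₁ ∧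
    τ.nat 4 (s + 1) = a₂ ∧ τ.nat 4 (s + 2) = N ∧ τ.nat 4 (s + 3) = ρ x
  have hSt : ∀ τ υ : Store, υ.nat 4 = τ.nat 4 → St τ → St υ := fun τ υ h h' => by
    simp only [St, h]; exact h'
  let Inv₁ : ℕ → Store → Prop := fun i τ => Rep τ I (Function.update ρ x i) α ∧ St τ ∧
    ∀ j < i, τ.nat 5 j = f j
  let Inv₂ : ℕ → Store → Prop := fun i τ =>
    Rep τ I (Function.update ρ x i) (rowSet α A a₁ a₂ i g) ∧ St τ ∧ ∀ j < N, τ.nat 5 j = f j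
  simp only [comp]
  refine (Runs.seq (r₁ s σ hr) fun τ₁ k₁ => Runs.seq (r₂ (s + 1) τ₁ (k₁.1.rep hr)) fun τ₂ k₂ =>
    Runs.seq (r₃ (s + 2) τ₂ (k₂.1.rep (k₁.1.rep hr))) fun τ₃ k₃ =>
    Runs.seq (T₁ := 1 + B) (Q := fun τ => Rep τ I ρ α ∧ St τ) (Runs.natSet ?_ ?_) fun τ₄ k₄ =>
    Runs.seq (T₁ := 1) (Q := Inv₁ 0) (Runs.natSet ?_ ?_) fun τ₅ k₅ =>
    Runs.seq (Runs.loop (m := N) (T := M + (1 + M + (M + 1))) Inv₁ ?_ ?_ k₅) fun τ₆ k₆ =>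
    Runs.seq (T₁ := 1) (Q := Inv₂ 0) (Runs.natSet ?_ ?_) fun τ₇ k₇ =>
    Runs.seq (Runs.loop (m := N) (T := 2 + (M + 1)) Inv₂ ?_ ?_ k₇) fun τ₈ k₈ =>
    Runs.natSet (T := 1 + B) ?_ ?_).mono ?_ fun _ h => h
  · have hr₃ := k₃.1.rep (k₂.1.rep (k₁.1.rep hr))
    refine ⟨hr₃.setOther (by omega) _ _, ?_, ?_, ?_, ?_, ?_⟩
    · intro j hj
      rw [setNat_nat, if_neg (by simp only [NatExpr.eval]; omega), k₃.1.stk j (by omega),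
        k₂.1.stk j (by omega), k₁.1.stk j hj]
    · rw [setNat_nat, if_neg (by simp only [NatExpr.eval]; omega), k₃.1.stk s (by omega),
        k₂.1.stk s (by omega), k₁.2]
    · rw [setNat_nat, if_neg (by simp only [NatExpr.eval]; omega), k₃.1.stk (s + 1) (by omega),
        k₂.2]
    · rw [setNat_nat, if_neg (by simp only [NatExpr.eval]; omega), k₃.2]
    · simp [setNat_nat, NatExpr.eval, cell, hr₃.var]
  · simp only [NatExpr.eval, cell, (k₃.1.rep (k₂.1.rep (k₁.1.rep hr))).var]; omega
  · refine ⟨k₄.1.setVar x 0, hSt τ₄ _ (setNat_nat_ne _ _ _ (by omega)) k₄.2, fun j hj => by omega⟩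
  · simp [NatExpr.eval]
  · rintro τ ⟨h1, h2, h3⟩
    simp [Test.Holds, NatExpr.eval, cell, stk, h1.var, h2.2.2.2.1]
  · rintro i τ hi ⟨h1, h2, h3⟩
    refine ⟨by simp [Test.Holds, NatExpr.eval, cell, stk, h1.var, h2.2.2.2.1, hi], ?_⟩
    refine Runs.seq (((h₄' i hi).2 (s + 4) τ h1).mono q₄ fun _ h => h) fun υ hυ =>
      Runs.seq (Q := fun φ => Rep φ I (Function.update ρ x i) α ∧ St φ ∧
        ∀ j < i + 1, φ.nat 5 j = f j) (Runs.natSet ?_ ?_) fun φ hφ =>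
      runs_incr hφ.1 (by omega) fun ψ hψ hψ' => ⟨hψ, hSt φ _ (hψ' 4 (by omega)) hφ.2.1, ?_⟩
    · have hr' := hυ.1.rep h1
      refine ⟨hr'.setOther (by omega) _ _, hSt υ _ (setNat_nat_ne _ _ _ (by omega)) ⟨?_, ?_, ?_, ?_, ?_⟩,
        fun j hj => ?_⟩
      · exact fun j hj => (hυ.1.stk j (by omega)).trans (h2.1 j hj)
      · rw [hυ.1.stk s (by omega), h2.2.1]
      · rw [hυ.1.stk _ (by omega), h2.2.2.1]
      · rw [hυ.1.stk _ (by omega), h2.2.2.2.1]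
      · rw [hυ.1.stk _ (by omega), h2.2.2.2.2]
      · rw [setNat_nat]
        simp only [NatExpr.eval, cell, stk, hr'.var, Function.update_self, hυ.2]
        by_cases hji : j = i
        · subst hji; simp [f]
        · rw [if_neg (by simp [hji]), hυ.1.nat 5 (by omega), h3 j (by omega)]
    · simp only [NatExpr.eval, stk, hυ.2]
      have := (h₄' i hi).1
      omega
    · intro j hj
      rw [hψ' 5 (by omega), hφ.2.2 j hj]
  · obtain ⟨h1, h2, h3⟩ := k₆
    have h9 := h1.setVar x 0
    rw [Function.update_idem] at h9
    refine ⟨?_, hSt τ₆ _ (setNat_nat_ne _ _ _ (by omega)) h2, fun j hj => ?_⟩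
    · simp only [NatExpr.eval]
      convert h9 using 1
      funext A' i' j' k
      simp [rowSet]
    · rw [setNat_nat_ne _ _ _ (by omega), h3 j hj]
  · simp [NatExpr.eval]
  · rintro τ ⟨h1, h2, h3⟩
    simp [Test.Holds, NatExpr.eval, cell, stk, h1.var, h2.2.2.2.1]
  · rintro i τ hi ⟨h1, h2, h3⟩
    refine ⟨by simp [Test.Holds, NatExpr.eval, cell, stk, h1.var, h2.2.2.2.1, hi], ?_⟩
    have hev : (NatExpr.sub (.const 1) (.sub (.const 1) (.get 5 (cell x)))).eval τ = g i := by
      simp [NatExpr.eval, cell, h1.var, h3 i hi, g]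
    have had : (prE (prE (stk s) (stk (s + 1))) (cell x)).eval τ = adr a₁ a₂ i := by
      simp [prE_eval, stk, cell, NatExpr.eval, h1.var, h2.2.1, h2.2.2.1, adr]
    have hg : g i ≤ 1 := by simp only [g]; omega
    refine Runs.seq (T₁ := 2) (Q := fun φ => Rep φ I (Function.update ρ x i)
      (rowSet α A a₁ a₂ (i + 1) g) ∧ St φ ∧ ∀ j < N, φ.nat 5 j = f j) (Runs.natSet ?_ ?_) fun φ hφ =>
      runs_incr hφ.1 (by omega) fun ψ hψ hψ' => ⟨hψ, hSt φ _ (hψ' 4 (by omega)) hφ.2.1, ?_⟩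
    · rw [hev, had]
      refine ⟨h1.setRow, hSt τ _ (setNat_nat_ne _ _ _ (by omega)) h2, fun j hj => ?_⟩
      rw [setNat_nat_ne _ _ _ (by omega), h3 j hj]
    · rw [hev]; omega
    · intro j hj
      rw [hψ' 5 (by omega), hφ.2.2 j hj]
  · obtain ⟨h1, h2, h3⟩ := k₈
    have h9 := h1.setVar x (ρ x)
    rw [update_self_eq] at h9
    simp only [NatExpr.eval, stk, h2.2.2.2.2]
    refine ⟨h9, fun j hj => ?_⟩
    rw [setNat_nat_ne _ _ _ (by omega), h2.1 j hj]
  · simp only [NatExpr.eval, stk, k₈.2.1.2.2.2.2]; omega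
  · have h1 : N * (M + (1 + M + (M + 1)) + 1) ≤ M * (M + (1 + M + (M + 1)) + 1) :=
      Nat.mul_le_mul_right _ (by omega)
    have h2 : M * (M + (1 + M + (M + 1)) + 1) = 3 * M ^ 2 + 3 * M := by ring
    have h3 : N * (2 + (M + 1) + 1) ≤ M * (2 + (M + 1) + 1) := Nat.mul_le_mul_right _ (by omega)
    have h4 : M * (2 + (M + 1) + 1) = M ^ 2 + 4 * M := by ring
    have h5 : M ≤ M ^ 2 := by rw [pow_two]; exact Nat.le_mul_self M
    omega

/-- Repetition does not make the numbers in sight grow: after every pass the arrays still hold bits,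
so each pass obeys the same bound. -/
theorem Stmt.spec_rep {x : ℕ} {b : Term} {S : Stmt} {c₁ c₂ : ℕ} (h₁ : b.Spec c₁)
    (h₂ : S.Spec c₂) : ∃ c, (Stmt.rep x b S).Spec c := by
  refine ⟨5 + (c₁ + (c₁ + 2) * c₂ + 1) * 2, fun I ρ α B hB => ?_⟩
  obtain ⟨v₁, r₁⟩ := h₁ I ρ α B hB
  set N := b.eval I α ρ with hN
  have hsm : ∀ i ≤ N, ∀ α', (∀ A i j k, α' A i j k ≤ 1) →
      Small I (Function.update ρ x i) α' ((B + 2) ^ (c₁ + 1)) := fun i hi α' hα' => by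
    have h := hB.update x (c := c₁) (i := i) (by omega)
    exact ⟨h.size, h.dim, h.var, hα'⟩
  let F : ℕ → Arrays → Arrays := fun i => S.run I (Function.update ρ x i)
  have hbit : ∀ m ≤ N, ∀ A i j k, iter F m α A i j k ≤ 1 := by
    intro m
    induction m with
    | zero => exact fun _ => hB.arr
    | succ m ih => exact fun hm => (h₂ I _ _ _ (hsm m (by omega) _ (ih (by omega)))).1
  refine ⟨by simp only [run]; exact hbit N le_rfl, fun s σ hr => ?_⟩
  have hcomp := bpow_comp B c₁ c₂
  have hbig := const_mul_le_bpow B (c₁ + (c₁ + 2) * c₂ + 1) 5 2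
  set M := (B + 2) ^ (c₁ + (c₁ + 2) * c₂ + 1) with hM
  have q₁ : (B + 2) ^ c₁ ≤ M := pow_le_pow_of_le B (by omega)
  have q₂ : ((B + 2) ^ (c₁ + 1) + 2) ^ c₂ ≤ M := hcomp.trans (pow_le_pow_of_le B (by omega))
  have q₃ : B + 2 ≤ M := le_bpow B _ (by omega)
  have hx := hB.var x
  simp only [run, comp]
  let St : Store → Prop := fun τ => (∀ j < s, τ.nat 4 j = σ.nat 4 j) ∧ τ.nat 4 s = N ∧
    τ.nat 4 (s + 1) = ρ x
  let Inv : ℕ → Store → Prop := fun i τ => Rep τ I (Function.update ρ x i) (iter F i α) ∧ St τ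
  refine (Runs.seq (r₁ s σ hr) fun τ hτ =>
    Runs.seq (T₁ := 1 + B) (Q := fun τ => Rep τ I ρ α ∧ St τ) (Runs.natSet ?_ ?_) fun υ hυ =>
    Runs.seq (T₁ := 1) (Q := Inv 0) (Runs.natSet ?_ ?_) fun φ hφ =>
    Runs.seq (Runs.loop (m := N) (T := M + (M + 1)) Inv ?_ ?_ hφ) fun ψ hψ =>
    Runs.natSet (T := 1 + B) ?_ ?_).mono ?_ fun _ h => h
  · have hr' := hτ.1.rep hr
    refine ⟨hr'.setOther (by omega) _ _, fun j hj => ?_, ?_, ?_⟩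
    · rw [setNat_nat, if_neg (by simp only [NatExpr.eval]; omega), hτ.1.stk j hj]
    · rw [setNat_nat, if_neg (by simp only [NatExpr.eval]; omega), hτ.2]
    · simp [setNat_nat, NatExpr.eval, cell, hr'.var]
  · simp only [NatExpr.eval, cell, (hτ.1.rep hr).var]; omega
  · refine ⟨hυ.1.setVar x 0, ?_⟩
    simp only [St, setNat_nat_ne _ _ _ (show 4 ≠ 3 by omega)]
    exact hυ.2
  · simp [NatExpr.eval]
  · rintro τ ⟨h1, h2⟩
    simp [Test.Holds, NatExpr.eval, cell, stk, h1.var, h2.2.1]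
  · rintro i τ hi ⟨h1, h2⟩
    refine ⟨by simp [Test.Holds, NatExpr.eval, cell, stk, h1.var, h2.2.1, hi], ?_⟩
    refine Runs.seq (((h₂ I _ _ _ (hsm i hi.le _ (hbit i hi.le))).2 (s + 2) τ h1).mono q₂
      fun _ h => h) fun υ hυ => runs_incr hυ.1 (by omega) fun φ hφ hφ' => ⟨hφ, ?_⟩
    simp only [St, hφ' 4 (by omega)]
    refine ⟨fun j hj => ?_, ?_, ?_⟩
    · rw [hυ.2 j (by omega), h2.1 j hj]
    · rw [hυ.2 s (by omega), h2.2.1]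
    · rw [hυ.2 (s + 1) (by omega), h2.2.2]
  · obtain ⟨h1, h2⟩ := hψ
    have h9 := h1.setVar x (ρ x)
    rw [update_self_eq] at h9
    simp only [NatExpr.eval, stk, h2.2.2]
    refine ⟨h9, fun j hj => ?_⟩
    rw [setNat_nat_ne _ _ _ (by omega), h2.1 j hj]
  · simp only [NatExpr.eval, stk, hψ.2.2.2]; omega
  · have h1 : N * (M + (M + 1) + 1) ≤ M * (M + (M + 1) + 1) := Nat.mul_le_mul_right _ (by omega)
    have h2 : M * (M + (M + 1) + 1) = 2 * M ^ 2 + 2 * M := by ring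
    have h5 : M ≤ M ^ 2 := by rw [pow_two]; exact Nat.le_mul_self M
    omega

theorem Stmt.exists_spec (S : Stmt) : ∃ c, S.Spec c := by
  induction S with
  | row A e₁ e₂ x b v =>
    obtain ⟨c₁, h₁⟩ := e₁.exists_spec
    obtain ⟨c₂, h₂⟩ := e₂.exists_spec
    obtain ⟨c₃, h₃⟩ := b.exists_spec
    obtain ⟨c₄, h₄⟩ := v.exists_spec
    exact spec_row h₁ h₂ h₃ h₄
  | seq S T h₁ h₂ =>
    obtain ⟨c₁, h₁⟩ := h₁
    obtain ⟨c₂, h₂⟩ := h₂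
    refine ⟨1 + (c₁ + c₂) * 1, fun I ρ α B hB => ?_⟩
    obtain ⟨v₁, r₁⟩ := h₁ I ρ α B hB
    obtain ⟨v₂, r₂⟩ := h₂ I ρ (S.run I ρ α) B ⟨hB.size, hB.dim, hB.var, v₁⟩
    refine ⟨v₂, fun s σ hr => ?_⟩
    refine (Runs.seq (r₁ s σ hr) fun τ hτ => (r₂ s τ hτ.1).mono le_rfl fun υ hυ =>
      (⟨hυ.1, fun j hj => (hυ.2 j hj).trans (hτ.2 j hj)⟩ :
        Post s σ I ρ (T.run I ρ (S.run I ρ α)) υ)).mono ?_ fun _ h => h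
    have hbig := const_mul_le_bpow B (c₁ + c₂) 1 1
    have q₁ := pow_le_pow_of_le B (show c₁ ≤ c₁ + c₂ by omega)
    have q₂ := pow_le_pow_of_le B (show c₂ ≤ c₁ + c₂ by omega)
    simp only [pow_one] at hbig
    omega
  | rep x b S h₂ =>
    obtain ⟨c₁, h₁⟩ := b.exists_spec
    obtain ⟨c₂, h₂⟩ := h₂
    exact spec_rep h₁ h₂
  | cond c S h₂ =>
    obtain ⟨c₁, h₁⟩ := c.exists_spec
    obtain ⟨c₂, h₂⟩ := h₂
    refine ⟨2 + (c₁ + c₂) * 1, fun I ρ α B hB => ?_⟩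
    obtain ⟨v₁, r₁⟩ := h₁ I ρ α B hB
    obtain ⟨v₂, r₂⟩ := h₂ I ρ α B hB
    have hbig := const_mul_le_bpow B (c₁ + c₂) 2 1
    have q₁ := pow_le_pow_of_le B (show c₁ ≤ c₁ + c₂ by omega)
    have q₂ := pow_le_pow_of_le B (show c₂ ≤ c₁ + c₂ by omega)
    have q₃ := one_le_bpow B (c₁ + c₂)
    rw [pow_one] at hbig
    by_cases hc : c.eval I α ρ = 0
    · simp only [run, hc, if_true]
      refine ⟨hB.arr, fun s σ hr => ?_⟩
      refine (Runs.seq (T₂ := 1) (r₁ s σ hr) fun τ hτ => Runs.ite_false ?_ ⟨0, le_rfl, τ,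
        fun _ => .skip τ, hτ.1.rep hr, hτ.1.stk⟩).mono ?_ fun _ h => h
      · simp [Test.Holds, NatExpr.eval, stk, hτ.2, hc]
      · omega
    · simp only [run, hc, if_false]
      refine ⟨v₂, fun s σ hr => ?_⟩
      refine (Runs.seq (r₁ s σ hr) fun τ hτ => Runs.ite_true ?_
        ((r₂ s τ (hτ.1.rep hr)).mono le_rfl fun υ hυ => (⟨hυ.1, fun j hj =>
          (hυ.2 j hj).trans (hτ.1.stk j hj)⟩ : Post s σ I ρ (S.run I ρ α) υ))).mono ?_ fun _ h => h
      · simp [Test.Holds, NatExpr.eval, stk, hτ.2]; omega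
      · omega

/-! ### Complete programs -/

/-- Copy the values of the term `v`, as a function of the variable `x`, into the `k`-th array. -/
def output (k x : ℕ) (v : Term) : Program :=
  .seq (.natSet 3 (.const x) (.const 0)) <| .seq (.loop (.natLt (cell x) (.get 0 (.const 0))) <|
    .seq (v.comp 0) <| .seq (.natSet k (cell x) (stk 0)) (incr x)) (.natSet 3 (.const x) (.const 0))

theorem output_spec (k x : ℕ) (hk : k ≠ 0 ∧ k ≠ 3 ∧ k ≠ 4 ∧ k < 10) (v : Term) :
    ∃ c, ∀ (I : Inp) (α : Arrays) (B : ℕ), Small I (fun _ => 0) α B → ∀ σ,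
      Rep σ I (fun _ => 0) α → Runs (output k x v) σ ((B + 2) ^ c) fun τ =>
        Rep τ I (fun _ => 0) α ∧ (∀ i < I.n, τ.nat k i = v.eval I α (Function.update (fun _ => 0) x i)) ∧
        ∀ k', k' ≠ k → k' ≠ 3 → k' ≠ 4 → τ.nat k' = σ.nat k' := by
  obtain ⟨c₄, h₄⟩ := v.exists_spec
  refine ⟨5 + (1 + (1 + 2) * c₄ + 1) * 2, fun I α B hB σ hr => ?_⟩
  have hsz := hB.size
  have h₄' : ∀ i < I.n, _ := fun i hi =>
    h₄ I (Function.update (fun _ => 0) x i) α _ (hB.update x (c := 1) (i := i) (by rw [pow_one]; omega))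
  have hcomp := bpow_comp B 1 c₄
  have hbig := const_mul_le_bpow B (1 + (1 + 2) * c₄ + 1) 5 2
  set M := (B + 2) ^ (1 + (1 + 2) * c₄ + 1) with hM
  have q₂ : ((B + 2) ^ (1 + 1) + 2) ^ c₄ ≤ M := hcomp.trans (pow_le_pow_of_le B (by omega))
  have q₃ : B + 2 ≤ M := le_bpow B _ (by omega)
  let f : ℕ → ℕ := fun i => v.eval I α (Function.update (fun _ => 0) x i)
  let Inv : ℕ → Store → Prop := fun i τ => Rep τ I (Function.update (fun _ => 0) x i) α ∧
    (∀ j < i, τ.nat k j = f j) ∧ ∀ k', k' ≠ k → k' ≠ 3 → k' ≠ 4 → τ.nat k' = σ.nat k'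
  refine (Runs.seq (T₁ := 1) (Q := Inv 0) (Runs.natSet ?_ ?_) fun φ hφ =>
    Runs.seq (Runs.loop (m := I.n) (T := M + (1 + M + (M + 1))) Inv ?_ ?_ hφ) fun ψ hψ =>
    Runs.natSet (T := 1) ?_ ?_).mono ?_ fun _ h => h
  · exact ⟨hr.setVar x 0, fun j hj => by omega, fun k' h1 h2 h3 => setNat_nat_ne _ _ _ h2⟩
  · simp [NatExpr.eval]
  · rintro τ ⟨h1, -⟩
    simp [Test.Holds, NatExpr.eval, cell, h1.var, h1.size]
  · rintro i τ hi ⟨h1, h2, h3⟩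
    refine ⟨by simp [Test.Holds, NatExpr.eval, cell, h1.var, h1.size, hi], ?_⟩
    refine Runs.seq (((h₄' i hi).2 0 τ h1).mono q₂ fun _ h => h) fun υ hυ =>
      Runs.seq (Q := Inv i ⊓ fun φ => φ.nat k i = f i) (Runs.natSet ?_ ?_) fun φ hφ =>
      runs_incr hφ.1.1 (by omega) fun ψ hψ hψ' => ⟨hψ, fun j hj => ?_, fun k' h5 h6 h7 => ?_⟩
    · have hr' := hυ.1.rep h1
      refine ⟨⟨hr'.setOther (by omega) _ _, fun j hj => ?_, fun k' h5 h6 h7 => ?_⟩, ?_⟩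
      · rw [setNat_nat, if_neg, hυ.1.nat k (by omega), h2 j hj]
        simp only [NatExpr.eval, cell, hr'.var, Function.update_self]
        omega
      · rw [setNat_nat_ne _ _ _ h5, hυ.1.nat k' h7, h3 k' h5 h6 h7]
      · simp [setNat_nat, NatExpr.eval, cell, stk, hr'.var, hυ.2, f]
    · simp only [NatExpr.eval, stk, hυ.2]
      have := (h₄' i hi).1
      omega
    · rw [hψ' k (by omega)]
      by_cases hji : j = i
      · subst hji; exact hφ.2
      · exact hφ.1.2.1 j (by omega)
    · rw [hψ' k' h6, hφ.1.2.2 k' h5 h6 h7]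
  · obtain ⟨h1, h2, h3⟩ := hψ
    have h9 := h1.setVar x 0
    rw [Function.update_idem] at h9
    refine ⟨?_, fun i hi => ?_, fun k' h5 h6 h7 => ?_⟩
    · rw [show Function.update (fun _ : ℕ => 0) x 0 = fun _ => 0 from
        Function.update_eq_self x _] at h9
      exact h9
    · rw [setNat_nat_ne _ _ _ (by omega), h2 i hi]
    · rw [setNat_nat_ne _ _ _ h6, h3 k' h5 h6 h7]
  · simp [NatExpr.eval]
  · have h1 : I.n * (M + (1 + M + (M + 1)) + 1) ≤ M * (M + (1 + M + (M + 1)) + 1) :=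
      Nat.mul_le_mul_right _ (by omega)
    have h2 : M * (M + (1 + M + (M + 1)) + 1) = 3 * M ^ 2 + 3 * M := by ring
    have h5 : M ≤ M ^ 2 := by rw [pow_two]; exact Nat.le_mul_self M
    omega

/-- The input in the form used by terms. -/
noncomputable def inp {n d : ℕ} (a b : Fin n → EuclideanSpace ℝ (Fin d)) : Inp :=
  ⟨n, d, (inputStore a b).real, by
    rcases Nat.eq_zero_or_pos d with h | h
    · subst h; simp [inputStore]
    · simp [inputStore, Nat.mul_div_cancel _ h], by
    rcases Nat.eq_zero_or_pos d with h | h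
    · subst h; simp [inputStore]
    · simp [inputStore, Nat.mul_div_cancel _ h]⟩

/-- Execute a statement, starting with empty arrays, and copy the values of two terms. -/
theorem exists_program (S : Stmt) (v₁ v₂ : Term) : ∃ (P : Program) (p : Polynomial ℕ),
    ∀ (d n : ℕ) (a b : Fin n → EuclideanSpace ℝ (Fin d)) (α : Arrays),
      α = S.run (inp a b) (fun _ => 0) (fun _ _ _ _ => 0) → ∃ τ,
        (∀ w, RunsWithin w P (inputStore a b) τ (p.eval (n + d))) ∧
        (∀ i < n, τ.nat 1 i = v₁.eval (inp a b) α (Function.update (fun _ => 0) 0 i)) ∧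
        ∀ i < n, τ.nat 2 i = v₂.eval (inp a b) α (Function.update (fun _ => 0) 0 i) := by
  obtain ⟨c₀, h₀⟩ := S.exists_spec
  obtain ⟨c₁, h₁⟩ := output_spec 1 0 (by omega) v₁
  obtain ⟨c₂, h₂⟩ := output_spec 2 0 (by omega) v₂
  refine ⟨.seq (S.comp 0) (.seq (output 1 0 v₁) (output 2 0 v₂)),
    (Polynomial.X + 2) ^ c₀ + ((Polynomial.X + 2) ^ c₁ + (Polynomial.X + 2) ^ c₂),
    fun d n a b α hα => ?_⟩
  -- Variables and arrays start as zero, so `n + d` bounds all numbers in sight.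
  have hB : Small (inp a b) (fun _ => 0) (fun _ _ _ _ => 0) (n + d) :=
    ⟨Nat.le_add_right n d, Nat.le_add_left d n, fun _ => Nat.zero_le _, fun _ _ _ _ => Nat.zero_le _⟩
  have hr : Rep (inputStore a b) (inp a b) (fun _ => 0) (fun _ _ _ _ => 0) := by
    refine ⟨?_, ?_, rfl, ?_, ?_⟩ <;> simp [inputStore, inp]
  obtain ⟨v₀, r₀⟩ := h₀ _ _ _ _ hB
  rw [← hα] at v₀ r₀
  have hB' : Small (inp a b) (fun _ => 0) α (n + d) := ⟨hB.size, hB.dim, hB.var, v₀⟩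
  obtain ⟨t, ht, τ, he, hQ⟩ := Runs.seq (r₀ 0 _ hr) fun τ hτ => Runs.seq (h₁ _ _ _ hB' τ hτ.1)
    fun υ hυ => (h₂ _ _ _ hB' υ hυ.1).mono le_rfl fun φ hφ => (⟨fun i hi => by
        rw [hφ.2.2 1 (by omega) (by omega) (by omega), hυ.2.1 i hi], hφ.2.1⟩ :
      (∀ i < n, φ.nat 1 i = v₁.eval (inp a b) α (Function.update (fun _ => 0) 0 i)) ∧
        ∀ i < n, φ.nat 2 i = v₂.eval (inp a b) α (Function.update (fun _ => 0) 0 i))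
  -- The program writes no real number, so the same run with the same cost serves every charge `w`.
  exact ⟨τ, fun w => ⟨t, by simpa using ht, he w⟩, hQ⟩

end SegAlg

/-! ### Segments in coordinates -/

/-- A sequence of segments, given by the coordinates of their endpoints. -/
structure Segs where
  a : ℕ → ℕ → ℝ
  b : ℕ → ℕ → ℝ

namespace Segs

/-- The direction of a segment. -/
def dir (S : Segs) (i r : ℕ) : ℝ := S.b i r - S.a i r

/-- The vector from the first endpoint of a segment to that of another one. -/
def off (S : Segs) (i j r : ℕ) : ℝ := S.a j r - S.a i r

/-- The point of a segment with parameter `l`. -/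
def pt (S : Segs) (i : ℕ) (l : ℝ) (r : ℕ) : ℝ := S.a i r + l * S.dir i r

/-- The point `P` lies on the `i`-th segment. -/
def OnSeg (S : Segs) (P : ℕ → ℝ) (i : ℕ) : Prop := ∃ l, 0 ≤ l ∧ l ≤ 1 ∧ ∀ r, P r = S.pt i l r

/-- Two segments have a common point. -/
def Meets (S : Segs) (i j : ℕ) : Prop := ∃ P, S.OnSeg P i ∧ S.OnSeg P j

/-- Three segments have a common point. -/
def Shared (S : Segs) (i j k : ℕ) : Prop := ∃ P, S.OnSeg P i ∧ S.OnSeg P j ∧ S.OnSeg P k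

/-- A two by two minor. -/
def minor (f g : ℕ → ℝ) (p q : ℕ) : ℝ := f p * g q - f q * g p

/-- Two vectors are linearly independent. -/
def Indep (f g : ℕ → ℝ) : Prop := ∃ p q, minor f g p q ≠ 0

/-- The point `P` lies in the plane spanned by `f` and `g` at `o`. -/
def InPlane (o f g P : ℕ → ℝ) : Prop := ∃ x y, ∀ r, P r = o r + x * f r + y * g r

/-- The point `P` lies in the plane spanned by the segment `u` and the first endpoint of `v`. -/
def Plane (S : Segs) (u v : ℕ) (P : ℕ → ℝ) : Prop := InPlane (S.a u) (S.dir u) (S.off u v) P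

/-- The segment `u` and the first endpoint of `v` span a plane, and it contains the segment `t`. -/
def InPl (S : Segs) (u v t : ℕ) : Prop :=
  Indep (S.dir u) (S.off u v) ∧ S.Plane u v (S.a t) ∧ S.Plane u v (S.b t)

variable (S : Segs)

theorem onSeg_a (i : ℕ) : S.OnSeg (S.a i) i := ⟨0, le_rfl, zero_le_one, fun r => by simp [pt]⟩

theorem onSeg_b (i : ℕ) : S.OnSeg (S.b i) i := ⟨1, zero_le_one, le_rfl, fun r => by simp [pt, dir]⟩

theorem Meets.refl (i : ℕ) : S.Meets i i := ⟨_, S.onSeg_a i, S.onSeg_a i⟩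

variable {S}

theorem Meets.symm {i j : ℕ} (h : S.Meets i j) : S.Meets j i := by
  obtain ⟨P, h1, h2⟩ := h
  exact ⟨P, h2, h1⟩

theorem Indep.symm {f g : ℕ → ℝ} (h : Indep f g) : Indep g f := by
  obtain ⟨p, q, h⟩ := h
  refine ⟨q, p, ?_⟩
  convert h using 1
  unfold minor; ring

theorem Indep.eq_zero {f g : ℕ → ℝ} (h : Indep f g) {x y : ℝ} (hxy : ∀ r, x * f r + y * g r = 0) :
    x = 0 ∧ y = 0 := by
  obtain ⟨p, q, h⟩ := h
  have hp := hxy p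
  have hq := hxy q
  constructor
  · have : x * minor f g p q = 0 := by unfold minor; linear_combination g q * hp - g p * hq
    exact (mul_eq_zero.1 this).resolve_right h
  · have : y * minor f g p q = 0 := by unfold minor; linear_combination f p * hq - f q * hp
    exact (mul_eq_zero.1 this).resolve_right h

theorem exists_smul_of_not_indep {f g : ℕ → ℝ} (h : ¬ Indep f g) {p : ℕ} (hp : g p ≠ 0) :
    ∃ c, ∀ r, f r = c * g r := by
  refine ⟨f p / g p, fun r => ?_⟩
  have h1 : minor f g p r = 0 := by
    by_contra h2
    exact h ⟨p, r, h2⟩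
  unfold minor at h1
  field_simp
  linear_combination -h1

/-! #### Points of segments -/

/-- Elimination of one parameter from the coordinates `p` and `q`. It expresses the parameters of a
common point as quotients of polynomials in the input. -/
theorem cramer {i j : ℕ} {l m : ℝ} (h : ∀ r, S.pt i l r = S.pt j m r) (p q : ℕ) :
    l * minor (S.dir i) (S.dir j) p q = minor (S.off i j) (S.dir j) p q ∧
      m * minor (S.dir i) (S.dir j) p q = minor (S.off i j) (S.dir i) p q := by
  have hp := h p
  have hq := h q
  unfold pt at hp hq
  unfold minor off
  constructor
  · linear_combination S.dir j q * hp - S.dir j p * hq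
  · linear_combination S.dir i q * hp - S.dir i p * hq

/-- Any coordinate that is not constant on the segment determines the parameter, so no quantifier
over reals remains. The first alternative is needed for segments that are points. -/
theorem onSeg_iff (P : ℕ → ℝ) (i : ℕ) : S.OnSeg P i ↔ (∀ r, P r = S.a i r) ∨
    ∃ p, S.dir i p ≠ 0 ∧ 0 ≤ (P p - S.a i p) / S.dir i p ∧ (P p - S.a i p) / S.dir i p ≤ 1 ∧
      ∀ r, P r = S.a i r + (P p - S.a i p) / S.dir i p * S.dir i r := by
  constructor
  · rintro ⟨l, h0, h1, h⟩
    by_cases hd : ∀ r, S.dir i r = 0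
    · left
      intro r
      rw [h, pt, hd r, mul_zero, add_zero]
    · right
      push Not at hd
      obtain ⟨p, hp⟩ := hd
      have hl : (P p - S.a i p) / S.dir i p = l := by
        rw [h p, pt]; field_simp; ring
      refine ⟨p, hp, ?_⟩
      rw [hl]
      exact ⟨h0, h1, h⟩
  · rintro (h | ⟨p, -, h0, h1, h⟩)
    · exact ⟨0, le_rfl, zero_le_one, fun r => by rw [h, pt, zero_mul, add_zero]⟩
    · exact ⟨_, h0, h1, h⟩

/-- Two parallel segments that meet: the first one contains an endpoint of the second one, or is
contained in it. -/
theorem Meets.of_not_indep {t u : ℕ} (h : S.Meets t u) (hp : ¬ Indep (S.dir t) (S.dir u)) :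
    S.OnSeg (S.a u) t ∨ S.OnSeg (S.b u) t ∨ ∀ P, S.OnSeg P t → S.OnSeg P u := by
  obtain ⟨P, ⟨l, hl0, hl1, hl⟩, m, hm0, hm1, hm⟩ := h
  by_cases hd : ∀ r, S.dir u r = 0
  · left
    refine ⟨l, hl0, hl1, fun r => ?_⟩
    rw [← hl, hm, pt, hd, mul_zero, add_zero]
  push Not at hd
  obtain ⟨p, hpu⟩ := hd
  obtain ⟨c, hc⟩ := exists_smul_of_not_indep hp hpu
  -- On the common line, the parameter on `u` is an affine function of the parameter on `t`.
  have hpt : ∀ l' r, S.pt t l' r = S.pt u (m + (l' - l) * c) r := by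
    intro l' r
    have h1 := hl r
    have h2 := hm r
    rw [h1] at h2
    unfold pt at h2 ⊢
    rw [hc r] at h2 ⊢
    linear_combination h2
  have ha : ∀ l', 0 ≤ l' → l' ≤ 1 → m + (l' - l) * c = 0 → S.OnSeg (S.a u) t := by
    intro l' h0 h1 h2
    refine ⟨l', h0, h1, fun r => ?_⟩
    rw [hpt, h2, pt, zero_mul, add_zero]
  have hb : ∀ l', 0 ≤ l' → l' ≤ 1 → m + (l' - l) * c = 1 → S.OnSeg (S.b u) t := by
    intro l' h0 h1 h2
    refine ⟨l', h0, h1, fun r => ?_⟩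
    rw [hpt, h2, pt, one_mul, dir]; ring
  by_contra hcon
  push Not at hcon
  obtain ⟨h1, h2, Q, ⟨l', h0', h1', hQ⟩, hQu⟩ := hcon
  have hout : ¬ (0 ≤ m + (l' - l) * c ∧ m + (l' - l) * c ≤ 1) := by
    rintro ⟨h3, h4⟩
    exact hQu ⟨_, h3, h4, fun r => by rw [hQ, hpt]⟩
  -- Intermediate values: between `l` and `l'` the parameter on `u` takes every value between `m`
  -- and its value at `l'`.
  have key : ∀ z : ℝ, (m ≤ z ∧ z ≤ m + (l' - l) * c ∨
      m + (l' - l) * c ≤ z ∧ z ≤ m) → ∃ k, 0 ≤ k ∧ k ≤ 1 ∧ m + (k - l) * c = z := by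
    intro z hz
    set y := (l' - l) * c with hy
    by_cases hy0 : y = 0
    · refine ⟨l, hl0, hl1, ?_⟩
      rcases hz with hz | hz <;> linarith [hz.1, hz.2]
    · refine ⟨l + (z - m) / y * (l' - l), ?_, ?_, ?_⟩
      · have h5 : 0 ≤ (z - m) / y ∧ (z - m) / y ≤ 1 := by
          rcases hz with hz | hz
          · have : 0 < y := lt_of_le_of_ne (by linarith) (Ne.symm hy0)
            exact ⟨by apply div_nonneg <;> linarith, by rw [div_le_one this]; linarith⟩
          · have : y < 0 := lt_of_le_of_ne (by linarith) hy0
            exact ⟨by apply div_nonneg_of_nonpos <;> linarith,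
              by rw [div_le_one_of_neg this]; linarith⟩
        nlinarith [h5.1, h5.2]
      · have h5 : 0 ≤ (z - m) / y ∧ (z - m) / y ≤ 1 := by
          rcases hz with hz | hz
          · have : 0 < y := lt_of_le_of_ne (by linarith) (Ne.symm hy0)
            exact ⟨by apply div_nonneg <;> linarith, by rw [div_le_one this]; linarith⟩
          · have : y < 0 := lt_of_le_of_ne (by linarith) hy0
            exact ⟨by apply div_nonneg_of_nonpos <;> linarith,
              by rw [div_le_one_of_neg this]; linarith⟩
        nlinarith [h5.1, h5.2]
      · have : (z - m) / y * y = z - m := div_mul_cancel₀ _ hy0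
        rw [hy] at this ⊢
        linear_combination this
  -- A point of `t` outside `u` has a parameter below 0 or above 1, and on the way to it from the
  -- common point an endpoint of `u` is passed.
  by_cases hneg : m + (l' - l) * c < 0
  · obtain ⟨k, hk0, hk1, hk⟩ := key 0 (Or.inr ⟨hneg.le, hm0⟩)
    exact h1 (ha k hk0 hk1 hk)
  · have hpos : 1 < m + (l' - l) * c := by
      by_contra h3
      exact hout ⟨not_lt.1 hneg, not_lt.1 h3⟩
    obtain ⟨k, hk0, hk1, hk⟩ := key 1 (Or.inl ⟨hm1, hpos.le⟩)
    exact h2 (hb k hk0 hk1 hk)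

/-- For independent directions, Cramer's rule produces the only possible common point. For parallel
segments that meet, `Meets.of_not_indep` shows that one of the four endpoints lies on the other
segment. -/
theorem meets_iff (i j : ℕ) : S.Meets i j ↔
    (S.OnSeg (S.a i) j ∨ S.OnSeg (S.b i) j ∨ S.OnSeg (S.a j) i ∨ S.OnSeg (S.b j) i) ∨
    ∃ p q, minor (S.dir i) (S.dir j) p q ≠ 0 ∧
      (0 ≤ minor (S.off i j) (S.dir j) p q / minor (S.dir i) (S.dir j) p q ∧
        minor (S.off i j) (S.dir j) p q / minor (S.dir i) (S.dir j) p q ≤ 1) ∧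
      (0 ≤ minor (S.off i j) (S.dir i) p q / minor (S.dir i) (S.dir j) p q ∧
        minor (S.off i j) (S.dir i) p q / minor (S.dir i) (S.dir j) p q ≤ 1) ∧
      ∀ r, S.a i r + minor (S.off i j) (S.dir j) p q / minor (S.dir i) (S.dir j) p q * S.dir i r =
        S.a j r + minor (S.off i j) (S.dir i) p q / minor (S.dir i) (S.dir j) p q * S.dir j r := by
  constructor
  · intro h
    by_cases hi : Indep (S.dir i) (S.dir j)
    · right
      obtain ⟨p, q, hpq⟩ := hi
      obtain ⟨P, ⟨l, hl0, hl1, hl⟩, m, hm0, hm1, hm⟩ := h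
      have hlm : ∀ r, S.pt i l r = S.pt j m r := fun r => by rw [← hl, hm]
      obtain ⟨h1, h2⟩ := cramer hlm p q
      refine ⟨p, q, hpq, ?_⟩
      rw [← h1, ← h2, mul_div_cancel_right₀ _ hpq, mul_div_cancel_right₀ _ hpq]
      exact ⟨⟨hl0, hl1⟩, ⟨hm0, hm1⟩, hlm⟩
    · left
      rcases h.of_not_indep hi with h1 | h1 | h1
      · exact Or.inr (Or.inr (Or.inl h1))
      · exact Or.inr (Or.inr (Or.inr h1))
      · exact Or.inl (h1 _ (S.onSeg_a i))
  · rintro ((h | h | h | h) | ⟨p, q, -, ⟨hl0, hl1⟩, ⟨hm0, hm1⟩, h⟩)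
    · exact ⟨_, S.onSeg_a i, h⟩
    · exact ⟨_, S.onSeg_b i, h⟩
    · exact ⟨_, h, S.onSeg_a j⟩
    · exact ⟨_, h, S.onSeg_b j⟩
    · exact ⟨_, ⟨_, hl0, hl1, fun _ => rfl⟩, _, hm0, hm1, h⟩

theorem OnSeg.unique {t u : ℕ} (hi : Indep (S.dir t) (S.dir u)) {P P' : ℕ → ℝ} (h1 : S.OnSeg P t)
    (h2 : S.OnSeg P u) (h3 : S.OnSeg P' t) (h4 : S.OnSeg P' u) : P = P' := by
  obtain ⟨p, q, hpq⟩ := hi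
  obtain ⟨l, -, -, hl⟩ := h1
  obtain ⟨m, -, -, hm⟩ := h2
  obtain ⟨l', -, -, hl'⟩ := h3
  obtain ⟨m', -, -, hm'⟩ := h4
  have e1 := (cramer (fun r => by rw [← hl, hm] : ∀ r, S.pt t l r = S.pt u m r) p q).1
  have e2 := (cramer (fun r => by rw [← hl', hm'] : ∀ r, S.pt t l' r = S.pt u m' r) p q).1
  have : l = l' := mul_right_cancel₀ hpq (e1.trans e2.symm)
  funext r
  rw [hl, hl', this]

/-- A test for three segments to have a common point. -/
theorem shared_iff {u t y : ℕ} (ht : Indep (S.dir u) (S.dir t)) (hy : Indep (S.dir u) (S.dir y))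
    (hut : S.Meets u t) (huy : S.Meets u y) : S.Shared u t y ↔
    ∃ p q, minor (S.dir u) (S.dir t) p q ≠ 0 ∧ ∃ p' q', minor (S.dir u) (S.dir y) p' q' ≠ 0 ∧
      minor (S.off u t) (S.dir t) p q / minor (S.dir u) (S.dir t) p q =
        minor (S.off u y) (S.dir y) p' q' / minor (S.dir u) (S.dir y) p' q' := by
  obtain ⟨P, ⟨l, hl0, hl1, hl⟩, m, hm0, hm1, hm⟩ := hut
  obtain ⟨P', ⟨l', hl0', hl1', hl'⟩, m', hm0', hm1', hm'⟩ := huy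
  -- Every nonzero minor yields the parameter on `u` of the common point, so a single choice of
  -- coordinates suffices for the comparison.
  have e1 : ∀ p q, minor (S.dir u) (S.dir t) p q ≠ 0 →
      minor (S.off u t) (S.dir t) p q / minor (S.dir u) (S.dir t) p q = l := fun p q h => by
    rw [← (cramer (fun r => by rw [← hl, hm] : ∀ r, S.pt u l r = S.pt t m r) p q).1,
      mul_div_cancel_right₀ _ h]
  have e2 : ∀ p q, minor (S.dir u) (S.dir y) p q ≠ 0 →
      minor (S.off u y) (S.dir y) p q / minor (S.dir u) (S.dir y) p q = l' := fun p q h => by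
    rw [← (cramer (fun r => by rw [← hl', hm'] : ∀ r, S.pt u l' r = S.pt y m' r) p q).1,
      mul_div_cancel_right₀ _ h]
  constructor
  · rintro ⟨Q, h1, h2, h3⟩
    obtain ⟨p, q, hpq⟩ := id ht
    obtain ⟨p', q', hpq'⟩ := id hy
    refine ⟨p, q, hpq, p', q', hpq', ?_⟩
    obtain ⟨k, -, -, hk⟩ := h1
    obtain ⟨k2, -, -, hk2⟩ := h2
    obtain ⟨k3, -, -, hk3⟩ := h3
    rw [← (cramer (fun r => by rw [← hk, hk2] : ∀ r, S.pt u k r = S.pt t k2 r) p q).1,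
      ← (cramer (fun r => by rw [← hk, hk3] : ∀ r, S.pt u k r = S.pt y k3 r) p' q').1,
      mul_div_cancel_right₀ _ hpq, mul_div_cancel_right₀ _ hpq']
  · rintro ⟨p, q, hpq, p', q', hpq', h⟩
    rw [e1 p q hpq, e2 p' q' hpq'] at h
    refine ⟨P, ⟨l, hl0, hl1, hl⟩, ⟨m, hm0, hm1, hm⟩, m', hm0', hm1', fun r => ?_⟩
    rw [hl, h, ← hl', hm']

/-! #### Planes -/

/-- A plane is closed under affine combinations. This form, a point plus multiples of two
differences, covers both points of a line (`y = 0`) and points given by two spanning segments. -/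
theorem InPlane.comb {o f g P Q R T U V : ℕ → ℝ} (hP : InPlane o f g P) (hQ : InPlane o f g Q)
    (hR : InPlane o f g R) (hT : InPlane o f g T) (hU : InPlane o f g U) {x y : ℝ}
    (hV : ∀ r, V r = P r + x * (R r - Q r) + y * (U r - T r)) : InPlane o f g V := by
  obtain ⟨x1, y1, h1⟩ := hP
  obtain ⟨x2, y2, h2⟩ := hQ
  obtain ⟨x3, y3, h3⟩ := hR
  obtain ⟨x4, y4, h4⟩ := hT
  obtain ⟨x5, y5, h5⟩ := hU
  refine ⟨x1 + x * (x3 - x2) + y * (x5 - x4), y1 + x * (y3 - y2) + y * (y5 - y4), fun r => ?_⟩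
  rw [hV, h1, h2, h3, h4, h5]; ring

/-- Cramer's rule in the coordinates `p` and `q` gives the coefficients; the remaining coordinates
are then conditions, written without division. -/
theorem inPlane_iff {o f g : ℕ → ℝ} {p q : ℕ} (h : minor f g p q ≠ 0) (P : ℕ → ℝ) :
    InPlane o f g P ↔ ∀ r, (P r - o r) * minor f g p q =
      ((P p - o p) * g q - (P q - o q) * g p) * f r +
        (f p * (P q - o q) - f q * (P p - o p)) * g r := by
  constructor
  · rintro ⟨x, y, hP⟩ r
    rw [hP r, hP p, hP q, minor]; ring
  · intro hr
    refine ⟨((P p - o p) * g q - (P q - o q) * g p) / minor f g p q,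
      (f p * (P q - o q) - f q * (P p - o p)) / minor f g p q, fun r => ?_⟩
    have := hr r
    field_simp
    linear_combination this

/-- The test for a segment to lie in a plane. -/
theorem inPl_iff (u v t : ℕ) : S.InPl u v t ↔ ∃ p q, minor (S.dir u) (S.off u v) p q ≠ 0 ∧ ∀ r,
    ((S.a t r - S.a u r) * minor (S.dir u) (S.off u v) p q =
      ((S.a t p - S.a u p) * S.off u v q - (S.a t q - S.a u q) * S.off u v p) * S.dir u r +
      (S.dir u p * (S.a t q - S.a u q) - S.dir u q * (S.a t p - S.a u p)) * S.off u v r) ∧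
    ((S.b t r - S.a u r) * minor (S.dir u) (S.off u v) p q =
      ((S.b t p - S.a u p) * S.off u v q - (S.b t q - S.a u q) * S.off u v p) * S.dir u r +
      (S.dir u p * (S.b t q - S.a u q) - S.dir u q * (S.b t p - S.a u p)) * S.off u v r) := by
  constructor
  · rintro ⟨⟨p, q, h⟩, h1, h2⟩
    exact ⟨p, q, h, fun r => ⟨(inPlane_iff h _).1 h1 r, (inPlane_iff h _).1 h2 r⟩⟩
  · rintro ⟨p, q, h, h1⟩
    exact ⟨⟨p, q, h⟩, (inPlane_iff h _).2 fun r => (h1 r).1, (inPlane_iff h _).2 fun r => (h1 r).2⟩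

/-- Two coordinates with a nonzero minor are a coordinate system of the plane. -/
theorem InPlane.eq_of_coords {o f g P Q : ℕ → ℝ} {p q : ℕ} (h : minor f g p q ≠ 0)
    (hP : InPlane o f g P) (hQ : InPlane o f g Q) (hp : P p = Q p) (hq : P q = Q q) : P = Q := by
  funext r
  have h1 := (inPlane_iff h P).1 hP r
  have h2 := (inPlane_iff h Q).1 hQ r
  rw [hp, hq] at h1
  have := mul_right_cancel₀ h (h1.trans h2.symm)
  linarith

theorem InPl.plane {u v t : ℕ} (h : S.InPl u v t) {P : ℕ → ℝ} (hP : S.OnSeg P t) :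
    S.Plane u v P := by
  obtain ⟨-, h1, h2⟩ := h
  obtain ⟨l, -, -, hl⟩ := hP
  exact InPlane.comb (x := l) (y := 0) h1 h1 h2 h1 h1 fun r => by rw [hl, pt, dir]; ring

/-- A segment with two points in a plane lies in it. -/
theorem inPl_of_two_points {u v t : ℕ} (hi : Indep (S.dir u) (S.off u v)) {P Q : ℕ → ℝ}
    (hP : S.OnSeg P t) (hQ : S.OnSeg Q t) (hP' : S.Plane u v P) (hQ' : S.Plane u v Q)
    (hne : P ≠ Q) : S.InPl u v t := by
  obtain ⟨l, -, -, hl⟩ := hP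
  obtain ⟨m, -, -, hm⟩ := hQ
  have hlm : m - l ≠ 0 := by
    intro h
    apply hne
    have : m = l := by linarith
    funext r
    rw [hl, hm, this]
  refine ⟨hi, InPlane.comb (x := -l / (m - l)) (y := 0) hP' hP' hQ' hP' hP' fun r => ?_,
    InPlane.comb (x := (1 - l) / (m - l)) (y := 0) hP' hP' hQ' hP' hP' fun r => ?_⟩
  · rw [hl, hm, pt, pt]
    field_simp
    ring
  · rw [hl, hm, pt, pt]
    have : S.b t r = S.a t r + S.dir t r := by rw [dir]; ring
    rw [this]
    field_simp
    ring

theorem plane_self {u v : ℕ} {P : ℕ → ℝ} (hP : S.OnSeg P u) : S.Plane u v P := by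
  obtain ⟨l, -, -, hl⟩ := hP
  exact ⟨l, 0, fun r => by rw [hl, pt]; ring⟩

/-- A segment that meets two coplanar disjoint segments lies in their plane. -/
theorem InPl.of_meets {u v t : ℕ} (h : S.InPl u v v) (huv : ¬ S.Meets u v) (hu : S.Meets t u)
    (hv : S.Meets t v) : S.InPl u v t := by
  obtain ⟨P, hP, hP'⟩ := hu
  obtain ⟨Q, hQ, hQ'⟩ := hv
  refine inPl_of_two_points h.1 hP hQ (plane_self hP') (h.plane hQ') ?_
  rintro rfl
  exact huv ⟨P, hP', hQ'⟩

/-- Segments that meet a segment `w` transversal to a plane in which they lie meet each other. -/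
theorem meets_of_not_inPl {u v w t t' : ℕ} (hw : ¬ S.InPl u v w) (ht : S.InPl u v t)
    (ht' : S.InPl u v t') (h : S.Meets t w) (h' : S.Meets t' w) : S.Meets t t' := by
  obtain ⟨P, hP, hP'⟩ := h
  obtain ⟨Q, hQ, hQ'⟩ := h'
  -- Two different points of `w` in the plane would force `w` into it.
  by_cases hne : P = Q
  · subst hne; exact ⟨P, hP, hQ⟩
  · exact (hw (inPl_of_two_points ht.1 hP' hQ' (ht.plane hP) (ht'.plane hQ) hne)).elim

/-- Two planes that contain two transversal segments with a common point coincide. -/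
theorem InPl.plane_unique {u v u' v' x m t : ℕ} (hi : Indep (S.dir x) (S.dir m))
    (hxm : S.Meets x m) (hx : S.InPl u v x) (hm : S.InPl u v m) (hx' : S.InPl u' v' x)
    (hm' : S.InPl u' v' m) (ht : S.InPl u v t) : S.InPl u' v' t := by
  obtain ⟨Z, hZ, -⟩ := hxm
  have hZ' := hx'.plane hZ
  obtain ⟨z1, z2, hz⟩ := hx.plane hZ
  obtain ⟨p, q, hpq⟩ := hi
  obtain ⟨x1, y1, e1⟩ := hx.2.1
  obtain ⟨x2, y2, e2⟩ := hx.2.2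
  obtain ⟨x3, y3, e3⟩ := hm.2.1
  obtain ⟨x4, y4, e4⟩ := hm.2.2
  set f := S.dir u
  set g := S.off u v
  have dx : ∀ r, S.dir x r = (x2 - x1) * f r + (y2 - y1) * g r := fun r => by
    rw [dir, e1, e2]; ring
  have dm : ∀ r, S.dir m r = (x4 - x3) * f r + (y4 - y3) * g r := fun r => by
    rw [dir, e3, e4]; ring
  -- The independent directions of `x` and `m` have a nonzero determinant with respect to `f` and
  -- `g`, so they span the plane too.
  have hδ : (x2 - x1) * (y4 - y3) - (y2 - y1) * (x4 - x3) ≠ 0 := by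
    intro h0
    apply hpq
    rw [minor, dx, dx, dm, dm]
    linear_combination (f p * g q - f q * g p) * h0
  have key : ∀ P, S.Plane u v P → S.Plane u' v' P := by
    rintro P ⟨w1, w2, hw⟩
    replace hw : ∀ r, P r = S.a u r + w1 * f r + w2 * g r := hw
    replace hz : ∀ r, Z r = S.a u r + z1 * f r + z2 * g r := hz
    -- The coefficients of `P - Z` with respect to the directions of `x` and `m`.
    refine InPlane.comb (P := Z)
      (x := ((w1 - z1) * (y4 - y3) - (w2 - z2) * (x4 - x3)) /
        ((x2 - x1) * (y4 - y3) - (y2 - y1) * (x4 - x3)))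
      (y := ((x2 - x1) * (w2 - z2) - (y2 - y1) * (w1 - z1)) /
        ((x2 - x1) * (y4 - y3) - (y2 - y1) * (x4 - x3))) hZ' hx'.2.1 hx'.2.2 hm'.2.1 hm'.2.2
      fun r => ?_
    have h1 := dx r
    have h2 := dm r
    rw [dir] at h1 h2
    rw [h1, h2, hw, hz, div_mul_eq_mul_div, div_mul_eq_mul_div,
      add_assoc (S.a u r + z1 * f r + z2 * g r), ← add_div,
      show ((w1 - z1) * (y4 - y3) - (w2 - z2) * (x4 - x3)) * ((x2 - x1) * f r + (y2 - y1) * g r) +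
        ((x2 - x1) * (w2 - z2) - (y2 - y1) * (w1 - z1)) * ((x4 - x3) * f r + (y4 - y3) * g r) =
        ((x2 - x1) * (y4 - y3) - (y2 - y1) * (x4 - x3)) * ((w1 - z1) * f r + (w2 - z2) * g r) by
          ring, mul_div_cancel_left₀ _ hδ]
    ring
  exact ⟨hx'.1, key _ ht.2.1, key _ ht.2.2⟩

/-! #### Skew pairs -/

/-- Two disjoint segments that are met by a common transversal and are not coplanar have linearly
independent directions and offset. -/
theorem skew_indep {u v t : ℕ} (huv : ¬ S.Meets u v) (htu : S.Meets t u) (htv : S.Meets t v)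
    (iu : Indep (S.dir t) (S.dir u)) (iv : Indep (S.dir t) (S.dir v)) (h1 : ¬ S.InPl u v v)
    (h2 : ¬ S.InPl v u u) {x y z : ℝ}
    (h : ∀ r, x * S.dir u r + y * S.dir v r + z * S.off u v r = 0) : x = 0 ∧ y = 0 ∧ z = 0 := by
  obtain ⟨P, ⟨l, -, -, hl⟩, hPu⟩ := htu
  obtain ⟨Q, ⟨l', -, -, hl'⟩, hQv⟩ := htv
  obtain ⟨m, -, -, hm⟩ := id hPu
  obtain ⟨m', -, -, hm'⟩ := id hQv
  have hu : ∃ p, S.dir u p ≠ 0 := by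
    obtain ⟨p, q, h⟩ := iu
    by_contra h0
    push Not at h0
    exact h (by simp [minor, h0])
  have hv : ∃ p, S.dir v p ≠ 0 := by
    obtain ⟨p, q, h⟩ := iv
    by_contra h0
    push Not at h0
    exact h (by simp [minor, h0])
  -- The vector from `P` to `Q`, computed once along `t` and once along `u`, the offset and `v`.
  have hrel : ∀ r, (l' - l) * S.dir t r =
      S.off u v r + m' * S.dir v r - m * S.dir u r := by
    intro r
    have e1 := hl r
    have e2 := hm r
    have e3 := hl' r
    have e4 := hm' r
    simp only [pt] at e1 e2 e3 e4
    rw [off]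
    linear_combination e4 - e3 + e1 - e2
  by_cases hi : Indep (S.dir u) (S.off u v)
  -- With `y ≠ 0` the relation could be solved for the direction of `v`, and `v` would lie in the
  -- plane.
  · have hy : y = 0 := by
      by_contra hy
      refine h1 ⟨hi, ⟨0, 1, fun r => by rw [off]; ring⟩, -(x / y), 1 - z / y, fun r => ?_⟩
      have h3 := h r
      have : S.b v r = S.a v r + S.dir v r := by rw [dir]; ring
      rw [this]
      simp only [off] at h3 ⊢
      field_simp
      linear_combination h3
    subst hy
    have := hi.eq_zero (x := x) (y := z) fun r => by linear_combination h r
    exact ⟨this.1, rfl, this.2⟩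
  · by_cases hi' : Indep (S.dir v) (S.off v u)
    · have hx : x = 0 := by
        by_contra hx
        refine h2 ⟨hi', ⟨0, 1, fun r => by rw [off]; ring⟩, -(y / x), 1 + z / x, fun r => ?_⟩
        have h3 := h r
        have : S.b u r = S.a u r + S.dir u r := by rw [dir]; ring
        rw [this]
        simp only [off] at h3 ⊢
        field_simp
        linear_combination h3
      subst hx
      have := hi'.eq_zero (x := y) (y := -z) fun r => by
        have := h r; simp only [off] at this ⊢; linear_combination this
      exact ⟨rfl, this.1, by linarith [this.2]⟩
    -- Here the offset is parallel to both directions. Either the two segments have a common point,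
    -- or they lie on one line which `t` meets in two different points, so `t` is parallel to `u`.
    · exfalso
      obtain ⟨p, hp⟩ := hu
      obtain ⟨p', hp'⟩ := hv
      obtain ⟨c, hc⟩ := exists_smul_of_not_indep (fun h => hi h.symm) hp
      obtain ⟨c', hc'⟩ := exists_smul_of_not_indep (fun h => hi' h.symm) hp'
      have hoff : ∀ r, S.off v u r = - S.off u v r := fun r => by simp [off]
      by_cases hl0 : l' - l = 0
      · have hPQ : P = Q := by
          funext r
          rw [hl, hl', show l' = l by linarith]
        exact huv ⟨P, hPu, hPQ ▸ hQv⟩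
      · by_cases hc0 : c' = 0
        · refine huv ⟨S.a u, S.onSeg_a u, ?_⟩
          have : S.a u = S.a v := by
            funext r
            have h3 := hc' r
            rw [hc0, zero_mul, off] at h3
            linarith
          rw [this]
          exact S.onSeg_a v
        · have hdv : ∀ r, S.dir v r = -(c / c') * S.dir u r := fun r => by
            have h3 := hc r
            have h4 := hc' r
            rw [hoff] at h4
            field_simp
            linear_combination -h3 - h4
          obtain ⟨p, q, hpq⟩ := iu
          have h3 := hrel p
          have h4 := hrel q
          rw [hc, hdv] at h3 h4
          have : (l' - l) * minor (S.dir t) (S.dir u) p q = 0 := by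
            unfold minor
            linear_combination S.dir u q * h3 - S.dir u p * h4
          exact hpq ((mul_eq_zero.1 this).resolve_left hl0)

/-- Two transversals of two skew segments that meet do so on one of the two segments. -/
theorem shared_of_skew {u v t t' : ℕ} (huv : ¬ S.Meets u v)
    (hi : ∀ x y z, (∀ r, x * S.dir u r + y * S.dir v r + z * S.off u v r = 0) →
      x = 0 ∧ y = 0 ∧ z = 0) (htu : S.Meets t u) (htv : S.Meets t v) (htu' : S.Meets t' u)
    (htv' : S.Meets t' v) (h : S.Meets t t') : S.Shared u t t' ∨ S.Shared v t t' := by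
  obtain ⟨P, hPt, hPu⟩ := htu
  obtain ⟨Q, hQt, hQv⟩ := htv
  obtain ⟨P', hPt', hPu'⟩ := htu'
  obtain ⟨Q', hQt', hQv'⟩ := htv'
  obtain ⟨Z, hZ, hZ'⟩ := h
  by_contra hcon
  push Not at hcon
  have hP : P ≠ P' := fun h => hcon.1 ⟨P, hPu, hPt, h ▸ hPt'⟩
  have hQ : Q ≠ Q' := fun h => hcon.2 ⟨Q, hQv, hQt, h ▸ hQt'⟩
  -- Since `u` and `v` are disjoint, the points of a transversal on them are different and span its
  -- line.
  have hline : ∀ {s : ℕ} {P Q Z : ℕ → ℝ}, S.OnSeg P u → S.OnSeg Q v → S.OnSeg P s → S.OnSeg Q s →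
      S.OnSeg Z s → ∃ x, ∀ r, Z r = P r + x * (Q r - P r) := by
    rintro s P Q Z hPu hQv ⟨l, -, -, hl⟩ ⟨m, -, -, hm⟩ ⟨k, -, -, hk⟩
    have hne : m - l ≠ 0 := fun h => huv ⟨P, hPu, by
      have : P = Q := by funext r; rw [hl, hm, show m = l by linarith]
      exact this ▸ hQv⟩
    refine ⟨(k - l) / (m - l), fun r => ?_⟩
    rw [hl, hm, hk, pt, pt, pt]
    field_simp
    ring
  obtain ⟨x, hx⟩ := hline hPu hQv hPt hQt hZ
  obtain ⟨y, hy⟩ := hline hPu' hQv' hPt' hQt' hZ'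
  obtain ⟨l, -, -, hl⟩ := hPu
  obtain ⟨l', -, -, hl'⟩ := hPu'
  obtain ⟨m, -, -, hm⟩ := hQv
  obtain ⟨m', -, -, hm'⟩ := hQv'
  have hll : l - l' ≠ 0 := fun h => hP (by funext r; rw [hl, hl', show l = l' by linarith])
  have hmm : m - m' ≠ 0 := fun h => hQ (by funext r; rw [hm, hm', show m = m' by linarith])
  -- The two descriptions of `Z` give a linear relation between the directions of `u` and `v` and
  -- the offset. Its coefficients vanish, so `x = y`, `(1 - x) * (l - l') = 0` and `x * (m - m') =
  -- 0`, which is impossible.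
  obtain ⟨h1, h2, h3⟩ := hi ((1 - x) * l - (1 - y) * l') (x * m - y * m') (x - y) fun r => by
    have h1 := hx r
    have h2 := hy r
    rw [hl, hm] at h1
    rw [hl', hm', h1] at h2
    simp only [pt] at h2
    simp only [off]
    linear_combination h2
  have hxy : x = y := by linarith
  subst hxy
  have h4 : x = 0 := (mul_eq_zero.1 (by linear_combination h2 : x * (m - m') = 0)).resolve_right hmm
  subst h4
  exact hll (by linarith)

end Segs

namespace Segs

variable (S : Segs)

/-! #### Four partial orders on the segments of a plane -/

/-- The coordinates `p` and `q` are the first ones that separate the points of the plane. -/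
def Coord (u v p q : ℕ) : Prop := minor (S.dir u) (S.off u v) p q ≠ 0 ∧
  ∀ p' q', minor (S.dir u) (S.off u v) p' q' ≠ 0 → p < p' ∨ p = p' ∧ q ≤ q'

/-- On every common vertical line, `s` is below `t`. -/
def Below (p q s t : ℕ) : Prop :=
  ∀ P P', S.OnSeg P s → S.OnSeg P' t → P p = P' p → P q < P' q

/-- The left end of `s` is not to the right of the left end of `t`. -/
def LeftLe (p s t : ℕ) : Prop :=
  min (S.a s p) (S.b s p) ≤ min (S.a t p) (S.b t p)

/-- The right end of `s` is not to the right of the right end of `t`. -/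
def RightLe (p s t : ℕ) : Prop :=
  max (S.a s p) (S.b s p) ≤ max (S.a t p) (S.b t p)

/-- The four orders in given coordinates. -/
def Ord (p q o s t : ℕ) : Prop :=
  S.RightLe p s t ∧ (if o < 2 then S.LeftLe p s t else S.LeftLe p t s) ∧
    (if o % 2 = 0 then S.Below p q s t else S.Below p q t s)

/-- The four orders in the coordinates of a plane. -/
def Lt (u v o s t : ℕ) : Prop := ∃ p q, S.Coord u v p q ∧ ¬ S.Meets s t ∧ S.Ord p q o s t

variable {S}

theorem Coord.unique {u v p q p' q' : ℕ} (h : S.Coord u v p q) (h' : S.Coord u v p' q') :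
    p = p' ∧ q = q' := by
  have h1 := h.2 _ _ h'.1
  have h2 := h'.2 _ _ h.1
  omega

theorem exists_coord {u v : ℕ} (h : Indep (S.dir u) (S.off u v)) : ∃ p q, S.Coord u v p q := by
  classical
  refine ⟨Nat.find h, Nat.find (Nat.find_spec h), Nat.find_spec (Nat.find_spec h), ?_⟩
  intro p' q' h'
  rcases lt_or_eq_of_le (Nat.find_min' h ⟨q', h'⟩) with h1 | h1
  · exact Or.inl h1
  · refine Or.inr ⟨h1, Nat.find_min' _ ?_⟩
    rw [h1]; exact h'

theorem OnSeg.mem_Icc {P : ℕ → ℝ} {i : ℕ} (h : S.OnSeg P i) (p : ℕ) :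
    min (S.a i p) (S.b i p) ≤ P p ∧ P p ≤ max (S.a i p) (S.b i p) := by
  obtain ⟨l, h0, h1, h⟩ := h
  rw [h, pt, dir]
  rcases le_total (S.a i p) (S.b i p) with h2 | h2
  · rw [min_eq_left h2, max_eq_right h2]; constructor <;> nlinarith
  · rw [min_eq_right h2, max_eq_left h2]; constructor <;> nlinarith

/-- The parameter of the point with a given coordinate. -/
theorem exists_onSeg (i p : ℕ) {x : ℝ} (h : min (S.a i p) (S.b i p) ≤ x)
    (h' : x ≤ max (S.a i p) (S.b i p)) : ∃ P, S.OnSeg P i ∧ P p = x ∧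
      ∀ q, P q = S.a i q + (x - S.a i p) / S.dir i p * S.dir i q := by
  have hx : 0 ≤ (x - S.a i p) / S.dir i p ∧ (x - S.a i p) / S.dir i p ≤ 1 ∧
      S.a i p + (x - S.a i p) / S.dir i p * S.dir i p = x := by
    unfold dir
    rcases lt_trichotomy (S.a i p) (S.b i p) with h2 | h2 | h2
    · rw [min_eq_left h2.le] at h
      rw [max_eq_right h2.le] at h'
      have h3 : 0 < S.b i p - S.a i p := by linarith
      exact ⟨by apply div_nonneg <;> linarith, by rw [div_le_one h3]; linarith,
        by rw [div_mul_cancel₀ _ h3.ne']; ring⟩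
    -- On a vertical segment the quotient has denominator zero and equals 0 by convention, which is
    -- an admissible parameter.
    · rw [h2, min_self] at h
      rw [h2, max_self] at h'
      rw [h2, sub_self, div_zero]
      exact ⟨le_rfl, zero_le_one, by linarith⟩
    · rw [min_eq_right h2.le] at h
      rw [max_eq_left h2.le] at h'
      have h3 : S.b i p - S.a i p < 0 := by linarith
      exact ⟨by apply div_nonneg_of_nonpos <;> linarith, by rw [div_le_one_of_neg h3]; linarith,
        by rw [div_mul_cancel₀ _ h3.ne]; ring⟩
  exact ⟨S.pt i ((x - S.a i p) / S.dir i p), ⟨_, hx.1, hx.2.1, fun _ => rfl⟩, hx.2.2, fun _ => rfl⟩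

theorem Below.not_meets {p q s t : ℕ} (h : S.Below p q s t) : ¬ S.Meets s t := by
  rintro ⟨P, h1, h2⟩
  exact lt_irrefl _ (h P P h1 h2 rfl)

theorem OnSeg.convex {i : ℕ} {P Q : ℕ → ℝ} (hP : S.OnSeg P i) (hQ : S.OnSeg Q i) {x : ℝ}
    (h0 : 0 ≤ x) (h1 : x ≤ 1) : S.OnSeg (fun r => P r + x * (Q r - P r)) i := by
  obtain ⟨l, l0, l1, hl⟩ := hP
  obtain ⟨m, m0, m1, hm⟩ := hQ
  refine ⟨l + x * (m - l), by nlinarith, by nlinarith, fun r => ?_⟩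
  change P r + x * (Q r - P r) = _
  rw [hl, hm, pt, pt, pt]; ring

/-- Of two disjoint segments in a plane, one is below the other. -/
theorem below_or_below {u v p q s t : ℕ} (hpq : minor (S.dir u) (S.off u v) p q ≠ 0)
    (hs : S.InPl u v s) (ht : S.InPl u v t) (h : ¬ S.Meets s t) :
    S.Below p q s t ∨ S.Below p q t s := by
  have key : ∀ P P', S.OnSeg P s → S.OnSeg P' t → P p = P' p → P q ≠ P' q := by
    intro P P' h1 h2 h3 h4
    have := InPlane.eq_of_coords hpq (hs.plane h1) (ht.plane h2) h3 h4
    exact h ⟨P, h1, this ▸ h2⟩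
  by_contra hcon
  unfold Below at hcon
  push Not at hcon
  obtain ⟨⟨P, P', h1, h2, h3, h4⟩, Q', Q, h5, h6, h7, h8⟩ := hcon
  have h4' : P' q < P q := lt_of_le_of_ne h4 (key P P' h1 h2 h3).symm
  have h8' : Q q < Q' q := lt_of_le_of_ne h8 (key Q Q' h6 h5 h7.symm)
  -- If the order of heights is different on two common vertical lines, then the difference of
  -- heights vanishes at this intermediate position.
  have hd : 0 < (P q - P' q) + (Q' q - Q q) := by linarith
  have hx0 : 0 ≤ (P q - P' q) / ((P q - P' q) + (Q' q - Q q)) := by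
    apply div_nonneg <;> linarith
  have hx1 : (P q - P' q) / ((P q - P' q) + (Q' q - Q q)) ≤ 1 := by
    rw [div_le_one hd]; linarith
  refine key _ _ (h1.convex h6 hx0 hx1) (h2.convex h5 hx0 hx1) ?_ ?_
  · simp only [h3, h7]
  · have := div_mul_cancel₀ (P q - P' q) hd.ne'
    linear_combination -this

/-- `Below` alone is not transitive, since the middle segment may have no point on a vertical line
common to the outer ones. The extra condition excludes this. -/
theorem Below.trans_of_mem {p q s t r : ℕ} (h1 : S.Below p q s t) (h2 : S.Below p q t r)
    (h : ∀ P Q, S.OnSeg P s → S.OnSeg Q r → P p = Q p →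
      min (S.a t p) (S.b t p) ≤ P p ∧ P p ≤ max (S.a t p) (S.b t p)) : S.Below p q s r := by
  intro P Q hP hQ hPQ
  obtain ⟨h3, h4⟩ := h P Q hP hQ hPQ
  obtain ⟨R, hR, hRp, -⟩ := exists_onSeg t p h3 h4
  exact (h1 P R hP hR hRp.symm).trans (h2 R Q hR hQ (hRp.trans hPQ))

/-- A vertical line common to `s` and `r` is not to the right of `t` because of the right end of
`s`. It is not to the left of `t` because of the left end of `r` in the first two orders and of `s`
in the other two. So it crosses `t`. -/
theorem Ord.trans {p q o s t r : ℕ} (h1 : S.Ord p q o s t) (h2 : S.Ord p q o t r) :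
    S.Ord p q o s r := by
  obtain ⟨a1, b1, c1⟩ := h1
  obtain ⟨a2, b2, c2⟩ := h2
  unfold RightLe at a1 a2
  have hmem : ∀ P Q, S.OnSeg P s → S.OnSeg Q r → P p = Q p →
      min (S.a t p) (S.b t p) ≤ P p ∧ P p ≤ max (S.a t p) (S.b t p) := by
    intro P Q hP hQ hPQ
    have h3 := hP.mem_Icc p
    have h4 := hQ.mem_Icc p
    refine ⟨?_, h3.2.trans a1⟩
    split_ifs at b1 b2
    · exact le_trans b2 (by rw [hPQ]; exact h4.1)
    · exact le_trans b1 h3.1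
  refine ⟨a1.trans a2, ?_, ?_⟩
  · split_ifs at b1 b2 ⊢
    · exact le_trans b1 b2
    · exact le_trans b2 b1
  · split_ifs at c1 c2 ⊢
    · exact c1.trans_of_mem c2 hmem
    · exact c2.trans_of_mem c1 fun P Q hP hQ hPQ => by
        have := hmem Q P hQ hP hPQ.symm
        rwa [← hPQ] at this

theorem Ord.not_meets {p q o s t : ℕ} (h : S.Ord p q o s t) : ¬ S.Meets s t := by
  obtain ⟨-, -, h⟩ := h
  split_ifs at h
  · exact h.not_meets
  · exact fun h' => h.not_meets h'.symm

theorem Lt.not_meets {u v o s t : ℕ} (h : S.Lt u v o s t) : ¬ S.Meets s t := by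
  obtain ⟨p, q, -, h, -⟩ := h
  exact h

theorem Lt.trans {u v o s t r : ℕ} (h1 : S.Lt u v o s t) (h2 : S.Lt u v o t r) :
    S.Lt u v o s r := by
  obtain ⟨p, q, c1, -, h1⟩ := h1
  obtain ⟨p', q', c2, -, h2⟩ := h2
  obtain ⟨rfl, rfl⟩ := c1.unique c2
  exact ⟨p, q, c1, (h1.trans h2).not_meets, h1.trans h2⟩

theorem Lt.irrefl {u v o s : ℕ} : ¬ S.Lt u v o s s := fun h => h.not_meets (Meets.refl S s)

/-- Disjoint segments of a plane are comparable in one of the four orders. -/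
theorem exists_lt {u v s t : ℕ} (hs : S.InPl u v s) (ht : S.InPl u v t) (h : ¬ S.Meets s t) :
    ∃ o < 4, S.Lt u v o s t ∨ S.Lt u v o t s := by
  obtain ⟨p, q, hc⟩ := exists_coord hs.1
  have h' : ¬ S.Meets t s := fun h' => h h'.symm
  have hl : S.LeftLe p s t ∨ S.LeftLe p t s := le_total _ _
  -- The names are chosen so that `s` does not extend further to the right. The comparison of left
  -- ends and the comparison of heights then select one of four orders.
  have main : ∀ s t, ¬ S.Meets s t → S.RightLe p s t → (S.LeftLe p s t ∨ S.LeftLe p t s) →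
      (S.Below p q s t ∨ S.Below p q t s) → ∃ o < 4, S.Lt u v o s t := by
    rintro s t h hr (hl | hl) (hb | hb)
    · exact ⟨0, by omega, p, q, hc, h, hr, by simpa using hl, by simpa using hb⟩
    · exact ⟨1, by omega, p, q, hc, h, hr, by simpa using hl, by simpa using hb⟩
    · exact ⟨2, by omega, p, q, hc, h, hr, by simpa using hl, by simpa using hb⟩
    · exact ⟨3, by omega, p, q, hc, h, hr, by simpa using hl, by simpa using hb⟩
  have hb := below_or_below hc.1 hs ht h
  rcases le_total (max (S.a s p) (S.b s p)) (max (S.a t p) (S.b t p)) with hr | hr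
  · obtain ⟨o, ho, hlt⟩ := main s t h hr hl hb
    exact ⟨o, ho, Or.inl hlt⟩
  · obtain ⟨o, ho, hlt⟩ := main t s h' hr hl.symm hb.symm
    exact ⟨o, ho, Or.inr hlt⟩

/-! #### The tests for the orders -/

/-- The coordinate `x` belongs to the projection of the `t`-th segment. -/
def InRange (S : Segs) (p t : ℕ) (x : ℝ) : Prop :=
  S.a t p ≤ x ∧ x ≤ S.b t p ∨ S.b t p ≤ x ∧ x ≤ S.a t p

/-- The height of the `t`-th segment at `x`. -/
noncomputable def height (S : Segs) (p q t : ℕ) (x : ℝ) : ℝ :=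
  S.a t q + (x - S.a t p) / S.dir t p * S.dir t q

theorem inRange_iff {p t : ℕ} {x : ℝ} : S.InRange p t x ↔
    min (S.a t p) (S.b t p) ≤ x ∧ x ≤ max (S.a t p) (S.b t p) := by
  unfold InRange
  rcases le_total (S.a t p) (S.b t p) with h | h
  · rw [min_eq_left h, max_eq_right h]
    exact ⟨fun h' => by rcases h' with h' | h' <;> constructor <;> linarith [h'.1, h'.2], Or.inl⟩
  · rw [min_eq_right h, max_eq_left h]
    exact ⟨fun h' => by rcases h' with h' | h' <;> constructor <;> linarith [h'.1, h'.2], Or.inr⟩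

theorem leftLe_iff {p s t : ℕ} : S.LeftLe p s t ↔
    (S.a s p ≤ S.a t p ∨ S.b s p ≤ S.a t p) ∧ (S.a s p ≤ S.b t p ∨ S.b s p ≤ S.b t p) := by
  unfold LeftLe
  rw [le_min_iff, min_le_iff, min_le_iff]

theorem rightLe_iff {p s t : ℕ} : S.RightLe p s t ↔
    (S.a s p ≤ S.a t p ∨ S.a s p ≤ S.b t p) ∧ (S.b s p ≤ S.a t p ∨ S.b s p ≤ S.b t p) := by
  unfold RightLe
  rw [max_le_iff, le_max_iff, le_max_iff]

/-- The projections of two segments are disjoint, or there is an endpoint of one of them from which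
one can see that `s` is below `t`. -/
def BelowTest (S : Segs) (p q s t : ℕ) : Prop :=
  (¬ S.InRange p t (S.a s p) ∧ ¬ S.InRange p t (S.b s p) ∧ ¬ S.InRange p s (S.a t p) ∧
    ¬ S.InRange p s (S.b t p)) ∨
  (S.InRange p t (S.a s p) ∧ S.a s q < S.height p q t (S.a s p)) ∨
  (S.InRange p t (S.b s p) ∧ S.b s q < S.height p q t (S.b s p)) ∨
  (S.InRange p s (S.a t p) ∧ S.height p q s (S.a t p) < S.a t q) ∨
  (S.InRange p s (S.b t p) ∧ S.height p q s (S.b t p) < S.b t q)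

/-- One of two disjoint segments is below the other throughout, so a single common vertical line
decides. If the projections overlap, some endpoint of one segment lies over or under the other; if
not, `Below` holds vacuously. -/
theorem belowTest_iff {u v p q s t : ℕ} (hpq : minor (S.dir u) (S.off u v) p q ≠ 0)
    (hs : S.InPl u v s) (ht : S.InPl u v t) (h : ¬ S.Meets s t) :
    S.BelowTest p q s t ↔ S.Below p q s t := by
  have hh : ∀ {i x}, S.InRange p i x → ∃ P, S.OnSeg P i ∧ P p = x ∧ P q = S.height p q i x := by
    intro i x hx
    obtain ⟨h1, h2⟩ := inRange_iff.1 hx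
    obtain ⟨P, hP, hx, hq⟩ := exists_onSeg i p h1 h2
    exact ⟨P, hP, hx, hq q⟩
  have wit : ∀ P Q, S.OnSeg P s → S.OnSeg Q t → P p = Q p → P q < Q q → S.Below p q s t := by
    intro P Q hP hQ hPQ hlt
    exact (below_or_below hpq hs ht h).resolve_right fun h' =>
      lt_asymm hlt (h' Q P hQ hP hPQ.symm)
  constructor
  · rintro (⟨h1, h2, h3, h4⟩ | ⟨h1, h2⟩ | ⟨h1, h2⟩ | ⟨h1, h2⟩ | ⟨h1, h2⟩)
    · intro P Q hP hQ hPQ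
      exfalso
      have e1 := hP.mem_Icc p
      have e2 := hQ.mem_Icc p
      rw [hPQ] at e1
      unfold InRange at h1 h2 h3 h4
      rcases le_total (S.a s p) (S.b s p) with h5 | h5 <;>
      rcases le_total (S.a t p) (S.b t p) with h6 | h6 <;>
      simp only [min_eq_left, min_eq_right, max_eq_left, max_eq_right, h5, h6] at e1 e2
      · rcases le_total (S.a s p) (S.a t p) with h7 | h7
        · exact h3 (Or.inl ⟨h7, by linarith⟩)
        · exact h1 (Or.inl ⟨h7, by linarith⟩)
      · rcases le_total (S.a s p) (S.b t p) with h7 | h7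
        · exact h4 (Or.inl ⟨h7, by linarith⟩)
        · exact h1 (Or.inr ⟨h7, by linarith⟩)
      · rcases le_total (S.b s p) (S.a t p) with h7 | h7
        · exact h3 (Or.inr ⟨h7, by linarith⟩)
        · exact h2 (Or.inl ⟨h7, by linarith⟩)
      · rcases le_total (S.b s p) (S.b t p) with h7 | h7
        · exact h4 (Or.inr ⟨h7, by linarith⟩)
        · exact h2 (Or.inr ⟨h7, by linarith⟩)
    · obtain ⟨Q, hQ, hx, hq⟩ := hh h1
      exact wit _ Q (S.onSeg_a s) hQ hx.symm (by rw [hq]; exact h2)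
    · obtain ⟨Q, hQ, hx, hq⟩ := hh h1
      exact wit _ Q (S.onSeg_b s) hQ hx.symm (by rw [hq]; exact h2)
    · obtain ⟨Q, hQ, hx, hq⟩ := hh h1
      exact wit Q _ hQ (S.onSeg_a t) hx (by rw [hq]; exact h2)
    · obtain ⟨Q, hQ, hx, hq⟩ := hh h1
      exact wit Q _ hQ (S.onSeg_b t) hx (by rw [hq]; exact h2)
  · intro hb
    by_cases h1 : S.InRange p t (S.a s p)
    · obtain ⟨Q, hQ, hx, hq⟩ := hh h1
      exact Or.inr (Or.inl ⟨h1, by rw [← hq]; exact hb _ Q (S.onSeg_a s) hQ hx.symm⟩)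
    by_cases h2 : S.InRange p t (S.b s p)
    · obtain ⟨Q, hQ, hx, hq⟩ := hh h2
      exact Or.inr (Or.inr (Or.inl ⟨h2, by rw [← hq]; exact hb _ Q (S.onSeg_b s) hQ hx.symm⟩))
    by_cases h3 : S.InRange p s (S.a t p)
    · obtain ⟨Q, hQ, hx, hq⟩ := hh h3
      exact Or.inr (Or.inr (Or.inr (Or.inl ⟨h3, by rw [← hq]; exact hb Q _ hQ (S.onSeg_a t) hx⟩)))
    by_cases h4 : S.InRange p s (S.b t p)
    · obtain ⟨Q, hQ, hx, hq⟩ := hh h4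
      exact Or.inr (Or.inr (Or.inr (Or.inr ⟨h4, by rw [← hq]; exact hb Q _ hQ (S.onSeg_b t) hx⟩)))
    exact Or.inl ⟨h1, h2, h3, h4⟩

/-- The form of the four orders that is tested. -/
theorem lt_iff {u v o s t : ℕ} (hs : S.InPl u v s) (ht : S.InPl u v t) :
    S.Lt u v o s t ↔ ¬ S.Meets s t ∧ ∃ p q, S.Coord u v p q ∧
      S.RightLe p s t ∧ (if o < 2 then S.LeftLe p s t else S.LeftLe p t s) ∧
        (if o % 2 = 0 then S.BelowTest p q s t else S.BelowTest p q t s) := by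
  constructor
  · rintro ⟨p, q, hc, h, h1, h2, h3⟩
    refine ⟨h, p, q, hc, h1, h2, ?_⟩
    split_ifs at h3 ⊢
    · exact (belowTest_iff hc.1 hs ht h).2 h3
    · exact (belowTest_iff hc.1 ht hs fun h' => h h'.symm).2 h3
  · rintro ⟨h, p, q, hc, h1, h2, h3⟩
    refine ⟨p, q, hc, h, h1, h2, ?_⟩
    split_ifs at h3 ⊢
    · exact (belowTest_iff hc.1 hs ht h).1 h3
    · exact (belowTest_iff hc.1 ht hs fun h' => h h'.symm).1 h3

end Segs

namespace SegAlg

/-! ### Formulas -/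

/-- A term is read as a formula: it holds if its value is not zero. -/
def Holds (I : Inp) (α : Arrays) (ρ : ℕ → ℕ) (e : Term) : Prop := e.eval I α ρ ≠ 0

/-- Truth means being nonzero, so sums are disjunctions, products are conjunctions, and truncated
subtraction gives negation and comparison. -/
def notT (e : Term) : Term := .sub (.const 1) e
def andT (e f : Term) : Term := .mul e f
def orT (e f : Term) : Term := .add e f
def ltT (e f : Term) : Term := .sub f e
def eqT (e f : Term) : Term := andT (notT (ltT e f)) (notT (ltT f e))
def exT (x : ℕ) (b e : Term) : Term := .sum x b e
def allT (x : ℕ) (b e : Term) : Term := notT (exT x b (notT e))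
def rleT (r s : RTerm) : Term := notT (.rlt s r)
def reqT (r s : RTerm) : Term := andT (rleT r s) (rleT s r)
-- The double negation turns the summands into 0 and 1.
def countT (x : ℕ) (b e : Term) : Term := .sum x b (notT (notT e))
/-- The least `x < b` that satisfies `e`, or `b`; the variable `y` must not occur in `e`. -/
def leastT (y x : ℕ) (b e : Term) : Term :=
  .sum y b (notT (exT x (.add (.var y) (.const 1)) e))

variable {I : Inp} {α : Arrays} {ρ : ℕ → ℕ}

theorem holds_not (e : Term) : Holds I α ρ (notT e) ↔ ¬ Holds I α ρ e := by
  simp only [Holds, notT, Term.eval]; omega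

theorem holds_and (e f : Term) : Holds I α ρ (andT e f) ↔ Holds I α ρ e ∧ Holds I α ρ f := by
  simp [Holds, andT, Term.eval]

theorem holds_or (e f : Term) : Holds I α ρ (orT e f) ↔ Holds I α ρ e ∨ Holds I α ρ f := by
  simp only [Holds, orT, Term.eval]; omega

theorem holds_lt (e f : Term) : Holds I α ρ (ltT e f) ↔ e.eval I α ρ < f.eval I α ρ := by
  simp only [Holds, ltT, Term.eval]; omega

theorem holds_eq (e f : Term) : Holds I α ρ (eqT e f) ↔ e.eval I α ρ = f.eval I α ρ := by
  simp only [eqT, holds_and, holds_not, holds_lt]; omega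

theorem holds_ex (x : ℕ) (b e : Term) : Holds I α ρ (exT x b e) ↔
    ∃ i < b.eval I α ρ, Holds I α (Function.update ρ x i) e := by
  simp [Holds, exT, Term.eval, Finset.sum_eq_zero_iff]

theorem holds_all (x : ℕ) (b e : Term) : Holds I α ρ (allT x b e) ↔
    ∀ i < b.eval I α ρ, Holds I α (Function.update ρ x i) e := by
  simp [allT, holds_not, holds_ex]

theorem holds_rlt (r s : RTerm) : Holds I α ρ (.rlt r s) ↔ r.eval I ρ < s.eval I ρ := by
  simp [Holds, Term.eval]

theorem holds_rle (r s : RTerm) : Holds I α ρ (rleT r s) ↔ r.eval I ρ ≤ s.eval I ρ := by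
  simp [rleT, holds_not, holds_rlt]

theorem holds_req (r s : RTerm) : Holds I α ρ (reqT r s) ↔ r.eval I ρ = s.eval I ρ := by
  simp only [reqT, holds_and, holds_rle]; exact le_antisymm_iff.symm

open Classical in
theorem eval_count (x : ℕ) (b e : Term) : (countT x b e).eval I α ρ =
    #{i ∈ range (b.eval I α ρ) | Holds I α (Function.update ρ x i) e} := by
  simp only [countT, Term.eval, notT, card_filter]
  refine sum_congr rfl fun i _ => ?_
  unfold Holds
  split_ifs <;> omega

/-- The sum counts the `i` for which nothing up to and including `i` satisfies `e`, that is, all `i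
< m`. The hypothesis `hy` says that `e` does not depend on the counter `y`. -/
theorem eval_least {y x : ℕ} {b e : Term} {m : ℕ} (hm : m < b.eval I α ρ)
    (h : Holds I α (Function.update ρ x m) e)
    (hl : ∀ i < m, ¬ Holds I α (Function.update ρ x i) e)
    (hy : ∀ i j, Holds I α (Function.update (Function.update ρ y i) x j) e ↔
      Holds I α (Function.update ρ x j) e) :
    (leastT y x b e).eval I α ρ = m := by
  have key : ∀ i, (notT (exT x (.add (.var y) (.const 1)) e)).eval I α (Function.update ρ y i) =
      if i < m then 1 else 0 := by
    intro i
    have h1 : Holds I α (Function.update ρ y i) (exT x (.add (.var y) (.const 1)) e) ↔ m ≤ i := by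
      rw [holds_ex]
      simp only [Term.eval, Function.update_self, hy]
      constructor
      · rintro ⟨j, hj, hj'⟩
        by_contra h2
        exact hl j (by omega) hj'
      · exact fun h2 => ⟨m, by omega, h⟩
    unfold Holds at h1
    simp only [notT, Term.eval]
    simp only [exT] at h1 ⊢
    split_ifs <;> omega
  simp only [leastT, Term.eval]
  rw [sum_congr rfl fun i _ => key i, ← card_filter]
  rw [show {i ∈ range (b.eval I α ρ) | i < m} = range m by ext; simp; omega, card_range]

/-! ### Geometric formulas -/

/-- The segments of an input. -/
noncomputable def Inp.segs (I : Inp) : Segs := ⟨I.a, I.b⟩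

theorem Inp.a_eq_zero {i r : ℕ} (h : I.d ≤ r) : I.segs.a i r = 0 := if_neg (by omega)

theorem Inp.b_eq_zero {i r : ℕ} (h : I.d ≤ r) : I.segs.b i r = 0 := if_neg (by omega)

theorem Inp.dir_eq_zero {i r : ℕ} (h : I.d ≤ r) : I.segs.dir i r = 0 := by
  rw [Segs.dir, I.a_eq_zero h, I.b_eq_zero h, sub_zero]

theorem Inp.off_eq_zero {i j r : ℕ} (h : I.d ≤ r) : I.segs.off i j r = 0 := by
  rw [Segs.off, I.a_eq_zero h, I.a_eq_zero h, sub_zero]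

theorem lt_of_minor {f g : ℕ → ℝ} {d p q : ℕ} (hf : ∀ r, d ≤ r → f r = 0)
    (hg : ∀ r, d ≤ r → g r = 0) (h : Segs.minor f g p q ≠ 0) : p < d ∧ q < d := by
  by_contra h'
  apply h
  unfold Segs.minor
  rcases not_and_or.1 h' with h1 | h1
  · rw [hf p (by omega), hg p (by omega)]; ring
  · rw [hf q (by omega), hg q (by omega)]; ring

/-- All coordinates from `d` on vanish, so a nonzero minor uses only coordinates below `d`, and the
quantifiers may be bounded. -/
theorem bex_minor {f g : ℕ → ℝ} {d : ℕ} {X : ℕ → ℕ → Prop} (hf : ∀ r, d ≤ r → f r = 0)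
    (hg : ∀ r, d ≤ r → g r = 0) : (∃ p < d, ∃ q < d, Segs.minor f g p q ≠ 0 ∧ X p q) ↔
      ∃ p q, Segs.minor f g p q ≠ 0 ∧ X p q := by
  constructor
  · rintro ⟨p, -, q, -, h⟩; exact ⟨p, q, h⟩
  · rintro ⟨p, q, h⟩
    obtain ⟨hp, hq⟩ := lt_of_minor hf hg h.1
    exact ⟨p, hp, q, hq, h⟩

theorem ball_of_ge {d : ℕ} {F : ℕ → Prop} (h : ∀ r, d ≤ r → F r) : (∀ r < d, F r) ↔ ∀ r, F r :=
  ⟨fun h' r => (lt_or_ge r d).elim (h' r) (h r), fun h' r _ => h' r⟩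

/-- Bound variables have larger names than free ones: from 38 or 40 on in geometric formulas, from
20 on in formulas about a clique, from 10 on in the formula for colors. Hence nothing is captured.
-/
theorem update_of_lt {N x k : ℕ} (hx : x < N) (hk : N ≤ k) (ρ : ℕ → ℕ) (i : ℕ) :
    Function.update ρ k i x = ρ x := Function.update_of_ne (by omega) _ _

/-- Coordinates of directions and offsets. -/
def dirR (x r : ℕ) : RTerm := .sub (.snd x r) (.fst x r)
def offR (x y r : ℕ) : RTerm := .sub (.fst y r) (.fst x r)
def minorR (f g : ℕ → RTerm) (p q : ℕ) : RTerm := .sub (.mul (f p) (g q)) (.mul (f q) (g p))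
/-- An endpoint of a segment. -/
def endR (e : Bool) (x r : ℕ) : RTerm := if e then .snd x r else .fst x r
def rneT (r s : RTerm) : Term := notT (reqT r s)
def unitT (r : RTerm) : Term := andT (rleT (.const 0) r) (rleT r (.const 1))

theorem eval_dirR (x r : ℕ) : (dirR x r).eval I ρ = I.segs.dir (ρ x) (ρ r) := rfl
theorem eval_offR (x y r : ℕ) : (offR x y r).eval I ρ = I.segs.off (ρ x) (ρ y) (ρ r) := rfl
theorem eval_fst (x r : ℕ) : (RTerm.fst x r).eval I ρ = I.segs.a (ρ x) (ρ r) := rfl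
theorem eval_snd (x r : ℕ) : (RTerm.snd x r).eval I ρ = I.segs.b (ρ x) (ρ r) := rfl
theorem eval_const (c : ℕ) : (RTerm.const c).eval I ρ = c := rfl
theorem eval_add (r s : RTerm) : (RTerm.add r s).eval I ρ = r.eval I ρ + s.eval I ρ := rfl
theorem eval_sub (r s : RTerm) : (RTerm.sub r s).eval I ρ = r.eval I ρ - s.eval I ρ := rfl
theorem eval_mul (r s : RTerm) : (RTerm.mul r s).eval I ρ = r.eval I ρ * s.eval I ρ := rfl
theorem eval_div (r s : RTerm) : (RTerm.div r s).eval I ρ = r.eval I ρ / s.eval I ρ := rfl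
theorem eval_minorR (f g : ℕ → RTerm) (p q : ℕ) : (minorR f g p q).eval I ρ =
    (f p).eval I ρ * (g q).eval I ρ - (f q).eval I ρ * (g p).eval I ρ := rfl
theorem holds_rne (r s : RTerm) : Holds I α ρ (rneT r s) ↔ r.eval I ρ ≠ s.eval I ρ := by
  rw [rneT, holds_not, holds_req]
theorem holds_unit (r : RTerm) : Holds I α ρ (unitT r) ↔ 0 ≤ r.eval I ρ ∧ r.eval I ρ ≤ 1 := by
  simp [unitT, holds_and, holds_rle, RTerm.eval]

/-- The endpoint of `S` selected by `e`. -/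
def endp (S : Segs) (e : Bool) : ℕ → ℕ → ℝ := if e then S.b else S.a

theorem eval_endR (e : Bool) (x r : ℕ) : (endR e x r).eval I ρ = endp I.segs e (ρ x) (ρ r) := by
  cases e <;> rfl

theorem endp_eq_zero {e : Bool} {i r : ℕ} (h : I.d ≤ r) : endp I.segs e i r = 0 := by
  cases e
  · exact I.a_eq_zero h
  · exact I.b_eq_zero h

/-- An endpoint of `x` lies on `y`. -/
def onSegT (e : Bool) (x y : ℕ) : Term :=
  orT (allT 40 .dim (reqT (endR e x 40) (.fst y 40)))
    (exT 41 .dim (andT (rneT (dirR y 41) (.const 0))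
      (andT (unitT (.div (.sub (endR e x 41) (.fst y 41)) (dirR y 41)))
        (allT 40 .dim (reqT (endR e x 40) (.add (.fst y 40)
          (.mul (.div (.sub (endR e x 41) (.fst y 41)) (dirR y 41)) (dirR y 40))))))))

theorem holds_onSeg {e : Bool} {x y : ℕ} (hx : x < 40) (hy : y < 40) :
    Holds I α ρ (onSegT e x y) ↔ I.segs.OnSeg (endp I.segs e (ρ x)) (ρ y) := by
  rw [Segs.onSeg_iff]
  simp only [onSegT, holds_or, holds_all, holds_req, holds_ex, holds_and, holds_rne, holds_unit,
    eval_const, eval_add, eval_sub, eval_mul, eval_div, eval_dirR, eval_endR, Term.eval, eval_fst,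
    Function.update_self, update_of_lt hx, update_of_lt hy, le_refl, ne_eq, Nat.reduceEqDiff,
    not_false_eq_true, Function.update_of_ne, Nat.reduceLeDiff, Nat.cast_zero]
  refine or_congr (ball_of_ge fun r hr => ?_) ⟨?_, ?_⟩
  · rw [endp_eq_zero hr, I.a_eq_zero hr]
  · rintro ⟨p, -, h1, ⟨h2, h3⟩, h4⟩
    refine ⟨p, h1, h2, h3, (ball_of_ge fun r hr => ?_).1 h4⟩
    rw [endp_eq_zero hr, I.a_eq_zero hr, I.dir_eq_zero hr]; ring
  · rintro ⟨p, h1, h2, h3, h4⟩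
    refine ⟨p, ?_, h1, ⟨h2, h3⟩, fun r _ => h4 r⟩
    by_contra h5
    exact h1 (I.dir_eq_zero (by omega))

/-- Quotients of minors. -/
def divR (x y : ℕ) (f : ℕ → RTerm) (p q : ℕ) : RTerm :=
  .div (minorR (offR x y) f p q) (minorR (dirR x) (dirR y) p q)

/-- Two segments have a common point. -/
def meetT (x y : ℕ) : Term :=
  orT (orT (onSegT false x y) (orT (onSegT true x y) (orT (onSegT false y x) (onSegT true y x))))
    (exT 40 .dim (exT 41 .dim (andT (rneT (minorR (dirR x) (dirR y) 40 41) (.const 0))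
      (andT (unitT (divR x y (dirR y) 40 41)) (andT (unitT (divR x y (dirR x) 40 41))
        (allT 42 .dim (reqT (.add (.fst x 42) (.mul (divR x y (dirR y) 40 41) (dirR x 42)))
          (.add (.fst y 42) (.mul (divR x y (dirR x) 40 41) (dirR y 42))))))))))

theorem holds_meet {x y : ℕ} (hx : x < 40) (hy : y < 40) :
    Holds I α ρ (meetT x y) ↔ I.segs.Meets (ρ x) (ρ y) := by
  rw [Segs.meets_iff, ← bex_minor (d := I.d) (fun _ => I.dir_eq_zero) fun _ => I.dir_eq_zero]
  simp only [meetT, divR, holds_onSeg hx hy, holds_onSeg hy hx, endp, holds_or, holds_all,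
    holds_req, holds_ex, holds_and, holds_rne, holds_unit, if_true, if_false, Bool.false_eq_true,
    eval_const, eval_add, eval_mul, eval_div, eval_dirR, eval_offR, eval_minorR,
    Term.eval, eval_fst, Segs.minor,
    Function.update_self, update_of_lt hx, update_of_lt hy, le_refl, ne_eq, Nat.reduceEqDiff,
    not_false_eq_true, Function.update_of_ne, Nat.reduceLeDiff, Nat.cast_zero]
  refine or_congr Iff.rfl (exists_congr fun p => and_congr_right fun _ => exists_congr fun q =>
    and_congr_right fun _ => and_congr_right fun _ => and_congr_right fun _ =>
    and_congr_right fun _ => ball_of_ge fun r hr => ?_)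
  rw [I.a_eq_zero hr, I.a_eq_zero hr, I.dir_eq_zero hr, I.dir_eq_zero hr]; ring

/-- Two segments meet a third one in the same point. -/
def sharedT (u t y : ℕ) : Term :=
  exT 40 .dim (exT 41 .dim (andT (rneT (minorR (dirR u) (dirR t) 40 41) (.const 0))
    (exT 42 .dim (exT 43 .dim (andT (rneT (minorR (dirR u) (dirR y) 42 43) (.const 0))
      (reqT (divR u t (dirR t) 40 41) (divR u y (dirR y) 42 43)))))))

/-- The formula compares parameters on `u`. It is meaningful only for segments that meet `u`
transversally, whence the hypotheses. -/
theorem holds_shared {u t y : ℕ} (hu : u < 40) (ht : t < 40) (hy : y < 40)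
    (it : Segs.Indep (I.segs.dir (ρ u)) (I.segs.dir (ρ t)))
    (iy : Segs.Indep (I.segs.dir (ρ u)) (I.segs.dir (ρ y)))
    (mt : I.segs.Meets (ρ u) (ρ t)) (my : I.segs.Meets (ρ u) (ρ y)) :
    Holds I α ρ (sharedT u t y) ↔ I.segs.Shared (ρ u) (ρ t) (ρ y) := by
  rw [Segs.shared_iff it iy mt my,
    ← bex_minor (d := I.d) (fun _ => I.dir_eq_zero) fun _ => I.dir_eq_zero]
  simp only [← bex_minor (d := I.d) (fun _ => I.dir_eq_zero (i := ρ u))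
    fun _ => I.dir_eq_zero (i := ρ y)]
  simp only [sharedT, divR,
    holds_req, holds_ex, holds_and, holds_rne,
    eval_const, eval_div, eval_dirR, eval_offR, eval_minorR, Term.eval, Segs.minor,
    Function.update_self, update_of_lt hu, update_of_lt hy, update_of_lt ht, le_refl, ne_eq,
    Nat.reduceEqDiff, not_false_eq_true, Function.update_of_ne, Nat.reduceLeDiff, Nat.cast_zero]

/-- The equation saying that an endpoint of `t` lies in a plane. -/
def planeEqT (e : Bool) (u v t p q r : ℕ) : Term :=
  reqT (.mul (.sub (endR e t r) (.fst u r)) (minorR (dirR u) (offR u v) p q))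
    (.add (.mul (.sub (.mul (.sub (endR e t p) (.fst u p)) (offR u v q))
        (.mul (.sub (endR e t q) (.fst u q)) (offR u v p))) (dirR u r))
      (.mul (.sub (.mul (dirR u p) (.sub (endR e t q) (.fst u q)))
        (.mul (dirR u q) (.sub (endR e t p) (.fst u p)))) (offR u v r)))

/-- A segment lies in the plane of two others. -/
def inPlT (u v t : ℕ) : Term :=
  exT 40 .dim (exT 41 .dim (andT (rneT (minorR (dirR u) (offR u v) 40 41) (.const 0))
    (allT 42 .dim (andT (planeEqT false u v t 40 41 42) (planeEqT true u v t 40 41 42)))))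

theorem holds_inPl {u v t : ℕ} (hu : u < 40) (hv : v < 40) (ht : t < 40) :
    Holds I α ρ (inPlT u v t) ↔ I.segs.InPl (ρ u) (ρ v) (ρ t) := by
  rw [Segs.inPl_iff,
    ← bex_minor (d := I.d) (fun _ => I.dir_eq_zero) fun _ => I.off_eq_zero]
  simp only [inPlT, planeEqT, endp, holds_all, if_true, if_false, Bool.false_eq_true,
    holds_req, holds_ex, holds_and, holds_rne, eval_add, eval_sub, eval_mul, eval_fst, eval_endR,
    eval_const, eval_dirR, eval_offR, eval_minorR, Term.eval, Segs.minor,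
    Function.update_self, update_of_lt hu, update_of_lt hv, update_of_lt ht, le_refl, ne_eq,
    Nat.reduceEqDiff, not_false_eq_true, Function.update_of_ne, Nat.reduceLeDiff, Nat.cast_zero]
  refine exists_congr fun p => and_congr_right fun _ => exists_congr fun q =>
    and_congr_right fun _ => and_congr_right fun _ => ball_of_ge fun r hr => ?_
  rw [I.a_eq_zero hr, I.a_eq_zero hr, I.b_eq_zero hr, I.dir_eq_zero hr, I.off_eq_zero hr]
  constructor <;> ring

/-- The coordinates of a plane. -/
def coordT (u v p q : ℕ) : Term :=
  andT (rneT (minorR (dirR u) (offR u v) p q) (.const 0))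
    (allT 40 .dim (allT 41 .dim (orT (reqT (minorR (dirR u) (offR u v) 40 41) (.const 0))
      (orT (ltT (.var p) (.var 40)) (andT (eqT (.var p) (.var 40))
        (notT (ltT (.var 41) (.var q))))))))

theorem holds_coord {u v p q : ℕ} (hu : u < 40) (hv : v < 40) (hp : p < 40) (hq : q < 40) :
    Holds I α ρ (coordT u v p q) ↔ I.segs.Coord (ρ u) (ρ v) (ρ p) (ρ q) := by
  unfold Segs.Coord
  simp only [coordT, holds_all, holds_or, holds_lt, holds_eq, holds_not,
    holds_req, holds_and, holds_rne,
    eval_const, eval_dirR, eval_offR, eval_minorR, Term.eval, Segs.minor,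
    Function.update_self, update_of_lt hu, update_of_lt hv, update_of_lt hp, update_of_lt hq,
    le_refl, ne_eq,
    Nat.reduceEqDiff, not_false_eq_true, Function.update_of_ne, Nat.reduceLeDiff, Nat.cast_zero]
  refine and_congr_right fun _ => ⟨fun h p' q' h' => ?_, fun h p' _ q' _ => ?_⟩
  · obtain ⟨h1, h2⟩ := lt_of_minor (fun _ => I.dir_eq_zero) (fun _ => I.off_eq_zero) h'
    have := (h p' h1 q' h2).resolve_left h'
    omega
  · have := h p' q'
    by_cases h' : I.segs.dir (ρ u) p' * I.segs.off (ρ u) (ρ v) q' -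
      I.segs.dir (ρ u) q' * I.segs.off (ρ u) (ρ v) p' = 0
    · exact Or.inl h'
    · have := this h'
      right
      omega

def inRangeT (e : Bool) (p t s : ℕ) : Term :=
  orT (andT (rleT (.fst t p) (endR e s p)) (rleT (endR e s p) (.snd t p)))
    (andT (rleT (.snd t p) (endR e s p)) (rleT (endR e s p) (.fst t p)))

def heightR (e : Bool) (p q t s : ℕ) : RTerm :=
  .add (.fst t q) (.mul (.div (.sub (endR e s p) (.fst t p)) (dirR t p)) (dirR t q))

def belowT (p q s t : ℕ) : Term :=
  orT (andT (notT (inRangeT false p t s)) (andT (notT (inRangeT true p t s))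
    (andT (notT (inRangeT false p s t)) (notT (inRangeT true p s t)))))
  (orT (andT (inRangeT false p t s) (.rlt (.fst s q) (heightR false p q t s)))
  (orT (andT (inRangeT true p t s) (.rlt (.snd s q) (heightR true p q t s)))
  (orT (andT (inRangeT false p s t) (.rlt (heightR false p q s t) (.fst t q)))
    (andT (inRangeT true p s t) (.rlt (heightR true p q s t) (.snd t q))))))

def leftLeT (p s t : ℕ) : Term :=
  andT (orT (rleT (.fst s p) (.fst t p)) (rleT (.snd s p) (.fst t p)))
    (orT (rleT (.fst s p) (.snd t p)) (rleT (.snd s p) (.snd t p)))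

def rightLeT (p s t : ℕ) : Term :=
  andT (orT (rleT (.fst s p) (.fst t p)) (rleT (.fst s p) (.snd t p)))
    (orT (rleT (.snd s p) (.fst t p)) (rleT (.snd s p) (.snd t p)))

theorem holds_below (p q s t : ℕ) :
    Holds I α ρ (belowT p q s t) ↔ I.segs.BelowTest (ρ p) (ρ q) (ρ s) (ρ t) := by
  simp only [belowT, inRangeT, heightR, Segs.BelowTest, Segs.InRange, Segs.height, holds_or,
    holds_and, holds_not, holds_rle, holds_rlt, eval_endR, eval_fst, eval_snd, eval_add, eval_mul,
    eval_div, eval_sub, eval_dirR, endp, if_true, if_false, Bool.false_eq_true]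

theorem holds_leftLe (p s t : ℕ) :
    Holds I α ρ (leftLeT p s t) ↔ I.segs.LeftLe (ρ p) (ρ s) (ρ t) := by
  simp only [leftLeT, Segs.leftLe_iff, holds_or, holds_and, holds_rle, eval_fst, eval_snd]

theorem holds_rightLe (p s t : ℕ) :
    Holds I α ρ (rightLeT p s t) ↔ I.segs.RightLe (ρ p) (ρ s) (ρ t) := by
  simp only [rightLeT, Segs.rightLe_iff, holds_or, holds_and, holds_rle, eval_fst, eval_snd]

/-- The four orders in a plane. -/
def ordT (o u v s t : ℕ) : Term :=
  andT (notT (meetT s t)) (exT 38 .dim (exT 39 .dim (andT (coordT u v 38 39)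
    (andT (rightLeT 38 s t) (andT (if o < 2 then leftLeT 38 s t else leftLeT 38 t s)
      (if o % 2 = 0 then belowT 38 39 s t else belowT 38 39 t s))))))

theorem holds_ord {o u v s t : ℕ} (hu : u < 38) (hv : v < 38) (hs : s < 38) (ht : t < 38)
    (h1 : I.segs.InPl (ρ u) (ρ v) (ρ s)) (h2 : I.segs.InPl (ρ u) (ρ v) (ρ t)) :
    Holds I α ρ (ordT o u v s t) ↔ I.segs.Lt (ρ u) (ρ v) o (ρ s) (ρ t) := by
  have hif : ∀ (c : Prop) [Decidable c] (e f : Term) (ρ : ℕ → ℕ), Holds I α ρ (if c then e else f) ↔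
      if c then Holds I α ρ e else Holds I α ρ f := by
    intro c _ e f ρ; split_ifs <;> rfl
  rw [Segs.lt_iff h1 h2, ordT, holds_and, holds_not,
    holds_meet (hs.trans (by norm_num)) (ht.trans (by norm_num))]
  simp only [holds_ex, holds_and, hif, holds_rightLe, holds_leftLe, holds_below,
    holds_coord (hu.trans (by norm_num : 38 < 40)) (hv.trans (by norm_num : 38 < 40))
      (by norm_num : 38 < 40) (by norm_num : 39 < 40), Term.eval,
    Function.update_self, update_of_lt hu, update_of_lt hv, update_of_lt hs, update_of_lt ht,
    le_refl, ne_eq, Nat.reduceEqDiff, not_false_eq_true, Function.update_of_ne, Nat.reduceLeDiff]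
  refine and_congr_right fun _ => ⟨?_, ?_⟩
  · rintro ⟨p, -, q, -, h⟩
    exact ⟨p, q, h⟩
  · rintro ⟨p, q, h⟩
    obtain ⟨h3, h4⟩ := lt_of_minor (fun _ => I.dir_eq_zero) (fun _ => I.off_eq_zero) h.1.1
    exact ⟨p, h3, q, h4, h⟩

end SegAlg

namespace Segs

open SegAlg (pr pr_inj)

/-! ### Segments and a clique -/

section Clique

variable (S : Segs) (K : Finset ℕ)

/-- The members of `K` are pairwise disjoint. -/
def Clique : Prop := ∀ u ∈ K, ∀ v ∈ K, u ≠ v → ¬ S.Meets u v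

/-- The segment `t` meets two members of `K`. -/
def Two (t : ℕ) : Prop := ∃ u ∈ K, ∃ v ∈ K, u ≠ v ∧ S.Meets t u ∧ S.Meets t v

/-- The segment `t` contains an endpoint of a member of `K`. -/
def EndOn (t : ℕ) : Prop := ∃ u ∈ K, S.OnSeg (S.a u) t ∨ S.OnSeg (S.b u) t

/-- The segment `t` meets two members of `K`, and it contains none of their endpoints. -/
def Gen (t : ℕ) : Prop := S.Two K t ∧ ¬ S.EndOn K t

/-- Coplanar members of `K`. Their plane is described by the ordered pair. -/
def Key (u v : ℕ) : Prop := u ∈ K ∧ v ∈ K ∧ S.InPl u v v ∧ ¬ (v < u ∧ S.InPl v u u)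

/-- The segment `t` lies in the plane of two members of `K`. -/
def Pl (u v t : ℕ) : Prop := S.Key K u v ∧ S.InPl u v t

/-- The segment `t` lies in the plane of two members of `K` and meets a third one, which does not
lie in this plane. -/
def Out (u v w t : ℕ) : Prop := S.Pl K u v t ∧ w ∈ K ∧ S.Meets t w ∧ ¬ S.InPl u v w

/-- The lexicographic order of pairs. -/
def Lex (u' v' u v : ℕ) : Prop := u' < u ∨ u' = u ∧ v' < v

/-- The plane of `u` and `v` is the first one that contains `t`. -/
def Fst (u v t : ℕ) : Prop := S.Gen K t ∧ (∀ u' v' w, ¬ S.Out K u' v' w t) ∧ S.Pl K u v t ∧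
  ∀ u' v', Lex u' v' u v → ¬ S.Pl K u' v' t

/-- The segment `t` lies in none of the planes, and it meets `u` and `v`. -/
def SkewAt (u v t : ℕ) : Prop := S.Gen K t ∧ (∀ u' v', ¬ S.Pl K u' v' t) ∧ u ∈ K ∧ v ∈ K ∧ u < v ∧
  S.Meets t u ∧ S.Meets t v

/-- The plane of `u` and `v` is the first one that contains `t`, and `t` is disjoint from the
segments selected in earlier planes. -/
def Free (X : ℕ → ℕ → Finset ℕ) (u v t : ℕ) : Prop := S.Fst K u v t ∧
  ∀ u' ∈ K, ∀ v' ∈ K, Lex u' v' u v → ∀ x ∈ X u' v', ¬ S.Meets t x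

variable {S K}

/-- If `t` were parallel to `u`, it would contain an endpoint of `u` or be contained in `u`. In the
latter case it could meet no other member of the clique, but it meets two. -/
theorem Gen.indep (hK : S.Clique K) {t u : ℕ} (h : S.Gen K t) (hu : u ∈ K) (htu : S.Meets t u) :
    Indep (S.dir t) (S.dir u) := by
  by_contra hi
  rcases htu.of_not_indep hi with h1 | h1 | h1
  · exact h.2 ⟨u, hu, Or.inl h1⟩
  · exact h.2 ⟨u, hu, Or.inr h1⟩
  · obtain ⟨v, hv, w, hw, hvw, ⟨P, hP, hP'⟩, ⟨Q, hQ, hQ'⟩⟩ := h.1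
    by_cases huv : u = v
    · exact hK u hu w hw (huv ▸ hvw) ⟨Q, h1 Q hQ, hQ'⟩
    · exact hK u hu v hv huv ⟨P, h1 P hP, hP'⟩

theorem not_inPl_self {u t : ℕ} : ¬ S.InPl u u t := by
  rintro ⟨⟨p, q, h⟩, -⟩
  exact h (by simp [minor, off])

theorem Key.ne {u v : ℕ} (h : S.Key K u v) : u ≠ v := by
  rintro rfl
  exact not_inPl_self h.2.2.1

/-- One order of a coplanar pair may fail to describe the plane, namely if the first endpoint of one
segment lies on the line of the other. `Key` takes the increasing order if both work, so a pair is
never counted twice. -/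
theorem Key.asymm {u v : ℕ} (h : S.Key K u v) : ¬ S.Key K v u := by
  intro h'
  have h1 := h.2.2.2
  have h2 := h'.2.2.2
  have h3 := h.2.2.1
  have h4 := h'.2.2.1
  rcases lt_trichotomy u v with h5 | h5 | h5
  · exact h2 ⟨h5, h3⟩
  · exact h.ne h5
  · exact h1 ⟨h5, h4⟩

theorem inPl_v {u v : ℕ} (h : S.InPl u v v) : S.InPl u v u :=
  ⟨h.1, plane_self (S.onSeg_a u), plane_self (S.onSeg_b u)⟩

/-- A transversal of a coplanar pair lies in its plane, and one of the orders of the pair is a key;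
but `t` lies in none of these planes. -/
theorem SkewAt.not_inPl (hK : S.Clique K) {u v t : ℕ} (h : S.SkewAt K u v t) :
    ¬ S.InPl u v v ∧ ¬ S.InPl v u u := by
  obtain ⟨-, h1, hu, hv, hlt, htu, htv⟩ := h
  have hm := hK u hu v hv hlt.ne
  have key : ¬ S.InPl u v v := fun h2 => h1 u v ⟨⟨hu, hv, h2, by omega⟩, h2.of_meets hm htu htv⟩
  refine ⟨key, fun h2 => h1 v u ⟨⟨hv, hu, h2, fun h3 => key h3.2⟩, ?_⟩⟩
  exact h2.of_meets (fun h => hm h.symm) htv htu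

/-- Two segments of the same skew pair that meet do so on this pair. -/
theorem SkewAt.shared (hK : S.Clique K) {u v t t' : ℕ} (h : S.SkewAt K u v t)
    (h' : S.SkewAt K u v t') (hm : S.Meets t t') : S.Shared u t t' ∨ S.Shared v t t' := by
  obtain ⟨h1, h2⟩ := h.not_inPl hK
  obtain ⟨hg, -, hu, hv, hlt, htu, htv⟩ := h
  have huv := hK u hu v hv hlt.ne
  exact shared_of_skew huv (fun x y z => skew_indep huv htu htv (hg.indep hK hu htu)
    (hg.indep hK hv htv) h1 h2) htu htv h'.2.2.2.2.2.1 h'.2.2.2.2.2.2 hm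

/-- Being transversal to `u`, the segment `y` has a single point on `u`, and both `t` and `t'` pass
through it. -/
theorem Gen.meets_of_shared (hK : S.Clique K) {u t t' y : ℕ} (hy : S.Gen K y) (hu : u ∈ K)
    (h : S.Shared u t y) (h' : S.Shared u t' y) : S.Meets t t' := by
  obtain ⟨P, h1, h2, h3⟩ := h
  obtain ⟨Q, h1', h2', h3'⟩ := h'
  have := OnSeg.unique (hy.indep hK hu ⟨P, h3, h1⟩) h3 h1 h3' h1'
  exact ⟨P, h2, this ▸ h2'⟩

theorem Fst.unique {u v u' v' t : ℕ} (h : S.Fst K u v t) (h' : S.Fst K u' v' t) :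
    u = u' ∧ v = v' := by
  have h1 : ¬ Lex u v u' v' := fun hl => h'.2.2.2 _ _ hl h.2.2.1
  have h2 : ¬ Lex u' v' u v := fun hl => h.2.2.2 _ _ hl h'.2.2.1
  unfold Lex at h1 h2
  omega

/-- Two segments of the same plane that meet the same segment of an earlier plane meet. -/
theorem Fst.meets (hK : S.Clique K) {u v u' v' t t' x : ℕ} (h : S.Fst K u v t)
    (h' : S.Fst K u v t') (hx : S.Fst K u' v' x) (hl : Lex u' v' u v) (hm : S.Meets t x)
    (hm' : S.Meets t' x) : S.Meets t t' := by
  by_cases hxp : S.InPl u v x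
  -- If `x` lay in the later plane too, then so would a member `m` that it meets, since `x` does not
  -- leave either plane in the sense of `Out`. Then the planes coincide, and `t` lies in an earlier
  -- plane.
  · exfalso
    obtain ⟨hg, hout, hpl, -⟩ := hx
    obtain ⟨m, hmK, -, -, -, hxm, -⟩ := hg.1
    have hm1 : S.InPl u v m := by
      by_contra h1
      exact hout u v m ⟨⟨h.2.2.1.1, hxp⟩, hmK, hxm, h1⟩
    have hm2 : S.InPl u' v' m := by
      by_contra h1
      exact hout u' v' m ⟨hpl, hmK, hxm, h1⟩
    exact h.2.2.2 u' v' hl ⟨hpl.1, InPl.plane_unique (hg.indep hK hmK hxm) hxm hxp hm1 hpl.2 hm2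
      h.2.2.1.2⟩
  · exact meets_of_not_inPl hxp h.2.2.1.2 h'.2.2.1.2 hm hm'

end Clique

/-! ### The coloring -/

/-- A clique together with the selections that show that it cannot be improved: `X u v` is the
chain selected in the plane of `u` and `v`, and `g o u v t` is the height of `t` in the `o`-th order
of this plane; `Y u v` is the selection for the skew pair `u`, `v`. -/
structure Good (S : Segs) (n : ℕ) (K : Finset ℕ) (X Y : ℕ → ℕ → Finset ℕ)
    (g : ℕ → ℕ → ℕ → ℕ → ℕ) : Prop where
  sub : K ⊆ range n
  clique : S.Clique K
  skew_of_mem : ∀ u ∈ K, ∀ v ∈ K, ∀ y ∈ Y u v, S.SkewAt K u v y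
  not_shared : ∀ u ∈ K, ∀ v ∈ K, ∀ y ∈ Y u v, ∀ y' ∈ Y u v, y ≠ y' →
    ¬ S.Shared u y y' ∧ ¬ S.Shared v y y'
  exists_shared : ∀ u ∈ K, ∀ v ∈ K, ∀ t < n, S.SkewAt K u v t →
    ∃ y ∈ Y u v, S.Shared u t y ∨ S.Shared v t y
  free_of_mem : ∀ u ∈ K, ∀ v ∈ K, ∀ x ∈ X u v, S.Free K X u v x
  height_lt : ∀ u ∈ K, ∀ v ∈ K, ∀ o < 4, ∀ t < n, S.Free K X u v t → g o u v t < #(X u v)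
  height_mono : ∀ u ∈ K, ∀ v ∈ K, ∀ o < 4, ∀ s < n, ∀ t < n, S.Free K X u v s → S.Free K X u v t →
    S.Lt u v o s t → g o u v s < g o u v t
  disjoint_of_mem : ∀ u ∈ K, ∀ v ∈ K, ∀ x ∈ X u v, ∀ x' ∈ X u v, x ≠ x' → ¬ S.Meets x x'
  skew_le : ∀ u ∈ K, ∀ v ∈ K, #(Y u v) ≤ #K
  chain_le : #(K.biUnion fun u => K.biUnion fun v => X u v) ≤ #K
  exists_meets : ∀ t < n, ∃ u ∈ K, S.Meets t u
  swap : ∀ u ∈ K, ∀ t < n, ∀ t' < n, (∀ w ∈ K, w ≠ u → ¬ S.Meets t w ∧ ¬ S.Meets t' w) →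
    S.Meets t t'

/-- The colors that the segment `t` may get. -/
def Color (S : Segs) (K : Finset ℕ) (X Y : ℕ → ℕ → Finset ℕ) (g : ℕ → ℕ → ℕ → ℕ → ℕ) (t c : ℕ) :
    Prop :=
  (∃ u ∈ K, ¬ S.Two K t ∧ S.Meets t u ∧ c = pr 0 u) ∨
  (∃ u ∈ K, S.Two K t ∧ S.OnSeg (S.a u) t ∧ c = pr 1 (pr u 0)) ∨
  (∃ u ∈ K, S.Two K t ∧ S.OnSeg (S.b u) t ∧ c = pr 1 (pr u 1)) ∨
  (∃ u ∈ K, ∃ v ∈ K, ∃ w ∈ K, S.Out K u v w t ∧ c = pr 2 (pr u (pr v w))) ∨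
  (∃ u ∈ K, ∃ v ∈ K, ∃ u' ∈ K, ∃ v' ∈ K, ∃ x ∈ X u' v', S.Fst K u v t ∧ Lex u' v' u v ∧
    S.Meets t x ∧ c = pr 3 (pr u (pr v x))) ∨
  (∃ u ∈ K, ∃ v ∈ K, S.Free K X u v t ∧ c = pr 4 (pr u (pr v (pr (g 0 u v t)
    (pr (g 1 u v t) (pr (g 2 u v t) (g 3 u v t))))))) ∨
  (∃ u ∈ K, ∃ v ∈ K, ∃ y ∈ Y u v, S.SkewAt K u v t ∧ S.Shared u t y ∧
    c = pr 5 (pr u (pr v (pr y 0)))) ∨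
  (∃ u ∈ K, ∃ v ∈ K, ∃ y ∈ Y u v, S.SkewAt K u v t ∧ S.Shared v t y ∧
    c = pr 5 (pr u (pr v (pr y 1))))

section Good

variable {S : Segs} {n : ℕ} {K : Finset ℕ} {X Y : ℕ → ℕ → Finset ℕ} {g : ℕ → ℕ → ℕ → ℕ → ℕ}

/-- A segment for which the cases before the planes fail either lies in a plane, where it is `Free`
or meets an earlier chain, or it is a transversal of a skew pair and is caught by the maximality of
`Y`. -/
theorem Good.exists_color (h : Good S n K X Y g) {t : ℕ} (ht : t < n) :
    ∃ c, S.Color K X Y g t c := by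
  unfold Color
  by_cases h2 : S.Two K t
  swap
  · obtain ⟨u, hu, hm⟩ := h.exists_meets t ht
    exact ⟨_, Or.inl ⟨u, hu, h2, hm, rfl⟩⟩
  by_cases he : S.EndOn K t
  · obtain ⟨u, hu, hm | hm⟩ := he
    · exact ⟨_, Or.inr <| Or.inl ⟨u, hu, h2, hm, rfl⟩⟩
    · exact ⟨_, Or.inr <| Or.inr <| Or.inl ⟨u, hu, h2, hm, rfl⟩⟩
  have hg : S.Gen K t := ⟨h2, he⟩
  by_cases ho : ∃ u v w, S.Out K u v w t
  · obtain ⟨u, v, w, ho⟩ := ho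
    exact ⟨_, Or.inr <| Or.inr <| Or.inr <| Or.inl
      ⟨u, ho.1.1.1, v, ho.1.1.2.1, w, ho.2.1, ho, rfl⟩⟩
  push Not at ho
  by_cases hp : ∃ u v, S.Pl K u v t
  · classical
    have hf : ∃ u v, S.Fst K u v t := by
      refine ⟨Nat.find hp, Nat.find (Nat.find_spec hp), hg, ho, Nat.find_spec (Nat.find_spec hp),
        fun u' v' hl hpl => ?_⟩
      rcases hl with hl | ⟨rfl, hl⟩
      · exact Nat.find_min hp hl ⟨v', hpl⟩
      · exact Nat.find_min (Nat.find_spec hp) hl hpl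
    obtain ⟨u, v, hf⟩ := hf
    have hu := hf.2.2.1.1.1
    have hv := hf.2.2.1.1.2.1
    by_cases hfr : S.Free K X u v t
    · exact ⟨_, Or.inr <| Or.inr <| Or.inr <| Or.inr <| Or.inr <| Or.inl ⟨u, hu, v, hv, hfr, rfl⟩⟩
    · have : ∃ u' ∈ K, ∃ v' ∈ K, Lex u' v' u v ∧ ∃ x ∈ X u' v', S.Meets t x := by
        by_contra h3
        push Not at h3
        exact hfr ⟨hf, h3⟩
      obtain ⟨u', hu', v', hv', hl, x, hx, hm⟩ := this
      exact ⟨_, Or.inr <| Or.inr <| Or.inr <| Or.inr <| Or.inl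
        ⟨u, hu, v, hv, u', hu', v', hv', x, hx, hf, hl, hm, rfl⟩⟩
  · push Not at hp
    obtain ⟨u, hu, v, hv, hne, htu, htv⟩ := h2
    have key : ∃ u ∈ K, ∃ v ∈ K, S.SkewAt K u v t := by
      rcases lt_or_gt_of_ne hne with h3 | h3
      · exact ⟨u, hu, v, hv, hg, hp, hu, hv, h3, htu, htv⟩
      · exact ⟨v, hv, u, hu, hg, hp, hv, hu, h3, htv, htu⟩
    obtain ⟨u, hu, v, hv, hs⟩ := key
    obtain ⟨y, hy, h4 | h4⟩ := h.exists_shared u hu v hv t ht hs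
    · exact ⟨_, Or.inr <| Or.inr <| Or.inr <| Or.inr <| Or.inr <| Or.inr <| Or.inl
        ⟨u, hu, v, hv, y, hy, hs, h4, rfl⟩⟩
    · exact ⟨_, Or.inr <| Or.inr <| Or.inr <| Or.inr <| Or.inr <| Or.inr <| Or.inr
        ⟨u, hu, v, hv, y, hy, hs, h4, rfl⟩⟩

theorem pr_eq {i j i' j' : ℕ} : pr i j = pr i' j' ↔ i = i' ∧ j = j' :=
  ⟨pr_inj, by rintro ⟨rfl, rfl⟩; rfl⟩

/-- The tag, together with the last component for the tags 1 and 5, identifies the case. The other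
components name what the two segments have in common: mostly a point, otherwise their heights. -/
theorem Good.meets (h : Good S n K X Y g) {t t' c : ℕ} (ht : t < n) (ht' : t' < n)
    (hc : S.Color K X Y g t c) (hc' : S.Color K X Y g t' c) : S.Meets t t' := by
  have hK := h.clique
  unfold Color at hc
  rcases hc with ⟨u, hu, h1, h2, rfl⟩ | ⟨u, hu, h1, h2, rfl⟩ | ⟨u, hu, h1, h2, rfl⟩ |
    ⟨u, hu, v, hv, w, hw, h1, rfl⟩ | ⟨u, hu, v, hv, u₁, hu₁, v₁, hv₁, x, hx, h1, h2, h3, rfl⟩ |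
    ⟨u, hu, v, hv, h1, rfl⟩ |
    ⟨u, hu, v, hv, y, hy, h1, h2, rfl⟩ | ⟨u, hu, v, hv, y, hy, h1, h2, rfl⟩
    <;> simp only [Color, pr_eq, zero_ne_one, one_ne_zero, false_and, and_false, exists_false,
      false_or, or_false, OfNat.zero_ne_ofNat, OfNat.one_ne_ofNat, OfNat.ofNat_ne_zero,
      OfNat.ofNat_ne_one, Nat.reduceEqDiff, true_and, and_true] at hc'
  -- Both segments meet no member other than `u`, so if disjoint they could replace it.
  · obtain ⟨u', hu', h1', h2', rfl⟩ := hc'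
    refine h.swap u hu t ht t' ht' fun w hw hwu => ⟨fun h3 => ?_, fun h3 => ?_⟩
    · exact h1 ⟨u, hu, w, hw, hwu.symm, h2, h3⟩
    · exact h1' ⟨u, hu, w, hw, hwu.symm, h2', h3⟩
  · obtain ⟨u', hu', h1', h2', rfl⟩ := hc'
    exact ⟨_, h2, h2'⟩
  · obtain ⟨u', hu', h1', h2', rfl⟩ := hc'
    exact ⟨_, h2, h2'⟩
  · obtain ⟨u', hu', v', hv', w', hw', h1', rfl, rfl, rfl⟩ := hc'
    exact meets_of_not_inPl h1.2.2.2 h1.1.2 h1'.1.2 h1.2.2.1 h1'.2.2.1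
  · obtain ⟨u', hu', v', hv', u₁', hu₁', v₁', hv₁', x', hx', h1', h2', h3', rfl, rfl, rfl⟩ := hc'
    exact h1.meets hK h1' (h.free_of_mem u₁ hu₁ v₁ hv₁ x hx).1 h2 h3 h3'
  · obtain ⟨u', hu', v', hv', h1', rfl, rfl, e0, e1, e2, e3⟩ := hc'
    by_contra hm
    obtain ⟨o, ho, h3⟩ := exists_lt h1.1.2.2.1.2 h1'.1.2.2.1.2 hm
    have he : g o u v t = g o u v t' := by interval_cases o <;> assumption
    rcases h3 with h3 | h3
    · have := h.height_mono u hu v hv o ho t ht t' ht' h1 h1' h3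
      omega
    · have := h.height_mono u hu v hv o ho t' ht' t ht h1' h1 h3
      omega
  · obtain ⟨u', hu', v', hv', y', hy', h1', h2', rfl, rfl, rfl⟩ := hc'
    exact (h.skew_of_mem u hu v hv y hy).1.meets_of_shared hK hu h2 h2'
  · obtain ⟨u', hu', v', hv', y', hy', h1', h2', rfl, rfl, rfl⟩ := hc'
    exact (h.skew_of_mem u hu v hv y hy).1.meets_of_shared hK hv h2 h2'

/-! ### The number of colors -/

/-- The ordered pairs that describe the planes. -/
noncomputable def keys (S : Segs) (K : Finset ℕ) : Finset (ℕ × ℕ) := by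
  classical exact {p ∈ K ×ˢ K | S.Key K p.1 p.2}

/-- The skew pairs that are met by a segment. -/
noncomputable def skews (S : Segs) (K : Finset ℕ) : Finset (ℕ × ℕ) := by
  classical exact {p ∈ K ×ˢ K | ∃ t, S.SkewAt K p.1 p.2 t}

theorem mem_keys {u v : ℕ} : (u, v) ∈ S.keys K ↔ S.Key K u v := by
  classical
  simp only [keys, mem_filter, mem_product]
  exact ⟨fun h => h.2, fun h => ⟨⟨h.1, h.2.1⟩, h⟩⟩

theorem mem_skews {u v : ℕ} : (u, v) ∈ S.skews K ↔ ∃ t, S.SkewAt K u v t := by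
  classical
  simp only [skews, mem_filter, mem_product]
  exact ⟨fun h => h.2, fun h => ⟨⟨h.choose_spec.2.2.1, h.choose_spec.2.2.2.1⟩, h⟩⟩

/-- Keys and skew pairs never coincide, and neither kind occurs together with a reversed pair. So
with their reversals they fit into the pairs off the diagonal. -/
theorem card_pairs (hK : S.Clique K) : 2 * (#(S.keys K) + #(S.skews K)) + #K ≤ #K * #K := by
  classical
  have h1 : Disjoint (S.keys K) (S.skews K) := by
    rw [disjoint_left]
    rintro ⟨u, v⟩ h1 h2
    obtain ⟨t, h2⟩ := mem_skews.1 h2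
    exact (h2.not_inPl hK).1 (mem_keys.1 h1).2.2.1
  have h2 : Disjoint (S.keys K ∪ S.skews K) ((S.keys K ∪ S.skews K).image Prod.swap) := by
    rw [disjoint_left]
    rintro ⟨u, v⟩ h1 h2
    obtain ⟨⟨v', u'⟩, h4, h3⟩ := mem_image.1 h2
    obtain ⟨rfl, rfl⟩ := Prod.mk.inj h3
    clear h2
    rename' h4 => h2
    simp only [mem_union, mem_keys, mem_skews] at h1 h2
    rcases h1 with h1 | ⟨t, h1⟩ <;> rcases h2 with h2 | ⟨t', h2⟩
    · exact h1.asymm h2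
    · exact (h2.not_inPl hK).2 h1.2.2.1
    · exact (h1.not_inPl hK).2 h2.2.2.1
    · have := h1.2.2.2.2.1
      have := h2.2.2.2.2.1
      omega
  have h3 : (S.keys K ∪ S.skews K) ∪ (S.keys K ∪ S.skews K).image Prod.swap ⊆ K.offDiag := by
    have h4 : ∀ u v, (u, v) ∈ S.keys K ∪ S.skews K → u ∈ K ∧ v ∈ K ∧ u ≠ v := by
      intro u v h
      rw [mem_union, mem_keys, mem_skews] at h
      rcases h with h | ⟨t, h⟩
      · exact ⟨h.1, h.2.1, h.ne⟩
      · exact ⟨h.2.2.1, h.2.2.2.1, h.2.2.2.2.1.ne⟩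
    rintro ⟨u, v⟩ h
    rw [mem_offDiag]
    rcases mem_union.1 h with h | h
    · exact h4 u v h
    · obtain ⟨⟨v', u'⟩, h2, h3⟩ := mem_image.1 h
      obtain ⟨rfl, rfl⟩ := Prod.mk.inj h3
      obtain ⟨h5, h6, h7⟩ := h4 _ _ h2
      exact ⟨h6, h5, h7.symm⟩
  have h4 := card_le_card h3
  rw [card_union_of_disjoint h2, card_image_of_injective _ Prod.swap_injective,
    card_union_of_disjoint h1, offDiag_card] at h4
  have : #K ≤ #K * #K := Nat.le_mul_self _
  omega

/-- For `k ≥ 3` the sum is at most `k ^ 4 + 2 * k * (a + b) + 3 * k`, which suffices. For small `k`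
one needs that a single segment yields no endpoint colors, that there are no chains without planes,
and the term `k - 2`; for `k = 2`, `a = 1` there is no slack. -/
theorem count_le {k a b d₁ d₄ : ℕ} (h : 2 * (a + b) + k ≤ k * k) (h₁ : d₁ ≤ 2 * k)
    (h₁' : k < 2 → d₁ = 0) (h₄ : d₄ ≤ k ^ 4) (h₄' : a = 0 → d₄ = 0) :
    k + d₁ + a * (k - 2) + a * k + d₄ + b * (2 * k) ≤ k ^ 4 + k ^ 3 := by
  rcases Nat.lt_or_ge k 3 with hk | hk
  · interval_cases k
    · have : d₁ = 0 := h₁' (by omega)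
      have : a = 0 := by omega
      have := h₄' this
      subst a; omega
    · have : d₁ = 0 := h₁' (by omega)
      have : a = 0 := by omega
      have := h₄' this
      omega
    · have : a ≤ 1 := by omega
      interval_cases a
      · have := h₄' rfl
        omega
      · omega
  · have h1 : a * (k - 2) ≤ a * k := Nat.mul_le_mul_left _ (Nat.sub_le _ _)
    have h2 : 3 * k ≤ k * k := Nat.mul_le_mul_right k hk
    nlinarith [Nat.mul_le_mul_right k h]

/-- A segment has only one first plane, so the chains of different keys are disjoint sets. -/
theorem Good.card_X (h : Good S n K X Y g) : ∑ p ∈ S.keys K, #(X p.1 p.2) ≤ #K := by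
  classical
  refine le_trans ?_ h.chain_le
  rw [← card_biUnion]
  · refine card_le_card fun x hx => ?_
    obtain ⟨⟨u, v⟩, hp, hx⟩ := mem_biUnion.1 hx
    exact mem_biUnion.2 ⟨u, (mem_keys.1 hp).1, mem_biUnion.2 ⟨v, (mem_keys.1 hp).2.1, hx⟩⟩
  · rintro ⟨u, v⟩ hp ⟨u', v'⟩ hp' hne
    rw [Function.onFun, disjoint_left]
    intro x hx hx'
    rw [mem_coe, mem_keys] at hp hp'
    obtain ⟨h1, h2⟩ := (h.free_of_mem u hp.1 v hp.2.1 x hx).1.unique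
      (h.free_of_mem u' hp'.1 v' hp'.2.1 x hx').1
    exact hne (Prod.ext h1 h2)

/-- The colors that are used. -/
theorem Good.card_le (h : Good S n K X Y g) {F : Finset ℕ}
    (hF : ∀ c ∈ F, ∃ t < n, S.Color K X Y g t c) : #F ≤ #K ^ 4 + #K ^ 3 := by
  classical
  set U := K.biUnion fun u => K.biUnion fun v => X u v with hU
  -- One set of possible colors for each tag.
  let D₀ := K.image (pr 0)
  let D₁ := if 2 ≤ #K then (K ×ˢ range 2).image fun p => pr 1 (pr p.1 p.2) else ∅
  let D₂ := (S.keys K).biUnion fun p => ((K.erase p.1).erase p.2).image fun w =>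
    pr 2 (pr p.1 (pr p.2 w))
  let D₃ := (S.keys K).biUnion fun p => U.image fun x => pr 3 (pr p.1 (pr p.2 x))
  let D₄ := (S.keys K).biUnion fun p => (range #(X p.1 p.2) ×ˢ range #(X p.1 p.2) ×ˢ
    range #(X p.1 p.2) ×ˢ range #(X p.1 p.2)).image fun i =>
      pr 4 (pr p.1 (pr p.2 (pr i.1 (pr i.2.1 (pr i.2.2.1 i.2.2.2)))))
  let D₅ := (S.skews K).biUnion fun p => (Y p.1 p.2 ×ˢ range 2).image fun i =>
    pr 5 (pr p.1 (pr p.2 (pr i.1 i.2)))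
  have two : ∀ {t}, S.Two K t → 2 ≤ #K := by
    rintro t ⟨u, hu, v, hv, hne, -⟩
    exact one_lt_card.2 ⟨u, hu, v, hv, hne⟩
  have hsub : F ⊆ D₀ ∪ D₁ ∪ D₂ ∪ D₃ ∪ D₄ ∪ D₅ := by
    intro c hc
    obtain ⟨t, ht, hc⟩ := hF c hc
    simp only [mem_union]
    rcases hc with ⟨u, hu, h1, h2, rfl⟩ | ⟨u, hu, h1, h2, rfl⟩ | ⟨u, hu, h1, h2, rfl⟩ |
      ⟨u, hu, v, hv, w, hw, h1, rfl⟩ | ⟨u, hu, v, hv, u₁, hu₁, v₁, hv₁, x, hx, h1, h2, h3, rfl⟩ |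
      ⟨u, hu, v, hv, h1, rfl⟩ | ⟨u, hu, v, hv, y, hy, h1, h2, rfl⟩ |
      ⟨u, hu, v, hv, y, hy, h1, h2, rfl⟩
    · exact Or.inl <| Or.inl <| Or.inl <| Or.inl <| Or.inl <| mem_image_of_mem _ hu
    · refine Or.inl <| Or.inl <| Or.inl <| Or.inl <| Or.inr ?_
      simp only [D₁, if_pos (two h1)]
      exact mem_image.2 ⟨(u, 0), mem_product.2 ⟨hu, by simp⟩, rfl⟩
    · refine Or.inl <| Or.inl <| Or.inl <| Or.inl <| Or.inr ?_
      simp only [D₁, if_pos (two h1)]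
      exact mem_image.2 ⟨(u, 1), mem_product.2 ⟨hu, by simp⟩, rfl⟩
    · refine Or.inl <| Or.inl <| Or.inl <| Or.inr ?_
      refine mem_biUnion.2 ⟨(u, v), mem_keys.2 h1.1.1, mem_image.2 ⟨w, ?_, rfl⟩⟩
      -- The member `w` is outside the plane of `u` and `v`, hence different from both; this saves
      -- two colors for each plane.
      refine mem_erase.2 ⟨?_, mem_erase.2 ⟨?_, hw⟩⟩
      · rintro rfl; exact h1.2.2.2 h1.1.1.2.2.1
      · rintro rfl; exact h1.2.2.2 (inPl_v h1.1.1.2.2.1)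
    · refine Or.inl <| Or.inl <| Or.inr ?_
      refine mem_biUnion.2 ⟨(u, v), mem_keys.2 h1.2.2.1.1, mem_image.2 ⟨x, ?_, rfl⟩⟩
      exact mem_biUnion.2 ⟨u₁, hu₁, mem_biUnion.2 ⟨v₁, hv₁, hx⟩⟩
    · refine Or.inl <| Or.inr ?_
      have hg := fun o ho => h.height_lt u hu v hv o ho t ht h1
      refine mem_biUnion.2 ⟨(u, v), mem_keys.2 h1.1.2.2.1.1, mem_image.2
        ⟨(g 0 u v t, g 1 u v t, g 2 u v t, g 3 u v t), ?_, rfl⟩⟩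
      simp only [mem_product, mem_range]
      exact ⟨hg 0 (by norm_num), hg 1 (by norm_num), hg 2 (by norm_num), hg 3 (by norm_num)⟩
    · refine Or.inr <| mem_biUnion.2 ⟨(u, v), mem_skews.2 ⟨t, h1⟩, mem_image.2 ⟨(y, 0), ?_, rfl⟩⟩
      exact mem_product.2 ⟨hy, by simp⟩
    · refine Or.inr <| mem_biUnion.2 ⟨(u, v), mem_skews.2 ⟨t, h1⟩, mem_image.2 ⟨(y, 1), ?_, rfl⟩⟩
      exact mem_product.2 ⟨hy, by simp⟩
  have c₀ : #D₀ ≤ #K := card_image_le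
  have c₁ : #D₁ ≤ 2 * #K := by
    simp only [D₁]
    split_ifs
    · refine card_image_le.trans ?_
      rw [card_product, card_range, mul_comm]
    · simp
  have c₁' : #K < 2 → #D₁ = 0 := fun hk => by
    simp only [D₁]
    rw [if_neg (by omega), card_empty]
  have c₂ : #D₂ ≤ #(S.keys K) * (#K - 2) := by
    refine card_biUnion_le_card_mul _ _ _ ?_
    rintro ⟨u, v⟩ hp
    have hp := mem_keys.1 hp
    refine card_image_le.trans ?_
    rw [card_erase_of_mem (mem_erase.2 ⟨hp.ne.symm, hp.2.1⟩), card_erase_of_mem hp.1]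
    exact le_refl _
  have c₃ : #D₃ ≤ #(S.keys K) * #K :=
    card_biUnion_le_card_mul _ _ _ fun p _ => card_image_le.trans h.chain_le
  -- Three of the four factors are bounded by `#K`; the sum of the remaining ones is at most `#K` by
  -- `card_X`.
  have c₄ : #D₄ ≤ #K ^ 4 := by
    refine card_biUnion_le.trans ?_
    calc _ ≤ ∑ p ∈ S.keys K, #(X p.1 p.2) * #K ^ 3 := by
          refine sum_le_sum fun p hp => card_image_le.trans ?_
          rw [card_product, card_product, card_product, card_range]
          have h1 : #(X p.1 p.2) ≤ #K :=
            (single_le_sum (f := fun p : ℕ × ℕ => #(X p.1 p.2)) (fun _ _ => Nat.zero_le _) hp).trans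
              h.card_X
          refine Nat.mul_le_mul_left _ ?_
          rw [pow_succ, pow_two, mul_assoc]
          exact Nat.mul_le_mul h1 (Nat.mul_le_mul h1 h1)
      _ = (∑ p ∈ S.keys K, #(X p.1 p.2)) * #K ^ 3 := by rw [sum_mul]
      _ ≤ #K * #K ^ 3 := Nat.mul_le_mul_right _ h.card_X
      _ = #K ^ 4 := by ring
  have c₄' : #(S.keys K) = 0 → #D₄ = 0 := fun h0 => by
    simp only [D₄, card_eq_zero.1 h0, biUnion_empty, card_empty]
  have c₅ : #D₅ ≤ #(S.skews K) * (2 * #K) := by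
    refine card_biUnion_le_card_mul _ _ _ ?_
    rintro ⟨u, v⟩ hp
    obtain ⟨t, hp⟩ := mem_skews.1 hp
    refine card_image_le.trans ?_
    rw [card_product, card_range, mul_comm]
    exact Nat.mul_le_mul_left _ (h.skew_le u hp.2.2.1 v hp.2.2.2.1)
  have := count_le (card_pairs h.clique) c₁ c₁' c₄ c₄'
  have h1 := card_le_card hsub
  have h2 := card_union_le (D₀ ∪ D₁ ∪ D₂ ∪ D₃ ∪ D₄) D₅
  have h3 := card_union_le (D₀ ∪ D₁ ∪ D₂ ∪ D₃) D₄
  have h4 := card_union_le (D₀ ∪ D₁ ∪ D₂) D₃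
  have h5 := card_union_le (D₀ ∪ D₁) D₂
  have h6 := card_union_le D₀ D₁
  omega

end Good

end Segs

namespace SegAlg

/-! ### Greedy selections -/

open Classical in
/-- Select `0`, …, `s - 1` in this order, if they satisfy `p` and are unrelated to all previous
selections. -/
noncomputable def greedy (p : ℕ → Prop) (r : ℕ → ℕ → Prop) : ℕ → Finset ℕ
  | 0 => ∅
  | t + 1 => if p t ∧ ¬ ∃ y ∈ greedy p r t, r t y then insert t (greedy p r t) else greedy p r t

section Greedy

variable {p : ℕ → Prop} {r : ℕ → ℕ → Prop} {s : ℕ}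

theorem greedy_mem {x : ℕ} (h : x ∈ greedy p r s) : x < s ∧ p x := by
  induction s with
  | zero => exact absurd h (by simp [greedy])
  | succ s ih =>
    rw [greedy] at h
    split_ifs at h with h1
    · rcases mem_insert.1 h with rfl | h
      · exact ⟨by omega, h1.1⟩
      · exact ⟨(ih h).1.trans (by omega), (ih h).2⟩
    · exact ⟨(ih h).1.trans (by omega), (ih h).2⟩

theorem greedy_unrelated (hr : ∀ x y, r x y → r y x) {x y : ℕ} (hx : x ∈ greedy p r s)
    (hy : y ∈ greedy p r s) (hne : x ≠ y) : ¬ r x y := by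
  induction s with
  | zero => exact absurd hx (by simp [greedy])
  | succ s ih =>
    rw [greedy] at hx hy
    split_ifs at hx hy with h1
    · rcases mem_insert.1 hx with rfl | hx <;> rcases mem_insert.1 hy with rfl | hy
      · exact absurd rfl hne
      · exact fun h => h1.2 ⟨y, hy, h⟩
      · exact fun h => h1.2 ⟨x, hx, hr _ _ h⟩
      · exact ih hx hy
    · exact ih hx hy

theorem greedy_complete (hr : ∀ x, p x → r x x) {t : ℕ} (ht : t < s) (hp : p t) :
    ∃ y ∈ greedy p r s, r t y := by
  induction s with
  | zero => omega
  | succ s ih =>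
    rw [greedy]
    rcases Nat.lt_succ_iff_lt_or_eq.1 ht with h | rfl
    · obtain ⟨y, hy, h⟩ := ih h
      split_ifs
      · exact ⟨y, mem_insert_of_mem hy, h⟩
      · exact ⟨y, hy, h⟩
    · split_ifs with h
      · exact ⟨t, mem_insert_self _ _, hr t hp⟩
      · by_contra h'
        exact h ⟨hp, h'⟩

end Greedy

/-! ### Longest chains -/

open Classical in
/-- The elements of `Q` that are the last ones of chains with `h + 1` elements. -/
noncomputable def level (Q : Finset ℕ) (r : ℕ → ℕ → Prop) : ℕ → Finset ℕ
  | 0 => Q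
  | h + 1 => {x ∈ Q | ∃ y ∈ level Q r h, r y x}

open Classical in
/-- A chain that is built from the top. -/
noncomputable def topChain (H : ℕ → Finset ℕ) (r : ℕ → ℕ → Prop) (n : ℕ) : ℕ → Finset ℕ
  | 0 => ∅
  | s + 1 => topChain H r n s ∪ {x ∈ H (n - s) | (∀ c ∈ topChain H r n s, r x c) ∧
      ∀ x' < x, ¬ (x' ∈ H (n - s) ∧ ∀ c ∈ topChain H r n s, r x' c)}

section Chain

variable {Q : Finset ℕ} {r : ℕ → ℕ → Prop} {n : ℕ}

theorem level_subset (h : ℕ) : level Q r h ⊆ Q := by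
  classical
  cases h with
  | zero => exact Subset.rfl
  | succ h => exact fun x hx => (mem_filter.1 hx).1

theorem topChain_subset (s : ℕ) : topChain (level Q r) r n s ⊆ Q := by
  classical
  induction s with
  | zero => exact empty_subset _
  | succ s ih => exact union_subset ih fun x hx => level_subset _ (mem_filter.1 hx).1

theorem topChain_comparable {s x y : ℕ} (hx : x ∈ topChain (level Q r) r n s)
    (hy : y ∈ topChain (level Q r) r n s) (hne : x ≠ y) : r x y ∨ r y x := by
  induction s with
  | zero => exact absurd hx (by simp [topChain])
  | succ s ih =>
    simp only [topChain, mem_union, mem_filter] at hx hy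
    rcases hx with hx | hx <;> rcases hy with hy | hy
    · exact ih hx hy
    · exact Or.inr (hy.2.1 x hx)
    · exact Or.inl (hx.2.1 y hy)
    · exfalso
      rcases lt_or_gt_of_ne hne with h | h
      · exact hy.2.2 x h ⟨hx.1, hx.2.1⟩
      · exact hx.2.2 y h ⟨hy.1, hy.2.1⟩

/-- Invariant of the construction after the levels from `n` down to `n + 1 - s`: either they are all
empty, or the chain has its least element on the last of them and is long enough compared with every
nonempty level. -/
theorem topChain_spec (ht : ∀ x y z, r x y → r y z → r x z) (hi : ∀ x, ¬ r x x) {s : ℕ}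
    (hs : s ≤ n + 1) :
    (topChain (level Q r) r n s = ∅ ∧ ∀ h ≤ n, n + 1 - s ≤ h → level Q r h = ∅) ∨
    ((∃ c ∈ level Q r (n + 1 - s), ∀ c' ∈ topChain (level Q r) r n s, c' = c ∨ r c c') ∧
      ∀ h ≤ n, (level Q r h).Nonempty → h < #(topChain (level Q r) r n s) + (n + 1 - s)) := by
  classical
  induction s with
  | zero =>
    left
    exact ⟨rfl, fun h h1 h2 => by omega⟩
  | succ s ih =>
    set C := topChain (level Q r) r n s with hC
    have hne : n + 1 - (s + 1) = n - s := by omega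
    have hs' : n + 1 - s = n - s + 1 := by omega
    rw [hne]
    -- Of all candidates only the one with the least index is added.
    have add : ∀ x, x ∈ level Q r (n - s) → (∀ c ∈ C, r x c) → ∃ x ∈ level Q r (n - s),
        (∀ c ∈ C, r x c) ∧ topChain (level Q r) r n (s + 1) = insert x C := by
      intro x h1 h2
      have hex : ∃ x, x ∈ level Q r (n - s) ∧ ∀ c ∈ C, r x c := ⟨x, h1, h2⟩
      have hspec := Nat.find_spec hex
      refine ⟨Nat.find hex, hspec.1, hspec.2, ?_⟩
      rw [topChain, ← hC, insert_eq, union_comm]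
      congr 1
      ext y
      simp only [mem_filter, mem_singleton]
      constructor
      · rintro ⟨h3, h4, h5⟩
        refine le_antisymm (not_lt.1 fun h6 => h5 _ h6 hspec) (Nat.find_min' hex ⟨h3, h4⟩)
      · rintro rfl
        exact ⟨hspec.1, hspec.2, fun x' h => Nat.find_min hex h⟩
    rcases ih (by omega) with ⟨h1, h2⟩ | ⟨⟨c, hc, h1⟩, h2⟩
    · by_cases he : level Q r (n - s) = ∅
      · left
        refine ⟨?_, fun h h3 h4 => ?_⟩
        · rw [topChain, ← hC, he, h1]; rfl
        · rcases Nat.eq_or_lt_of_le h4 with rfl | h5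
          · exact he
          · exact h2 h h3 (by omega)
      · right
        obtain ⟨x, hx⟩ := nonempty_iff_ne_empty.2 he
        obtain ⟨x, hx, -, hx'⟩ := add x hx (by rw [h1]; simp)
        rw [hx', h1]
        refine ⟨⟨x, hx, by simp⟩, fun h h3 h4 => ?_⟩
        by_contra h5
        rw [h2 h h3 (by simp at h5; omega)] at h4
        exact absurd h4 (by simp)
    · right
      -- The least element of the chain has a predecessor one level lower, and by transitivity this
      -- is below the whole chain. So from now on each step adds an element.
      rw [hs', level, mem_filter] at hc
      obtain ⟨hcQ, y, hy, hyc⟩ := hc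
      have hy' : ∀ c' ∈ C, r y c' := fun c' hc' => by
        rcases h1 c' hc' with rfl | h3
        · exact hyc
        · exact ht _ _ _ hyc h3
      obtain ⟨x, hx, hxC, hx'⟩ := add y hy hy'
      rw [hx', card_insert_of_notMem fun h => hi _ (hxC _ h)]
      refine ⟨⟨x, hx, fun c' hc' => ?_⟩, fun h h3 h4 => ?_⟩
      · rcases mem_insert.1 hc' with rfl | h3
        · exact Or.inl rfl
        · exact Or.inr (hxC _ h3)
      · have := h2 h h3 h4
        omega

theorem lt_card_topChain (ht : ∀ x y z, r x y → r y z → r x z) (hi : ∀ x, ¬ r x x) {h : ℕ}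
    (h1 : h ≤ n) (h2 : (level Q r h).Nonempty) : h < #(topChain (level Q r) r n (n + 1)) := by
  rcases topChain_spec (n := n) (Q := Q) ht hi le_rfl with ⟨-, h3⟩ | ⟨-, h3⟩
  · rw [h3 h h1 (by omega)] at h2
    exact absurd h2 (by simp)
  · have := h3 h h1 h2
    omega

-- Every counted `h` belongs to a nonempty level `h + 1`, so `h + 1` is less than the length of the
-- chain.
open Classical in
theorem height_lt_card (ht : ∀ x y z, r x y → r y z → r x z) (hi : ∀ x, ¬ r x x) {x : ℕ}
    (hx : x ∈ Q) : #{h ∈ range n | x ∈ level Q r (h + 1)} <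
      #(topChain (level Q r) r n (n + 1)) := by
  have h0 := lt_card_topChain (n := n) (Q := Q) ht hi (Nat.zero_le n) ⟨x, hx⟩
  have h1 : {h ∈ range n | x ∈ level Q r (h + 1)} ⊆
      range (#(topChain (level Q r) r n (n + 1)) - 1) := by
    intro h hh
    rw [mem_filter, mem_range] at hh
    have := lt_card_topChain (n := n) (Q := Q) ht hi (h := h + 1) (by omega) ⟨x, hh.2⟩
    rw [mem_range]
    omega
  have := card_le_card h1
  rw [card_range] at this
  omega

-- The levels of `x`, shifted by one, are levels of `y`, and level 1 is an additional one. The shift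
-- stays in range because level `n` is empty: a chain in `range n` has at most `n` elements.
open Classical in
theorem height_lt_height (ht : ∀ x y z, r x y → r y z → r x z) (hi : ∀ x, ¬ r x x)
    (hQ : Q ⊆ range n) {x y : ℕ} (hx : x ∈ Q) (hy : y ∈ Q) (h : r x y) :
    #{h ∈ range n | x ∈ level Q r (h + 1)} < #{h ∈ range n | y ∈ level Q r (h + 1)} := by
  have hn : ¬ (level Q r n).Nonempty := fun h => by
    have h1 := lt_card_topChain (n := n) (Q := Q) ht hi le_rfl h
    have h2 := card_le_card ((topChain_subset (Q := Q) (r := r) (n := n) (n + 1)).trans hQ)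
    rw [card_range] at h2
    omega
  have step : ∀ h, x ∈ level Q r h → y ∈ level Q r (h + 1) := fun h' h1 =>
    mem_filter.2 ⟨hy, x, h1, h⟩
  have hsub : insert 0 ({h ∈ range n | x ∈ level Q r (h + 1)}.image Nat.succ) ⊆
      {h ∈ range n | y ∈ level Q r (h + 1)} := by
    intro k hk
    rw [mem_insert, mem_image] at hk
    rw [mem_filter, mem_range]
    rcases hk with rfl | ⟨h', hh, rfl⟩
    · exact ⟨Nat.pos_of_ne_zero fun h0 => by subst h0; simpa using hQ hx, step 0 hx⟩
    · rw [mem_filter, mem_range] at hh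
      refine ⟨?_, step _ hh.2⟩
      rcases Nat.eq_or_lt_of_le (Nat.succ_le_of_lt hh.1) with h1 | h1
      · exact absurd ⟨x, h1 ▸ hh.2⟩ hn
      · exact h1
  have h1 := card_le_card hsub
  rw [card_insert_of_notMem (by simp), card_image_of_injective _ Nat.succ_injective] at h1
  exact h1

end Chain

/-! ### Sets stored in the arrays -/

/-- The set stored in a row of an array. -/
def st (n : ℕ) (α : Arrays) (A i j : ℕ) : Finset ℕ := {x ∈ range n | α A i j x ≠ 0}

theorem mem_st {n : ℕ} {α : Arrays} {A i j x : ℕ} : x ∈ st n α A i j ↔ x < n ∧ α A i j x ≠ 0 := by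
  rw [st, mem_filter, mem_range]

theorem st_congr {n : ℕ} {α β : Arrays} {A i j : ℕ} (h : α A i j = β A i j) :
    st n α A i j = st n β A i j := by
  rw [st, st, h]

variable {I : Inp} {α : Arrays} {ρ : ℕ → ℕ}

/-- Membership in a stored set. -/
def inT (A : ℕ) (e₁ e₂ : Term) (x : ℕ) : Term :=
  andT (ltT (.var x) .size) (.arr A e₁ e₂ (.var x))

/-- Quantification over a stored set. -/
def exM (x A : ℕ) (e₁ e₂ φ : Term) : Term := exT x .size (andT (.arr A e₁ e₂ (.var x)) φ)

theorem holds_in {A : ℕ} {e₁ e₂ : Term} {x : ℕ} : Holds I α ρ (inT A e₁ e₂ x) ↔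
    ρ x ∈ st I.n α A (e₁.eval I α ρ) (e₂.eval I α ρ) := by
  rw [inT, holds_and, holds_lt, mem_st]
  rfl

theorem holds_exM {x A : ℕ} {e₁ e₂ φ : Term} : Holds I α ρ (exM x A e₁ e₂ φ) ↔
    ∃ i, i ∈ st I.n α A (e₁.eval I α (Function.update ρ x i)) (e₂.eval I α (Function.update ρ x i)) ∧
      Holds I α (Function.update ρ x i) φ := by
  simp only [exM, holds_ex, holds_and, mem_st, and_assoc]
  simp only [Holds, Term.eval, Function.update_self]

def prT (e f : Term) : Term := .add (.mul (.add e f) (.add e f)) e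

theorem eval_pr (e f : Term) : (prT e f).eval I α ρ = pr (e.eval I α ρ) (f.eval I α ρ) := rfl

/-- Assign a set to a row. -/
def setS (A : ℕ) (e₁ e₂ : Term) (x : ℕ) (φ : Term) : Stmt := .row A e₁ e₂ x .size φ

open Classical in
theorem st_setS {A : ℕ} {e₁ e₂ : Term} {x : ℕ} {φ : Term} {i j : ℕ} (hi : e₁.eval I α ρ = i)
    (hj : e₂.eval I α ρ = j) : st I.n ((setS A e₁ e₂ x φ).run I ρ α) A i j =
      {k ∈ range I.n | Holds I α (Function.update ρ x k) φ} := by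
  subst hi hj
  ext k
  rw [mem_st, mem_filter, mem_range]
  simp only [setS, Stmt.run, rowSet, Term.eval, true_and, Holds]
  refine and_congr_right fun hk => ?_
  rw [if_pos hk]
  omega

/-- The statement writes only to rows that satisfy `W`. -/
def Stmt.Writes (I : Inp) (W : ℕ → ℕ → ℕ → Prop) : Stmt → (ℕ → ℕ) → Prop
  | .row A e₁ e₂ _ _ _, ρ => ∀ α, W A (e₁.eval I α ρ) (e₂.eval I α ρ)
  | .seq S T, ρ => S.Writes I W ρ ∧ T.Writes I W ρ
  | .rep x _ S, ρ => ∀ i, S.Writes I W (Function.update ρ x i)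
  | .cond _ S, ρ => S.Writes I W ρ

/-- A frame rule: it keeps the rows of different pairs and the clique from disturbing each other. -/
theorem Stmt.Writes.run {W : ℕ → ℕ → ℕ → Prop} {S : Stmt} {ρ : ℕ → ℕ} (h : S.Writes I W ρ)
    (α : Arrays) {A i j : ℕ} (hW : ¬ W A i j) : S.run I ρ α A i j = α A i j := by
  induction S generalizing ρ α with
  | row A' e₁ e₂ x b v =>
    funext k
    simp only [Stmt.run, rowSet]
    refine if_neg fun h' => hW ?_
    rw [h'.1, h'.2.1, h'.2.2.1]
    exact h α
  | seq S T hS hT => exact (hT h.2 _).trans (hS h.1 _)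
  | rep x b S hS =>
    rw [Stmt.run]
    refine iter_induction (fun _ (β : Arrays) => β A i j = α A i j) rfl _ fun i β _ hβ => ?_
    exact (hS (h i) _).trans hβ
  | cond c S hS =>
    rw [Stmt.run]
    split_ifs
    · rfl
    · exact hS h _

/-! ### Formulas about a clique -/

def exK (x : ℕ) (φ : Term) : Term := exM x 0 (.const 0) (.const 0) φ
def kT (x : ℕ) : Term := inT 0 (.const 0) (.const 0) x

theorem holds_exK {x : ℕ} {φ : Term} : Holds I α ρ (exK x φ) ↔
    ∃ i, i ∈ st I.n α 0 0 0 ∧ Holds I α (Function.update ρ x i) φ := holds_exM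

theorem holds_k {x : ℕ} : Holds I α ρ (kT x) ↔ ρ x ∈ st I.n α 0 0 0 := holds_in

def neT (x y : ℕ) : Term := notT (eqT (.var x) (.var y))
def twoT (t : ℕ) : Term := exK 20 (exK 21 (andT (neT 20 21) (andT (meetT t 20) (meetT t 21))))
def endOnT (t : ℕ) : Term := exK 20 (orT (onSegT false 20 t) (onSegT true 20 t))
def genT (t : ℕ) : Term := andT (twoT t) (notT (endOnT t))
def keyT (u v : ℕ) : Term := andT (kT u) (andT (kT v) (andT (inPlT u v v)
  (notT (andT (ltT (.var v) (.var u)) (inPlT v u u)))))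
def plT (u v t : ℕ) : Term := andT (keyT u v) (inPlT u v t)
def outT (u v w t : ℕ) : Term := andT (plT u v t) (andT (kT w) (andT (meetT t w)
  (notT (inPlT u v w))))
def lexT (u' v' u v : ℕ) : Term := orT (ltT (.var u') (.var u))
  (andT (eqT (.var u') (.var u)) (ltT (.var v') (.var v)))
def fstT (u v t : ℕ) : Term := andT (genT t)
  (andT (notT (exK 20 (exK 21 (exK 22 (outT 20 21 22 t))))) (andT (plT u v t)
    (notT (exK 20 (exK 21 (andT (lexT 20 21 u v) (plT 20 21 t)))))))
def skewAtT (u v t : ℕ) : Term := andT (genT t) (andT (notT (exK 20 (exK 21 (plT 20 21 t))))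
  (andT (kT u) (andT (kT v) (andT (ltT (.var u) (.var v)) (andT (meetT t u) (meetT t v))))))
def freeT (u v t : ℕ) : Term := andT (fstT u v t) (notT (exK 20 (exK 21
  (andT (lexT 20 21 u v) (exM 22 2 (.var 20) (.var 21) (meetT t 22))))))

theorem holds_two {t : ℕ} (ht : t < 20) :
    Holds I α ρ (twoT t) ↔ I.segs.Two (st I.n α 0 0 0) (ρ t) := by
  have ht' := ht.trans (by norm_num : 20 < 40)
  simp only [twoT, neT, holds_exK, holds_and, holds_not, holds_eq,
    holds_meet ht' (by norm_num : 20 < 40), holds_meet ht' (by norm_num : 21 < 40), Term.eval,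
    Function.update_self, update_of_lt ht, le_refl, ne_eq, Nat.reduceEqDiff, not_false_eq_true,
    Function.update_of_ne, Nat.reduceLeDiff]
  rfl

theorem holds_endOn {t : ℕ} (ht : t < 20) :
    Holds I α ρ (endOnT t) ↔ I.segs.EndOn (st I.n α 0 0 0) (ρ t) := by
  have ht' := ht.trans (by norm_num : 20 < 40)
  simp only [endOnT, holds_exK, holds_or, holds_onSeg (by norm_num : 20 < 40) ht',
    Function.update_self, update_of_lt ht, le_refl]
  rfl

theorem holds_gen {t : ℕ} (ht : t < 20) :
    Holds I α ρ (genT t) ↔ I.segs.Gen (st I.n α 0 0 0) (ρ t) := by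
  rw [genT, holds_and, holds_not, holds_two ht, holds_endOn ht, Segs.Gen]

theorem holds_key {u v : ℕ} (hu : u < 40) (hv : v < 40) :
    Holds I α ρ (keyT u v) ↔ I.segs.Key (st I.n α 0 0 0) (ρ u) (ρ v) := by
  simp only [keyT, holds_and, holds_not, holds_lt, holds_k, holds_inPl hu hv hv,
    holds_inPl hv hu hu, Segs.Key, Term.eval]

theorem holds_pl {u v t : ℕ} (hu : u < 40) (hv : v < 40) (ht : t < 40) :
    Holds I α ρ (plT u v t) ↔ I.segs.Pl (st I.n α 0 0 0) (ρ u) (ρ v) (ρ t) := by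
  rw [plT, holds_and, holds_key hu hv, holds_inPl hu hv ht, Segs.Pl]

theorem holds_out {u v w t : ℕ} (hu : u < 40) (hv : v < 40) (hw : w < 40) (ht : t < 40) :
    Holds I α ρ (outT u v w t) ↔ I.segs.Out (st I.n α 0 0 0) (ρ u) (ρ v) (ρ w) (ρ t) := by
  simp only [outT, holds_and, holds_not, holds_pl hu hv ht, holds_k, holds_meet ht hw,
    holds_inPl hu hv hw, Segs.Out]

theorem holds_lex {u' v' u v : ℕ} :
    Holds I α ρ (lexT u' v' u v) ↔ Segs.Lex (ρ u') (ρ v') (ρ u) (ρ v) := by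
  simp only [lexT, holds_or, holds_and, holds_lt, holds_eq, Segs.Lex, Term.eval]

theorem holds_fst {u v t : ℕ} (hu : u < 20) (hv : v < 20) (ht : t < 20) :
    Holds I α ρ (fstT u v t) ↔ I.segs.Fst (st I.n α 0 0 0) (ρ u) (ρ v) (ρ t) := by
  have hu' := hu.trans (by norm_num : 20 < 40)
  have hv' := hv.trans (by norm_num : 20 < 40)
  have ht' := ht.trans (by norm_num : 20 < 40)
  simp only [fstT, holds_and, holds_not, holds_gen ht, holds_exK, holds_pl hu' hv' ht', holds_lex,
    holds_out (by norm_num : 20 < 40) (by norm_num : 21 < 40) (by norm_num : 22 < 40) ht',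
    holds_pl (by norm_num : 20 < 40) (by norm_num : 21 < 40) ht', Segs.Fst,
    Function.update_self, update_of_lt ht, update_of_lt hu, update_of_lt hv, le_refl, ne_eq,
    Nat.reduceEqDiff, not_false_eq_true, Function.update_of_ne, Nat.reduceLeDiff]
  -- The formula quantifies over the clique only. This is no restriction, since `Out` and `Pl`
  -- include membership.
  refine and_congr_right fun _ => and_congr ?_ (and_congr_right fun _ => ?_)
  · constructor
    · exact fun h u v w ho => h ⟨u, ho.1.1.1, v, ho.1.1.2.1, w, ho.2.1, ho⟩
    · rintro h ⟨u, -, v, -, w, -, ho⟩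
      exact h u v w ho
  · constructor
    · exact fun h u v hl ho => h ⟨u, ho.1.1, v, ho.1.2.1, hl, ho⟩
    · rintro h ⟨u, -, v, -, hl, ho⟩
      exact h u v hl ho

theorem holds_skewAt {u v t : ℕ} (hu : u < 20) (hv : v < 20) (ht : t < 20) :
    Holds I α ρ (skewAtT u v t) ↔ I.segs.SkewAt (st I.n α 0 0 0) (ρ u) (ρ v) (ρ t) := by
  have hu' := hu.trans (by norm_num : 20 < 40)
  have hv' := hv.trans (by norm_num : 20 < 40)
  have ht' := ht.trans (by norm_num : 20 < 40)
  simp only [skewAtT, holds_and, holds_not, holds_gen ht, holds_exK, holds_k, holds_lt,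
    holds_meet ht' hu', holds_meet ht' hv', Term.eval,
    holds_pl (by norm_num : 20 < 40) (by norm_num : 21 < 40) ht', Segs.SkewAt,
    Function.update_self, update_of_lt ht, le_refl, ne_eq,
    Nat.reduceEqDiff, not_false_eq_true, Function.update_of_ne, Nat.reduceLeDiff]
  refine and_congr_right fun _ => and_congr_left fun _ => ?_
  constructor
  · exact fun h u v ho => h ⟨u, ho.1.1, v, ho.1.2.1, ho⟩
  · rintro h ⟨u, -, v, -, ho⟩
    exact h u v ho

theorem holds_free {u v t : ℕ} (hu : u < 20) (hv : v < 20) (ht : t < 20) :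
    Holds I α ρ (freeT u v t) ↔
      I.segs.Free (st I.n α 0 0 0) (st I.n α 2) (ρ u) (ρ v) (ρ t) := by
  have ht' := ht.trans (by norm_num : 20 < 40)
  simp only [freeT, holds_and, holds_not, holds_fst hu hv ht, holds_exK, holds_exM, holds_lex,
    holds_meet ht' (by norm_num : 22 < 40), Term.eval, Segs.Free,
    Function.update_self, update_of_lt ht, update_of_lt hu, update_of_lt hv, le_refl, ne_eq,
    Nat.reduceEqDiff, not_false_eq_true, Function.update_of_ne, Nat.reduceLeDiff]
  refine and_congr_right fun _ => ?_
  constructor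
  · exact fun h u hu v hv hl x hx hm => h ⟨u, hu, v, hv, hl, x, hx, hm⟩
  · rintro h ⟨u, hu, v, hv, hl, x, hx, hm⟩
    exact h u hu v hv hl x hx hm

/-! ### The color as a term -/

open Classical in
/-- The height of a segment, as given by the arrays. -/
noncomputable def hgt (n : ℕ) (α : Arrays) (o u v t : ℕ) : ℕ :=
  #{h ∈ range n | t ∈ st n α (6 + o) (pr u v) (h + 1)}

def hgtT (o u v t : ℕ) : Term :=
  countT 20 .size (inT (6 + o) (prT (.var u) (.var v)) (.add (.var 20) (.const 1)) t)

theorem eval_hgt {o u v t : ℕ} (hu : u < 20) (hv : v < 20) (ht : t < 20) :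
    (hgtT o u v t).eval I α ρ = hgt I.n α o (ρ u) (ρ v) (ρ t) := by
  classical
  simp only [hgtT, eval_count, hgt, holds_in, eval_pr, Term.eval, Function.update_self,
    update_of_lt ht, update_of_lt hu, update_of_lt hv, le_refl]

def isT (c : ℕ) (e : Term) : Term := eqT (.var c) e

/-- The colors of `t`, as a formula. -/
def colorT (t c : ℕ) : Term :=
  orT (exK 10 (andT (notT (twoT t)) (andT (meetT t 10) (isT c (prT (.const 0) (.var 10)))))) <|
  orT (exK 10 (andT (twoT t) (andT (onSegT false 10 t)
    (isT c (prT (.const 1) (prT (.var 10) (.const 0))))))) <|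
  orT (exK 10 (andT (twoT t) (andT (onSegT true 10 t)
    (isT c (prT (.const 1) (prT (.var 10) (.const 1))))))) <|
  orT (exK 10 (exK 11 (exK 12 (andT (outT 10 11 12 t)
    (isT c (prT (.const 2) (prT (.var 10) (prT (.var 11) (.var 12))))))))) <|
  orT (exK 10 (exK 11 (exK 13 (exK 14 (exM 15 2 (.var 13) (.var 14) (andT (fstT 10 11 t)
    (andT (lexT 13 14 10 11) (andT (meetT t 15)
    (isT c (prT (.const 3) (prT (.var 10) (prT (.var 11) (.var 15))))))))))))) <|
  orT (exK 10 (exK 11 (andT (freeT 10 11 t) (isT c (prT (.const 4) (prT (.var 10) (prT (.var 11)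
    (prT (hgtT 0 10 11 t) (prT (hgtT 1 10 11 t) (prT (hgtT 2 10 11 t) (hgtT 3 10 11 t))))))))))) <|
  orT (exK 10 (exK 11 (exM 15 1 (.var 10) (.var 11) (andT (skewAtT 10 11 t)
    (andT (sharedT 10 t 15) (isT c (prT (.const 5) (prT (.var 10) (prT (.var 11)
      (prT (.var 15) (.const 0)))))))))))
  (exK 10 (exK 11 (exM 15 1 (.var 10) (.var 11) (andT (skewAtT 10 11 t)
    (andT (sharedT 11 t 15) (isT c (prT (.const 5) (prT (.var 10) (prT (.var 11)
      (prT (.var 15) (.const 1)))))))))))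

/-- The hypotheses on the clique and on the skew selections provide the transversality without which
the test for shared points has no meaning. -/
theorem holds_color {t c : ℕ} (ht : t < 10) (hc : c < 10)
    (hK : I.segs.Clique (st I.n α 0 0 0))
    (hY : ∀ u ∈ st I.n α 0 0 0, ∀ v ∈ st I.n α 0 0 0, ∀ y ∈ st I.n α 1 u v,
      I.segs.SkewAt (st I.n α 0 0 0) u v y) :
    Holds I α ρ (colorT t c) ↔ I.segs.Color (st I.n α 0 0 0) (st I.n α 2) (st I.n α 1)
      (hgt I.n α) (ρ t) (ρ c) := by
  have ht' := ht.trans (by norm_num : 10 < 20)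
  have ht'' := ht.trans (by norm_num : 10 < 40)
  have hs : ∀ (x : ℕ), x < 20 → ∀ (ρ : ℕ → ℕ), (ρ x = ρ 10 ∨ ρ x = ρ 11) →
      ρ 10 ∈ st I.n α 0 0 0 → ρ 11 ∈ st I.n α 0 0 0 →
      ρ 15 ∈ st I.n α 1 (ρ 10) (ρ 11) → I.segs.SkewAt (st I.n α 0 0 0) (ρ 10) (ρ 11) (ρ t) →
      (Holds I α ρ (sharedT x t 15) ↔ I.segs.Shared (ρ x) (ρ t) (ρ 15)) := by
    intro x hx ρ hx' hu hv hy h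
    have h' := hY _ hu _ hv _ hy
    have hxK : ρ x ∈ st I.n α 0 0 0 := by
      rcases hx' with h | h <;> rwa [h]
    have h1 : I.segs.Meets (ρ t) (ρ x) := by
      rcases hx' with h2 | h2 <;> rw [h2]
      exacts [h.2.2.2.2.2.1, h.2.2.2.2.2.2]
    have h2 : I.segs.Meets (ρ 15) (ρ x) := by
      rcases hx' with h2 | h2 <;> rw [h2]
      exacts [h'.2.2.2.2.2.1, h'.2.2.2.2.2.2]
    exact holds_shared (hx.trans (by norm_num)) ht'' (by norm_num) (h.1.indep hK hxK h1).symm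
      (h'.1.indep hK hxK h2).symm h1.symm h2.symm
  have h10 : 10 < 20 := by norm_num
  have h11 : 11 < 20 := by norm_num
  have h10' : 10 < 40 := by norm_num
  have h11' : 11 < 40 := by norm_num
  unfold Segs.Color colorT
  simp only [holds_or]
  refine or_congr ?_ <| or_congr ?_ <| or_congr ?_ <| or_congr ?_ <| or_congr ?_ <| or_congr ?_ <|
    or_congr ?_ ?_
  all_goals
    simp only [holds_exK, holds_exM, holds_and, holds_not, holds_two ht', isT, holds_eq, eval_pr,
      holds_meet ht'' h10', holds_meet ht'' (by norm_num : 15 < 40), holds_onSeg h10' ht'',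
      holds_out h10' h11' (by norm_num : 12 < 40) ht'', holds_fst h10 h11 ht', holds_lex,
      holds_free h10 h11 ht', eval_hgt h10 h11 ht', holds_skewAt h10 h11 ht', Term.eval,
      Function.update_self, update_of_lt ht, update_of_lt hc, le_refl, ne_eq,
      Nat.reduceEqDiff, not_false_eq_true, Function.update_of_ne, Nat.reduceLeDiff]
  · rfl
  · rfl
  all_goals
    refine exists_congr fun u => and_congr_right fun hu => exists_congr fun v =>
      and_congr_right fun hv => exists_congr fun y => and_congr_right fun hy =>
      and_congr_right fun h => and_congr_left fun _ => ?_
    rw [hs]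
  all_goals
    simp only [Function.update_self, update_of_lt ht, le_refl, ne_eq, true_or, or_true,
      Nat.reduceEqDiff, not_false_eq_true, Function.update_of_ne, Nat.reduceLeDiff, hu, hv, hy, h,
      Nat.reduceLT]

/-- A bound for numbers that are obtained by `k` pairings. -/
def bound (m : ℕ) : ℕ → ℕ
  | 0 => m
  | k + 1 => pr (bound m k) (bound m k)

theorem pr_le {i j m k : ℕ} (hi : i ≤ bound m k) (hj : j ≤ bound m k) :
    pr i j ≤ bound m (k + 1) := by
  have := Nat.mul_le_mul (add_le_add hi hj) (add_le_add hi hj)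
  rw [bound, pr, pr]
  omega

theorem le_bound {i m : ℕ} (h : i ≤ m) (k : ℕ) : i ≤ bound m k := by
  induction k with
  | zero => exact h
  | succ k ih =>
    refine ih.trans ?_
    rw [bound, pr]
    omega

def boundT (e : Term) : ℕ → Term
  | 0 => e
  | k + 1 => prT (boundT e k) (boundT e k)

theorem eval_bound (e : Term) (k : ℕ) : (boundT e k).eval I α ρ = bound (e.eval I α ρ) k := by
  induction k with
  | zero => rfl
  | succ k ih => rw [boundT, eval_pr, ih, bound]

/-- Tags, indices and heights are at most `n + 5`, and the longest color, that of a free segment,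
takes six pairings. -/
theorem color_le {n t c : ℕ} (h : I.segs.Color (st n α 0 0 0) (st n α 2) (st n α 1)
    (hgt n α) t c) : c ≤ bound (n + 5) 6 := by
  have hst : ∀ {A i j x}, x ∈ st n α A i j → ∀ k, x ≤ bound (n + 5) k := fun h k =>
    le_bound ((mem_st.1 h).1.le.trans (by omega)) k
  have hh : ∀ o u v k, hgt n α o u v t ≤ bound (n + 5) k := fun o u v k => by
    refine le_bound ?_ k
    have : hgt n α o u v t ≤ n := (card_filter_le _ _).trans (card_range n).le
    omega
  have hc : ∀ {i}, i ≤ 5 → ∀ k, i ≤ bound (n + 5) k := fun h k => le_bound (by omega) k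
  have up : ∀ {i k}, i ≤ bound (n + 5) k → i ≤ bound (n + 5) (k + 1) := fun h => by
    refine h.trans ?_
    rw [bound, pr]
    omega
  rcases h with ⟨u, hu, h1, h2, rfl⟩ | ⟨u, hu, h1, h2, rfl⟩ | ⟨u, hu, h1, h2, rfl⟩ |
    ⟨u, hu, v, hv, w, hw, h1, rfl⟩ | ⟨u, hu, v, hv, u₁, hu₁, v₁, hv₁, x, hx, h1, h2, h3, rfl⟩ |
    ⟨u, hu, v, hv, h1, rfl⟩ |
    ⟨u, hu, v, hv, y, hy, h1, h2, rfl⟩ | ⟨u, hu, v, hv, y, hy, h1, h2, rfl⟩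
  · exact pr_le (hc (by norm_num) _) (hst hu _)
  · exact pr_le (hc (by norm_num) _) (pr_le (hst hu _) (hc (by norm_num) _))
  · exact pr_le (hc (by norm_num) _) (pr_le (hst hu _) (hc (by norm_num) _))
  · exact pr_le (hc (by norm_num) _) (pr_le (hst hu _) (pr_le (hst hv _) (hst hw _)))
  · exact pr_le (hc (by norm_num) _) (pr_le (hst hu _) (pr_le (hst hv _) (hst hx _)))
  · exact pr_le (hc (by norm_num) _) (pr_le (hst hu _) (pr_le (hst hv _) (pr_le (hh _ _ _ _)
      (pr_le (hh _ _ _ _) (pr_le (hh _ _ _ _) (hh _ _ _ _))))))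
  · exact pr_le (hc (by norm_num) _) (pr_le (hst hu _) (pr_le (hst hv _) (pr_le (hst hy _)
      (hc (by norm_num) _))))
  · exact pr_le (hc (by norm_num) _) (pr_le (hst hu _) (pr_le (hst hv _) (pr_le (hst hy _)
      (hc (by norm_num) _))))

/-- The color of the segment with the index given by the variable `0`. -/
def outputT : Term := leastT 1 2 (.add (boundT (.add .size (.const 5)) 6) (.const 1)) (colorT 0 2)

theorem color_output {g : ℕ → ℕ → ℕ → ℕ → ℕ} (hg : g = hgt I.n α)
    (h : Segs.Good I.segs I.n (st I.n α 0 0 0) (st I.n α 2) (st I.n α 1) g) (ht : ρ 0 < I.n) :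
    I.segs.Color (st I.n α 0 0 0) (st I.n α 2) (st I.n α 1) g (ρ 0) (outputT.eval I α ρ) := by
  classical
  subst hg
  have hex := h.exists_color ht
  have hh : ∀ ρ : ℕ → ℕ, Holds I α ρ (colorT 0 2) ↔ I.segs.Color (st I.n α 0 0 0) (st I.n α 2)
      (st I.n α 1) (hgt I.n α) (ρ 0) (ρ 2) := fun ρ =>
    holds_color (by norm_num) (by norm_num) h.clique h.skew_of_mem
  have h2 : ∀ i, Function.update ρ 2 i 0 = ρ 0 := fun i => Function.update_of_ne (by norm_num) _ _
  have : outputT.eval I α ρ = Nat.find hex := by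
    refine eval_least ?_ ?_ ?_ ?_
    · simp only [Term.eval, eval_bound]
      exact Nat.lt_succ_of_le (color_le (Nat.find_spec hex))
    · rw [hh, h2, Function.update_self]
      exact Nat.find_spec hex
    · intro i hi
      rw [hh, h2, Function.update_self]
      exact Nat.find_min hex hi
    · intro i j
      rw [hh, hh, h2, Function.update_of_ne (by norm_num), Function.update_of_ne (by norm_num),
        Function.update_self, Function.update_self]
  rw [this]
  exact Nat.find_spec hex

end SegAlg

/-! ### Conditions on the selections for a single pair -/

namespace Segs

/-- The part of `Good` that concerns one pair. -/
structure PairOk (S : Segs) (n : ℕ) (K : Finset ℕ) (X Y : ℕ → ℕ → Finset ℕ)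
    (g : ℕ → ℕ → ℕ → ℕ → ℕ) (u v : ℕ) : Prop where
  skew_of_mem : ∀ y ∈ Y u v, S.SkewAt K u v y
  not_shared : ∀ y ∈ Y u v, ∀ y' ∈ Y u v, y ≠ y' → ¬ S.Shared u y y' ∧ ¬ S.Shared v y y'
  exists_shared : ∀ t < n, S.SkewAt K u v t → ∃ y ∈ Y u v, S.Shared u t y ∨ S.Shared v t y
  free_of_mem : ∀ x ∈ X u v, S.Free K X u v x
  height_lt : ∀ o < 4, ∀ t < n, S.Free K X u v t → g o u v t < #(X u v)
  height_mono : ∀ o < 4, ∀ s < n, ∀ t < n, S.Free K X u v s → S.Free K X u v t →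
    S.Lt u v o s t → g o u v s < g o u v t
  disjoint_of_mem : ∀ x ∈ X u v, ∀ x' ∈ X u v, x ≠ x' → ¬ S.Meets x x'

variable {S : Segs} {n : ℕ} {K : Finset ℕ} {X X' Y Y' : ℕ → ℕ → Finset ℕ}
  {g g' : ℕ → ℕ → ℕ → ℕ → ℕ} {u v : ℕ}

/-- Only the chains of strictly earlier pairs matter, so the chains can be computed one after the
other. -/
theorem free_congr (h : ∀ u' v', Lex u' v' u v → X' u' v' = X u' v') {t : ℕ} :
    S.Free K X' u v t ↔ S.Free K X u v t := by
  refine and_congr_right fun _ => forall_congr' fun u' => forall_congr' fun _ =>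
    forall_congr' fun v' => forall_congr' fun _ => forall_congr' fun hl => ?_
  rw [h _ _ hl]

/-- What holds for a pair survives all changes of chains that belong to later pairs. -/
theorem PairOk.congr (h : PairOk S n K X Y g u v)
    (hX : ∀ u' v', Lex u' v' u v ∨ u' = u ∧ v' = v → X' u' v' = X u' v') (hY : Y' u v = Y u v)
    (hg : ∀ o < 4, ∀ t, g' o u v t = g o u v t) : PairOk S n K X' Y' g' u v := by
  have hf : ∀ {t}, S.Free K X' u v t ↔ S.Free K X u v t :=
    free_congr fun u' v' hl => hX u' v' (Or.inl hl)
  have hX' := hX u v (Or.inr ⟨rfl, rfl⟩)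
  refine ⟨?_, ?_, ?_, ?_, ?_, ?_, ?_⟩
  · rw [hY]; exact h.skew_of_mem
  · rw [hY]; exact h.not_shared
  · rw [hY]; exact h.exists_shared
  · rw [hX']; exact fun x hx => hf.2 (h.free_of_mem x hx)
  · rw [hX']
    intro o ho t ht hft
    rw [hg o ho]
    exact h.height_lt o ho t ht (hf.1 hft)
  · intro o ho s hs t ht h1 h2 h3
    rw [hg o ho, hg o ho]
    exact h.height_mono o ho s hs t ht (hf.1 h1) (hf.1 h2) h3
  · rw [hX']; exact h.disjoint_of_mem

end Segs

namespace SegAlg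

variable {I : Inp} {α : Arrays} {ρ : ℕ → ℕ}

/-! ### The selections for one pair -/

/-- Select segments of a skew pair that do not meet on this pair. -/
def greedyS : Stmt := .seq (setS 1 (.var 1) (.var 2) 6 (.const 0)) (.rep 3 .size
  (setS 1 (.var 1) (.var 2) 6 (orT (inT 1 (.var 1) (.var 2) 6) (andT (eqT (.var 6) (.var 3))
    (andT (skewAtT 1 2 3)
      (notT (exM 24 1 (.var 1) (.var 2) (orT (sharedT 1 3 24) (sharedT 2 3 24)))))))))

theorem holds_zero : ¬ Holds I α ρ (.const 0) := fun h => h rfl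

theorem st_setS_zero {A : ℕ} {e₁ e₂ : Term} {x : ℕ} {i j : ℕ} (hi : e₁.eval I α ρ = i)
    (hj : e₂.eval I α ρ = j) : st I.n ((setS A e₁ e₂ x (.const 0)).run I ρ α) A i j = ∅ := by
  classical
  rw [st_setS hi hj]
  exact filter_false_of_mem fun _ _ => holds_zero

theorem writes_greedyS : greedyS.Writes I (fun A i j => A = 1 ∧ i = ρ 1 ∧ j = ρ 2) ρ := by
  simp [greedyS, Stmt.Writes, setS, Term.eval]

theorem st_greedyS (hK : I.segs.Clique (st I.n α 0 0 0)) :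
    st I.n (greedyS.run I ρ α) 1 (ρ 1) (ρ 2) =
      greedy (I.segs.SkewAt (st I.n α 0 0 0) (ρ 1) (ρ 2))
        (fun t y => I.segs.Shared (ρ 1) t y ∨ I.segs.Shared (ρ 2) t y) I.n := by
  classical
  rw [greedyS, Stmt.run, Stmt.run]
  refine (iter_induction (fun s (β : Arrays) => β 0 0 0 = α 0 0 0 ∧ st I.n β 1 (ρ 1) (ρ 2) =
    greedy (I.segs.SkewAt (st I.n α 0 0 0) (ρ 1) (ρ 2))
      (fun t y => I.segs.Shared (ρ 1) t y ∨ I.segs.Shared (ρ 2) t y) s) ⟨?_, ?_⟩ I.n ?_).2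
  · exact Stmt.Writes.run (W := fun A _ _ => A = 1) (by simp [setS, Stmt.Writes]) _ (by simp)
  · rw [st_setS_zero (i := ρ 1) (j := ρ 2) rfl rfl]
    rfl
  · rintro s β hs ⟨h1, h2⟩
    refine ⟨?_, ?_⟩
    · exact (Stmt.Writes.run (W := fun A _ _ => A = 1) (by simp [setS, Stmt.Writes]) _
        (by simp)).trans h1
    · rw [st_setS (i := ρ 1) (j := ρ 2) (by simp [Term.eval]) (by simp [Term.eval])]
      have h0 : st I.n β 0 0 0 = st I.n α 0 0 0 := st_congr h1
      ext k
      have key : Holds I β (Function.update (Function.update ρ 3 s) 6 k)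
          (orT (inT 1 (.var 1) (.var 2) 6) (andT (eqT (.var 6) (.var 3)) (andT (skewAtT 1 2 3)
          (notT (exM 24 1 (.var 1) (.var 2) (orT (sharedT 1 3 24) (sharedT 2 3 24))))))) ↔
          k ∈ st I.n β 1 (ρ 1) (ρ 2) ∨ k = s ∧ I.segs.SkewAt (st I.n α 0 0 0) (ρ 1) (ρ 2) s ∧
            ¬ ∃ y ∈ st I.n β 1 (ρ 1) (ρ 2), I.segs.Shared (ρ 1) s y ∨ I.segs.Shared (ρ 2) s y := by
        simp only [holds_or, holds_and, holds_not, holds_in, holds_eq, holds_exM,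
          holds_skewAt (by norm_num : 1 < 20) (by norm_num : 2 < 20) (by norm_num : 3 < 20),
          Term.eval, Function.update_self, ne_eq, Nat.reduceEqDiff, not_false_eq_true,
          Function.update_of_ne, OfNat.one_ne_ofNat, h0]
        refine or_congr_right (and_congr_right fun _ => and_congr_right fun hsk =>
          not_congr (exists_congr fun y => and_congr_right fun hy => ?_))
        -- The candidate and all selected segments are transversal to both members of the pair, so
        -- the test for shared points applies.
        have hy' := (greedy_mem (h2 ▸ hy)).2
        obtain ⟨hg, -, hu, hv, -, htu, htv⟩ := hsk
        obtain ⟨hg', -, -, -, -, htu', htv'⟩ := hy'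
        rw [holds_shared (by norm_num) (by norm_num) (by norm_num),
          holds_shared (by norm_num) (by norm_num) (by norm_num)]
        · simp only [Function.update_self, ne_eq, Nat.reduceEqDiff, not_false_eq_true,
            Function.update_of_ne, OfNat.one_ne_ofNat]
        · exact (hg.indep hK hv htv).symm
        · exact (hg'.indep hK hv htv').symm
        · exact htv.symm
        · exact htv'.symm
        · exact (hg.indep hK hu htu).symm
        · exact (hg'.indep hK hu htu').symm
        · exact htu.symm
        · exact htu'.symm
      rw [mem_filter, mem_range, key, h2, greedy]
      constructor
      · rintro ⟨-, h3 | ⟨rfl, h3, h4⟩⟩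
        · split_ifs
          · exact mem_insert_of_mem h3
          · exact h3
        · rw [if_pos ⟨h3, h4⟩]
          exact mem_insert_self _ _
      · intro h3
        split_ifs at h3 with h4
        · rcases mem_insert.1 h3 with rfl | h3
          · exact ⟨hs, Or.inr ⟨rfl, h4⟩⟩
          · exact ⟨(greedy_mem h3).1.trans hs, Or.inl h3⟩
        · exact ⟨(greedy_mem h3).1.trans hs, Or.inl h3⟩

/-- Compute the levels of one of the orders. -/
def levelS (o : ℕ) : Stmt := .rep 4 (.add .size (.const 1))
  (setS (6 + o) (prT (.var 1) (.var 2)) (.var 4) 6 (andT (inT 3 (.var 1) (.var 2) 6)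
    (orT (eqT (.var 4) (.const 0)) (exM 24 (6 + o) (prT (.var 1) (.var 2))
      (.sub (.var 4) (.const 1)) (ordT o 1 2 24 6)))))

theorem writes_levelS (o : ℕ) :
    (levelS o).Writes I (fun A i _ => A = 6 + o ∧ i = pr (ρ 1) (ρ 2)) ρ := by
  simp [levelS, Stmt.Writes, setS, Term.eval, eval_pr]

theorem st_levelS (o : ℕ) {Q : Finset ℕ} (hQ : st I.n α 3 (ρ 1) (ρ 2) = Q)
    (hp : ∀ t ∈ Q, I.segs.InPl (ρ 1) (ρ 2) t) {h : ℕ} (hh : h ≤ I.n) :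
    st I.n ((levelS o).run I ρ α) (6 + o) (pr (ρ 1) (ρ 2)) h =
      level Q (I.segs.Lt (ρ 1) (ρ 2) o) h := by
  classical
  rw [levelS, Stmt.run]
  refine (iter_induction (fun s (β : Arrays) => st I.n β 3 (ρ 1) (ρ 2) = Q ∧ ∀ h < s,
    st I.n β (6 + o) (pr (ρ 1) (ρ 2)) h = level Q (I.segs.Lt (ρ 1) (ρ 2) o) h) ⟨hQ, by simp⟩
      (I.n + 1) ?_).2 h (by omega)
  rintro s β hs ⟨h1, h2⟩
  have hW := fun (A i j : ℕ) hA => Stmt.Writes.run (I := I) (W := fun A i j => A = 6 + o ∧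
      i = pr (ρ 1) (ρ 2) ∧ j = s) (ρ := Function.update ρ 4 s)
      (S := setS (6 + o) (prT (.var 1) (.var 2)) (.var 4) 6 (andT (inT 3 (.var 1) (.var 2) 6)
        (orT (eqT (.var 4) (.const 0)) (exM 24 (6 + o) (prT (.var 1) (.var 2))
          (.sub (.var 4) (.const 1)) (ordT o 1 2 24 6)))))
      (by simp [setS, Stmt.Writes, eval_pr, Term.eval]) β (A := A) (i := i) (j := j) hA
  refine ⟨?_, fun h hhs => ?_⟩
  · rw [st_congr (hW _ _ _ (by omega)), h1]
  rcases Nat.lt_succ_iff_lt_or_eq.1 hhs with h3 | rfl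
  · rw [st_congr (hW _ _ _ (by omega)), h2 h h3]
  rw [st_setS (i := pr (ρ 1) (ρ 2)) (j := h) (by simp [eval_pr, Term.eval]) (by simp [Term.eval])]
  have hQn : ∀ {k}, k ∈ Q → k < I.n := fun hk => (mem_st.1 (h1 ▸ hk)).1
  ext k
  simp only [mem_filter, mem_range, holds_or, holds_and, holds_in, holds_eq, holds_exM,
    Term.eval, Function.update_self, ne_eq, Nat.reduceEqDiff, not_false_eq_true, eval_pr,
    Function.update_of_ne, OfNat.one_ne_ofNat, h1]
  cases h with
  | zero =>
    simp only [true_or, and_true, level]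
    exact ⟨fun h => h.2, fun h => ⟨hQn h, h⟩⟩
  | succ h =>
    simp only [Nat.succ_ne_zero, false_or, Nat.add_sub_cancel, h2 h (by omega), level, mem_filter]
    have key : k ∈ Q → ∀ y ∈ level Q (I.segs.Lt (ρ 1) (ρ 2) o) h,
        (Holds I β (Function.update (Function.update (Function.update ρ 4 (h + 1)) 6 k) 24 y)
          (ordT o 1 2 24 6) ↔ I.segs.Lt (ρ 1) (ρ 2) o y k) := by
      intro hk y hy
      rw [holds_ord (by norm_num) (by norm_num) (by norm_num) (by norm_num)]
      · simp
      · simpa using hp y (level_subset _ hy)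
      · simpa using hp k hk
    constructor
    · rintro ⟨-, hk, y, hy, h3⟩
      exact ⟨hk, y, hy, (key hk y hy).1 h3⟩
    · rintro ⟨hk, y, hy, h3⟩
      exact ⟨hQn hk, hk, y, hy, (key hk y hy).2 h3⟩

/-- In pass `s`, the value of variable 5, a candidate for the chain lies on level `n - s` and below
everything in the chain, which is stored in array 4. -/
def candT (o x : ℕ) : Term :=
  andT (inT (6 + o) (prT (.var 1) (.var 2)) (.sub .size (.var 5)) x)
    (notT (exM 24 4 (.var 1) (.var 2) (notT (ordT o 1 2 x 24))))

/-- Build a longest chain from its top. -/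
def chainS (o : ℕ) : Stmt := .seq (setS 4 (.var 1) (.var 2) 6 (.const 0))
  (.rep 5 (.add .size (.const 1)) (setS 4 (.var 1) (.var 2) 6 (orT (inT 4 (.var 1) (.var 2) 6)
    (andT (candT o 6) (notT (exT 25 (.var 6) (candT o 25)))))))

theorem writes_chainS (o : ℕ) :
    (chainS o).Writes I (fun A i j => A = 4 ∧ i = ρ 1 ∧ j = ρ 2) ρ := by
  simp [chainS, Stmt.Writes, setS, Term.eval]

theorem st_chainS (o : ℕ) {Q : Finset ℕ} (hp : ∀ t ∈ Q, I.segs.InPl (ρ 1) (ρ 2) t)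
    (hl : ∀ h ≤ I.n, st I.n α (6 + o) (pr (ρ 1) (ρ 2)) h =
      level Q (I.segs.Lt (ρ 1) (ρ 2) o) h) :
    st I.n ((chainS o).run I ρ α) 4 (ρ 1) (ρ 2) =
      topChain (level Q (I.segs.Lt (ρ 1) (ρ 2) o)) (I.segs.Lt (ρ 1) (ρ 2) o) I.n (I.n + 1) := by
  classical
  rw [chainS, Stmt.run, Stmt.run]
  refine (iter_induction (fun s (β : Arrays) => (∀ i j, β (6 + o) i j = α (6 + o) i j) ∧
    st I.n β 4 (ρ 1) (ρ 2) = topChain (level Q (I.segs.Lt (ρ 1) (ρ 2) o))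
      (I.segs.Lt (ρ 1) (ρ 2) o) I.n s) ⟨?_, ?_⟩ (I.n + 1) ?_).2
  · exact fun i j => Stmt.Writes.run (W := fun A _ _ => A = 4) (by simp [setS, Stmt.Writes]) _
      (by omega)
  · rw [st_setS_zero (i := ρ 1) (j := ρ 2) rfl rfl]
    rfl
  · rintro s β hs ⟨h1, h2⟩
    refine ⟨fun i j => ?_, ?_⟩
    · exact (Stmt.Writes.run (W := fun A _ _ => A = 4) (by simp [setS, Stmt.Writes]) _
        (by omega)).trans (h1 i j)
    rw [st_setS (i := ρ 1) (j := ρ 2) (by simp [Term.eval]) (by simp [Term.eval])]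
    have hl' : st I.n β (6 + o) (pr (ρ 1) (ρ 2)) (I.n - s) =
        level Q (I.segs.Lt (ρ 1) (ρ 2) o) (I.n - s) :=
      (st_congr (h1 _ _)).trans (hl _ (by omega))
    have cand : ∀ (x : ℕ) (ρ' : ℕ → ℕ), x < 38 → x ≠ 24 → ρ' 1 = ρ 1 → ρ' 2 = ρ 2 → ρ' 5 = s →
        (Holds I β ρ' (candT o x) ↔ ρ' x ∈ level Q (I.segs.Lt (ρ 1) (ρ 2) o) (I.n - s) ∧
          ∀ c ∈ topChain (level Q (I.segs.Lt (ρ 1) (ρ 2) o)) (I.segs.Lt (ρ 1) (ρ 2) o) I.n s,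
            I.segs.Lt (ρ 1) (ρ 2) o (ρ' x) c) := by
      intro x ρ' hx hx' e1 e2 e5
      simp only [candT, holds_and, holds_not, holds_in, holds_exM, Term.eval, eval_pr, ne_eq,
        Nat.reduceEqDiff, not_false_eq_true, Function.update_of_ne, OfNat.one_ne_ofNat, e1, e2, e5,
        hl', h2]
      refine and_congr_right fun h3 => ?_
      have key : ∀ c ∈ topChain (level Q (I.segs.Lt (ρ 1) (ρ 2) o)) (I.segs.Lt (ρ 1) (ρ 2) o) I.n s,
          (Holds I β (Function.update ρ' 24 c) (ordT o 1 2 x 24) ↔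
            I.segs.Lt (ρ 1) (ρ 2) o (ρ' x) c) := by
        intro c hc
        rw [holds_ord (by norm_num) (by norm_num) hx (by norm_num)]
        · simp [e1, e2, hx']
        · simpa [e1, e2, hx'] using hp _ (level_subset _ h3)
        · simpa [e1, e2] using hp _ (topChain_subset _ hc)
      constructor
      · intro h4 c hc
        by_contra h5
        exact h4 ⟨c, hc, fun h6 => h5 ((key c hc).1 h6)⟩
      · rintro h4 ⟨c, hc, h5⟩
        exact h5 ((key c hc).2 (h4 c hc))
    ext k
    rw [mem_filter, mem_range, topChain, mem_union, mem_filter, ← h2, holds_or, holds_in, holds_and,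
      holds_not, holds_ex]
    rw [cand 6 _ (by norm_num) (by norm_num) (by simp) (by simp) (by simp)]
    have c25 : ∀ i, _ ↔ _ := fun i => cand 25
      (Function.update (Function.update (Function.update ρ 5 s) 6 k) 25 i) (by norm_num)
      (by norm_num) (by simp) (by simp) (by simp)
    simp only [c25, Term.eval, Function.update_self, ne_eq, Nat.reduceEqDiff, not_false_eq_true,
      Function.update_of_ne, OfNat.one_ne_ofNat, ← h2]
    constructor
    · rintro ⟨-, h3 | ⟨⟨h3, h4⟩, h5⟩⟩
      · exact Or.inl h3
      · exact Or.inr ⟨h3, h4, fun x' hx' h6 => h5 ⟨x', hx', h6⟩⟩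
    · rintro (h3 | ⟨h3, h4, h5⟩)
      · exact ⟨(mem_st.1 h3).1, Or.inl h3⟩
      · refine ⟨?_, Or.inr ⟨⟨h3, h4⟩, fun ⟨x', hx', h6⟩ => h5 x' hx' h6⟩⟩
        rw [← hl'] at h3
        exact (mem_st.1 h3).1

theorem eval_card {x A : ℕ} {e₁ e₂ : Term} {i j : ℕ}
    (hi : ∀ k, e₁.eval I α (Function.update ρ x k) = i)
    (hj : ∀ k, e₂.eval I α (Function.update ρ x k) = j) :
    (countT x .size (inT A e₁ e₂ x)).eval I α ρ = #(st I.n α A i j) := by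
  classical
  rw [eval_count]
  congr 1
  ext k
  rw [mem_filter, holds_in, hi, hj, Function.update_self, mem_range]
  exact ⟨fun h => h.2, fun h => ⟨(mem_st.1 h).1, h⟩⟩

/-- Keep the chain if it is longer. -/
def pickS : Stmt := .cond (ltT (countT 6 .size (inT 2 (.var 1) (.var 2) 6))
  (countT 6 .size (inT 4 (.var 1) (.var 2) 6)))
  (setS 2 (.var 1) (.var 2) 6 (inT 4 (.var 1) (.var 2) 6))

theorem writes_pickS : pickS.Writes I (fun A i j => A = 2 ∧ i = ρ 1 ∧ j = ρ 2) ρ := by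
  simp [pickS, Stmt.Writes, setS, Term.eval]

theorem run_cond {c : Term} {S : Stmt} : (Stmt.cond c S).run I ρ α =
    open Classical in if Holds I α ρ c then S.run I ρ α else α := by
  classical
  rw [Stmt.run, Holds]
  split_ifs <;> first | rfl | contradiction

theorem st_pickS : st I.n (pickS.run I ρ α) 2 (ρ 1) (ρ 2) =
    if #(st I.n α 2 (ρ 1) (ρ 2)) < #(st I.n α 4 (ρ 1) (ρ 2)) then st I.n α 4 (ρ 1) (ρ 2)
    else st I.n α 2 (ρ 1) (ρ 2) := by
  classical
  rw [pickS, run_cond, holds_lt, eval_card (i := ρ 1) (j := ρ 2) (by simp [Term.eval])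
    (by simp [Term.eval]), eval_card (i := ρ 1) (j := ρ 2) (by simp [Term.eval])
    (by simp [Term.eval])]
  split_ifs
  · rw [st_setS (i := ρ 1) (j := ρ 2) rfl rfl]
    ext k
    simp only [mem_filter, mem_range, holds_in, Term.eval, Function.update_self, ne_eq,
      Nat.reduceEqDiff, not_false_eq_true, Function.update_of_ne, OfNat.one_ne_ofNat]
    exact ⟨fun h => h.2, fun h => ⟨(mem_st.1 h).1, h⟩⟩
  · rfl

def orderS (o : ℕ) : Stmt := .seq (levelS o) (.seq (chainS o) pickS)

theorem Stmt.Writes.mono {W W' : ℕ → ℕ → ℕ → Prop} {S : Stmt} (h : S.Writes I W ρ)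
    (hW : ∀ A i j, W A i j → W' A i j) : S.Writes I W' ρ := by
  induction S generalizing ρ with
  | row A' e₁ e₂ x b v => exact fun α => hW _ _ _ (h α)
  | seq S T hS hT => exact ⟨hS h.1, hT h.2⟩
  | rep x b S hS => exact fun i => hS (h i)
  | cond c S hS => exact hS h

theorem writes_orderS (o : ℕ) : (orderS o).Writes I (fun A i j =>
    ((A = 2 ∨ A = 4) ∧ i = ρ 1 ∧ j = ρ 2) ∨ A = 6 + o ∧ i = pr (ρ 1) (ρ 2)) ρ :=
  ⟨(writes_levelS o).mono fun _ _ _ => Or.inr,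
    (writes_chainS o).mono fun _ _ _ h => Or.inl ⟨Or.inr h.1, h.2⟩,
    writes_pickS.mono fun _ _ _ h => Or.inl ⟨Or.inl h.1, h.2⟩⟩

/-- The first `m` orders have been processed. -/
structure OrdersDone (I : Inp) (Q : Finset ℕ) (u v m : ℕ) (β : Arrays) : Prop where
  set : st I.n β 3 u v = Q
  level : ∀ o < m, ∀ h ≤ I.n, st I.n β (6 + o) (pr u v) h = level Q (I.segs.Lt u v o) h
  card : ∀ o < m, #(topChain (SegAlg.level Q (I.segs.Lt u v o)) (I.segs.Lt u v o) I.n (I.n + 1)) ≤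
    #(st I.n β 2 u v)
  chain : st I.n β 2 u v = ∅ ∨ ∃ o, st I.n β 2 u v =
    topChain (SegAlg.level Q (I.segs.Lt u v o)) (I.segs.Lt u v o) I.n (I.n + 1)

/-- The new chain is built in array 4 and moves to array 2 only if it is longer. So array 2 keeps a
longest chain over all orders processed so far, which bounds the heights in each of them. -/
theorem OrdersDone.step {Q : Finset ℕ} {m : ℕ} (hp : ∀ t ∈ Q, I.segs.InPl (ρ 1) (ρ 2) t)
    (h : OrdersDone I Q (ρ 1) (ρ 2) m α) :
    OrdersDone I Q (ρ 1) (ρ 2) (m + 1) ((orderS m).run I ρ α) := by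
  have hW := fun A i j => (writes_orderS (I := I) (ρ := ρ) m).run α (A := A) (i := i) (j := j)
  set β := (orderS m).run I ρ α with hβ
  set α₁ := (levelS m).run I ρ α with hα₁
  set α₂ := (chainS m).run I ρ α₁ with hα₂
  have hβ' : β = pickS.run I ρ α₂ := rfl
  have l₁ : ∀ h ≤ I.n, st I.n α₁ (6 + m) (pr (ρ 1) (ρ 2)) h =
      SegAlg.level Q (I.segs.Lt (ρ 1) (ρ 2) m) h := fun h' hh => st_levelS m h.set hp hh
  have l₂ := st_chainS m hp l₁
  have e₂ : st I.n α₂ 2 (ρ 1) (ρ 2) = st I.n α 2 (ρ 1) (ρ 2) := by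
    rw [hα₂, st_congr ((writes_chainS m).run _ (by simp)),
      st_congr ((writes_levelS m).run _ (by omega))]
  have l₃ : st I.n β 2 (ρ 1) (ρ 2) = _ := st_pickS (I := I) (ρ := ρ) (α := α₂)
  rw [l₂, e₂] at l₃
  refine ⟨?_, fun o ho h' hh => ?_, fun o ho => ?_, ?_⟩
  · rw [st_congr (hW _ _ _ (by omega)), h.set]
  · rcases Nat.lt_succ_iff_lt_or_eq.1 ho with ho | rfl
    · rw [st_congr (hW _ _ _ (by omega)), h.level o ho h' hh]
    · rw [hβ', st_congr (writes_pickS.run _ (by omega)), hα₂,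
        st_congr ((writes_chainS o).run _ (by omega)), l₁ h' hh]
  · rw [l₃]
    rcases Nat.lt_succ_iff_lt_or_eq.1 ho with ho | rfl
    · have := h.card o ho
      split_ifs <;> omega
    · split_ifs <;> omega
  · rw [l₃]
    split_ifs
    · exact Or.inr ⟨m, rfl⟩
    · exact h.chain

/-- The selections for one pair. -/
def pairS : Stmt := .seq greedyS <| .seq (setS 3 (.var 1) (.var 2) 6 (freeT 1 2 6)) <|
  .seq (setS 2 (.var 1) (.var 2) 6 (.const 0)) <|
  .seq (orderS 0) <| .seq (orderS 1) <| .seq (orderS 2) (orderS 3)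

theorem writes_pairS : pairS.Writes I (fun A i j => (1 ≤ A ∧ A ≤ 4 ∧ i = ρ 1 ∧ j = ρ 2) ∨
    6 ≤ A ∧ A < 10 ∧ i = pr (ρ 1) (ρ 2)) ρ := by
  have ho : ∀ o < 4, (orderS o).Writes I (fun A i j => (1 ≤ A ∧ A ≤ 4 ∧ i = ρ 1 ∧ j = ρ 2) ∨
      6 ≤ A ∧ A < 10 ∧ i = pr (ρ 1) (ρ 2)) ρ := fun o ho =>
    (writes_orderS o).mono fun A i j h => by omega
  refine ⟨writes_greedyS.mono fun A i j h => by omega, ?_, ?_, ho 0 (by norm_num),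
    ho 1 (by norm_num), ho 2 (by norm_num), ho 3 (by norm_num)⟩ <;>
  simp [setS, Stmt.Writes, Term.eval]

theorem pairOk_pairS (hK : I.segs.Clique (st I.n α 0 0 0)) :
    I.segs.PairOk I.n (st I.n α 0 0 0) (st I.n (pairS.run I ρ α) 2) (st I.n (pairS.run I ρ α) 1)
      (hgt I.n (pairS.run I ρ α)) (ρ 1) (ρ 2) := by
  classical
  set u := ρ 1 with hu
  set v := ρ 2 with hv
  set β := pairS.run I ρ α with hβ
  have hW := fun A i j => (writes_pairS (I := I) (ρ := ρ)).run α (A := A) (i := i) (j := j)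
  rw [← hβ] at hW
  set K := st I.n α 0 0 0 with hKdef
  set α₁ := greedyS.run I ρ α with hα₁
  set α₂ := (setS 3 (.var 1) (.var 2) 6 (freeT 1 2 6)).run I ρ α₁ with hα₂
  set α₃ := (setS 2 (.var 1) (.var 2) 6 (.const 0)).run I ρ α₂ with hα₃
  have hβ' : β = (orderS 3).run I ρ ((orderS 2).run I ρ ((orderS 1).run I ρ
    ((orderS 0).run I ρ α₃))) := rfl
  have w₁ := fun A i j => (writes_greedyS (I := I) (ρ := ρ)).run α (A := A) (i := i) (j := j)
  have w₂ := fun A i j => Stmt.Writes.run (I := I) (W := fun A i j => A = 3 ∧ i = u ∧ j = v)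
    (S := setS 3 (.var 1) (.var 2) 6 (freeT 1 2 6)) (ρ := ρ)
    (by simp [setS, Stmt.Writes, Term.eval, hu, hv]) α₁ (A := A) (i := i) (j := j)
  have w₃ := fun A i j => Stmt.Writes.run (I := I) (W := fun A i j => A = 2 ∧ i = u ∧ j = v)
    (S := setS 2 (.var 1) (.var 2) 6 (.const 0)) (ρ := ρ)
    (by simp [setS, Stmt.Writes, Term.eval, hu, hv]) α₂ (A := A) (i := i) (j := j)
  have wo := fun (γ : Arrays) (o A i j : ℕ) => (writes_orderS (I := I) (ρ := ρ) o).run γ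
    (A := A) (i := i) (j := j)
  have hY : st I.n β 1 u v = greedy (I.segs.SkewAt K u v)
      (fun t y => I.segs.Shared u t y ∨ I.segs.Shared v t y) I.n := by
    have h1 : β 1 u v = α₁ 1 u v := by
      rw [hβ', wo _ _ _ _ _ (by omega), wo _ _ _ _ _ (by omega), wo _ _ _ _ _ (by omega),
        wo _ _ _ _ _ (by omega), hα₃, w₃ _ _ _ (by omega), hα₂, w₂ _ _ _ (by omega)]
    rw [st_congr h1]
    exact st_greedyS hK
  -- Freeness may be expressed by the final contents of array 2, because the rows of earlier pairs
  -- are not written here.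
  set Q : Finset ℕ := {t ∈ range I.n | I.segs.Free K (st I.n β 2) u v t} with hQ
  have hp : ∀ t ∈ Q, I.segs.InPl u v t := fun t ht => (mem_filter.1 ht).2.1.2.2.1.2
  have hQ₂ : st I.n α₂ 3 u v = Q := by
    rw [hα₂, st_setS (i := u) (j := v) rfl rfl, hQ]
    refine filter_congr fun t ht => ?_
    rw [holds_free (by norm_num) (by norm_num) (by norm_num),
      st_congr (w₁ 0 0 0 (by omega)), Function.update_self,
      Function.update_of_ne (by norm_num), Function.update_of_ne (by norm_num)]
    refine Segs.free_congr fun u' v' hl => ?_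
    unfold Segs.Lex at hl
    exact st_congr (by rw [hα₁, w₁ _ _ _ (by omega), hW _ _ _ (by omega)])
  have h0 : OrdersDone I Q u v 0 α₃ := by
    refine ⟨?_, by simp, by simp, Or.inl (st_setS_zero rfl rfl)⟩
    rw [st_congr (w₃ _ _ _ (by omega)), hQ₂]
  have h4 : OrdersDone I Q u v 4 β :=
    OrdersDone.step hp (OrdersDone.step hp (OrdersDone.step hp (OrdersDone.step hp h0)))
  have tr : ∀ o x y z, I.segs.Lt u v o x y → I.segs.Lt u v o y z → I.segs.Lt u v o x z :=
    fun _ _ _ _ => Segs.Lt.trans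
  have irr : ∀ o x, ¬ I.segs.Lt u v o x x := fun _ _ => Segs.Lt.irrefl
  have hh : ∀ o < 4, ∀ t, hgt I.n β o u v t =
      #{h ∈ range I.n | t ∈ level Q (I.segs.Lt u v o) (h + 1)} := by
    intro o ho t
    unfold hgt
    congr 1
    refine filter_congr fun h hh => ?_
    rw [h4.level o ho (h + 1) (mem_range.1 hh)]
  have hQm : ∀ t < I.n, I.segs.Free K (st I.n β 2) u v t → t ∈ Q := fun t ht hf =>
    mem_filter.2 ⟨mem_range.2 ht, hf⟩
  refine ⟨?_, ?_, ?_, ?_, ?_, ?_, ?_⟩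
  · rw [hY]
    exact fun y hy => (greedy_mem hy).2
  · rw [hY]
    intro y hy y' hy' hne
    have := greedy_unrelated (fun x y h => ?_) hy hy' hne
    · exact not_or.1 this
    · rcases h with ⟨P, h1, h2, h3⟩ | ⟨P, h1, h2, h3⟩
      · exact Or.inl ⟨P, h1, h3, h2⟩
      · exact Or.inr ⟨P, h1, h3, h2⟩
  · rw [hY]
    refine fun t ht hs => greedy_complete (fun x hx => ?_) ht hs
    obtain ⟨P, h1, h2⟩ := hx.2.2.2.2.2.1
    exact Or.inl ⟨P, h2, h1, h1⟩
  · intro x hx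
    rcases h4.chain with h | ⟨o, h⟩
    · rw [h] at hx; exact absurd hx (by simp)
    · rw [h] at hx
      exact (mem_filter.1 (topChain_subset _ hx)).2
  · intro o ho t ht hf
    rw [hh o ho]
    exact (height_lt_card (tr o) (irr o) (hQm t ht hf)).trans_le (h4.card o ho)
  · intro o ho s hs t ht hf hf' hlt
    rw [hh o ho, hh o ho]
    exact height_lt_height (tr o) (irr o) (filter_subset _ _) (hQm s hs hf) (hQm t ht hf') hlt
  · intro x hx x' hx' hne
    rcases h4.chain with h | ⟨o, h⟩
    · rw [h] at hx; exact absurd hx (by simp)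
    · rw [h] at hx hx'
      rcases topChain_comparable hx hx' hne with h | h
      · exact h.not_meets
      · exact fun h' => h.not_meets h'.symm

end SegAlg

namespace SegAlg

variable {I : Inp} {α : Arrays} {ρ : ℕ → ℕ}

/-! ### All selections -/

/-- The nested loops visit the pairs in lexicographic order. `J` is an invariant, and `P` has to be
established for the current pair and preserved for the earlier ones. -/
theorem rep_lex {S : Stmt} {J : Arrays → Prop} {P : ℕ → ℕ → Arrays → Prop}
    (h : ∀ u < I.n, ∀ v < I.n, ∀ α, J α →
      (∀ u' < I.n, ∀ v' < I.n, Segs.Lex u' v' u v → P u' v' α) →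
      J (S.run I (Function.update (Function.update ρ 1 u) 2 v) α) ∧
        P u v (S.run I (Function.update (Function.update ρ 1 u) 2 v) α) ∧
        ∀ u' < I.n, ∀ v' < I.n, Segs.Lex u' v' u v →
          P u' v' (S.run I (Function.update (Function.update ρ 1 u) 2 v) α)) (hJ : J α) :
    J ((Stmt.rep 1 .size (.rep 2 .size S)).run I ρ α) ∧ ∀ u < I.n, ∀ v < I.n,
      P u v ((Stmt.rep 1 .size (.rep 2 .size S)).run I ρ α) := by
  rw [Stmt.run]
  refine iter_induction (fun k (β : Arrays) => J β ∧ ∀ u < k, ∀ v < I.n, P u v β) ⟨hJ, by simp⟩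
    I.n ?_
  rintro u β hu ⟨h1, h2⟩
  rw [Stmt.run]
  have key := iter_induction (f := fun i => S.run I
    (Function.update (Function.update ρ 1 u) 2 i)) (a := β) (fun k (β : Arrays) => J β ∧
      ∀ u' < I.n, ∀ v' < I.n, Segs.Lex u' v' u k → P u' v' β) ?_ I.n ?_
  · refine ⟨key.1, fun u' hu' v' hv' => key.2 u' (by omega) v' hv' ?_⟩
    unfold Segs.Lex
    omega
  · refine ⟨h1, fun u' _ v' hv' hl => h2 u' ?_ v' hv'⟩
    unfold Segs.Lex at hl
    omega
  · rintro v γ hv ⟨h3, h4⟩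
    obtain ⟨h5, h6, h7⟩ := h u hu v hv γ h3 h4
    refine ⟨h5, fun u' hu' v' hv' hl => ?_⟩
    by_cases h8 : u' = u ∧ v' = v
    · obtain ⟨rfl, rfl⟩ := h8
      exact h6
    · refine h7 u' hu' v' hv' ?_
      unfold Segs.Lex at hl ⊢
      omega

def computeS : Stmt := .rep 1 .size (.rep 2 .size pairS)

theorem writes_computeS : computeS.Writes I (fun A _ _ => A ≠ 0 ∧ A ≠ 5) ρ := by
  intro i j
  exact writes_pairS.mono fun A _ _ h => by omega

theorem pairOk_computeS (hK : I.segs.Clique (st I.n α 0 0 0)) {u v : ℕ} (hu : u < I.n)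
    (hv : v < I.n) : I.segs.PairOk I.n (st I.n α 0 0 0) (st I.n (computeS.run I ρ α) 2)
      (st I.n (computeS.run I ρ α) 1) (hgt I.n (computeS.run I ρ α)) u v := by
  classical
  refine (rep_lex (J := fun β => β 0 0 0 = α 0 0 0) (P := fun u v β =>
    I.segs.PairOk I.n (st I.n α 0 0 0) (st I.n β 2) (st I.n β 1) (hgt I.n β) u v)
    (fun u hu v hv β hJ hP => ?_) rfl).2 u hu v hv
  have hW := fun A i j => (writes_pairS (I := I)
    (ρ := Function.update (Function.update ρ 1 u) 2 v)).run β (A := A) (i := i) (j := j)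
  simp only [Function.update_self, ne_eq, Function.update_of_ne, OfNat.one_ne_ofNat,
    not_false_eq_true] at hW
  have hK' : st I.n β 0 0 0 = st I.n α 0 0 0 := st_congr hJ
  refine ⟨(hW 0 0 0 (by omega)).trans hJ, ?_, fun u' hu' v' hv' hl => ?_⟩
  · have := pairOk_pairS (ρ := Function.update (Function.update ρ 1 u) 2 v) (hK' ▸ hK)
    simpa [hK'] using this
  · unfold Segs.Lex at hl
    refine (hP u' hu' v' hv' hl).congr (fun u₁ v₁ h1 => st_congr (hW _ _ _ ?_))
      (st_congr (hW _ _ _ ?_)) fun o ho t => ?_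
    · unfold Segs.Lex at h1
      omega
    · omega
    · unfold hgt
      congr 1
      refine filter_congr fun h _ => ?_
      rw [st_congr (hW _ _ _ ?_)]
      rintro (h1 | ⟨-, -, h1⟩)
      · omega
      -- The level rows of different pairs have different addresses.
      · have := pr_inj h1
        omega

/-! ### Improvements of the clique -/

/-- The union of the chains. -/
def chains (n : ℕ) (α : Arrays) : Finset ℕ :=
  (range n).biUnion fun u => (range n).biUnion fun v => st n α 2 u v

/-- The sets in the arrays are cliques. -/
structure AllCliques (I : Inp) (α : Arrays) : Prop where
  clique : I.segs.Clique (st I.n α 0 0 0)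
  skew : ∀ u < I.n, ∀ v < I.n, I.segs.Clique (st I.n α 1 u v)
  chains : I.segs.Clique (chains I.n α)

/-- Selected transversals of a skew pair that meet would share a point on the pair. A chain is a
clique because comparable segments are disjoint, and chains of different pairs are disjoint because
the later one is free. -/
theorem allCliques_of_pairOk {K : Finset ℕ} {g : ℕ → ℕ → ℕ → ℕ → ℕ} (hK : I.segs.Clique K)
    (hα : st I.n α 0 0 0 = K) (h : ∀ u < I.n, ∀ v < I.n,
      I.segs.PairOk I.n K (st I.n α 2) (st I.n α 1) g u v) : AllCliques I α := by
  refine ⟨hα ▸ hK, fun u hu v hv y hy y' hy' hne hm => ?_, fun x hx x' hx' hne => ?_⟩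
  · have h' := h u hu v hv
    have h1 := h'.skew_of_mem y hy
    have h2 := h'.skew_of_mem y' hy'
    have h3 := h'.not_shared y hy y' hy' hne
    rcases h1.shared hK h2 hm with h4 | h4
    · exact h3.1 h4
    · exact h3.2 h4
  · simp only [SegAlg.chains, mem_biUnion, mem_range] at hx hx'
    obtain ⟨u, hu, v, hv, hx⟩ := hx
    obtain ⟨u', hu', v', hv', hx'⟩ := hx'
    have h1 := (h u hu v hv).free_of_mem x hx
    have h2 := (h u' hu' v' hv').free_of_mem x' hx'
    by_cases hl : Segs.Lex u' v' u v
    · exact h1.2 u' h2.1.2.2.1.1.1 v' h2.1.2.2.1.1.2.1 hl x' hx'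
    by_cases hl' : Segs.Lex u v u' v'
    · exact fun hm => h2.2 u h1.1.2.2.1.1.1 v h1.1.2.2.1.1.2.1 hl' x hx hm.symm
    obtain ⟨rfl, rfl⟩ : u = u' ∧ v = v' := by
      unfold Segs.Lex at hl hl'
      omega
    exact (h u hu v hv).disjoint_of_mem x hx x' hx' hne

/-- The statement keeps the clique or replaces it by a larger one. -/
def Improves (I : Inp) (S : Stmt) (ρ : ℕ → ℕ) : Prop := ∀ α, AllCliques I α →
  AllCliques I (S.run I ρ α) ∧
    (S.run I ρ α = α ∨ #(st I.n α 0 0 0) < #(st I.n (S.run I ρ α) 0 0 0))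

theorem Improves.seq {S T : Stmt} (hS : Improves I S ρ) (hT : Improves I T ρ) :
    Improves I (.seq S T) ρ := by
  intro α h
  obtain ⟨h1, h2⟩ := hS α h
  obtain ⟨h3, h4⟩ := hT _ h1
  refine ⟨h3, ?_⟩
  simp only [Stmt.run]
  rcases h4 with h4 | h4
  · rw [h4]; exact h2
  · rcases h2 with h2 | h2
    · rw [h2] at h4 ⊢; exact Or.inr h4
    · exact Or.inr (h2.trans h4)

/-- The clique never shrinks, and a step that changes anything enlarges it. So if the final state is
the initial one, no step has changed anything. -/
theorem Improves.of_seq_eq {S T : Stmt} (hS : Improves I S ρ) (hT : Improves I T ρ)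
    (h : AllCliques I α) (he : (Stmt.seq S T).run I ρ α = α) :
    S.run I ρ α = α ∧ T.run I ρ α = α := by
  obtain ⟨h1, h2⟩ := hS α h
  obtain ⟨h3, h4⟩ := hT _ h1
  simp only [Stmt.run] at he
  rw [he] at h4
  have h5 : S.run I ρ α = α := by
    rcases h2 with h2 | h2
    · exact h2
    · rcases h4 with h4 | h4
      · exact h4.symm
      · omega
  rw [h5] at he
  exact ⟨h5, he⟩

theorem Improves.rep {S : Stmt} {x : ℕ} {b : Term} {m : ℕ} (hb : ∀ α, b.eval I α ρ = m)
    (hS : ∀ i < m, Improves I S (Function.update ρ x i)) : Improves I (.rep x b S) ρ := by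
  intro α h
  rw [Stmt.run, hb]
  refine iter_induction (fun _ (β : Arrays) => AllCliques I β ∧
    (β = α ∨ #(st I.n α 0 0 0) < #(st I.n β 0 0 0))) ⟨h, Or.inl rfl⟩ _ ?_
  rintro i β hi ⟨h1, h2⟩
  obtain ⟨h3, h4⟩ := hS i hi β h1
  refine ⟨h3, ?_⟩
  rcases h4 with h4 | h4
  · rw [h4]; exact h2
  · rcases h2 with rfl | h2
    · exact Or.inr h4
    · exact Or.inr (h2.trans h4)

theorem Improves.of_rep_eq {S : Stmt} {x : ℕ} {b : Term} {m : ℕ} (hb : ∀ α, b.eval I α ρ = m)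
    (hS : ∀ i < m, Improves I S (Function.update ρ x i)) (h : AllCliques I α)
    (he : (Stmt.rep x b S).run I ρ α = α) {i : ℕ} (hi : i < m) :
    S.run I (Function.update ρ x i) α = α := by
  rw [Stmt.run, hb] at he
  clear hb
  induction m with
  | zero => omega
  | succ m ih =>
    have h1 := Improves.rep (b := .const m) (m := m) (fun _ => rfl) (fun i hi => hS i (by omega)) α h
    simp only [Stmt.run, Term.eval] at h1
    have he' : S.run I (Function.update ρ x m)
        (iter (fun i => S.run I (Function.update ρ x i)) m α) = α := he
    obtain ⟨h2, h3⟩ := h1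
    obtain ⟨h4, h5⟩ := hS m (by omega) _ h2
    rw [he'] at h5
    have h6 : iter (fun i => S.run I (Function.update ρ x i)) m α = α := by
      rcases h3 with h3 | h3
      · exact h3
      · rcases h5 with h5 | h5
        · exact h5.symm
        · omega
    rcases Nat.lt_succ_iff_lt_or_eq.1 hi with hi | rfl
    · exact ih (fun i hi => hS i (by omega)) h6 hi
    · rwa [h6] at he'

/-- Replace the clique by the set given by `φ` if `ψ` holds and this set is larger. -/
def imprS (ψ φ : Term) : Stmt := .cond (andT ψ (ltT
  (countT 6 .size (inT 0 (.const 0) (.const 0) 6)) (countT 6 .size φ)))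
  (setS 0 (.const 0) (.const 0) 6 φ)

theorem writes_imprS (ψ φ : Term) : (imprS ψ φ).Writes I (fun A _ _ => A = 0) ρ := by
  simp [imprS, Stmt.Writes, setS]

open Classical in
theorem holds_improvement {ψ φ : Term} : Holds I α ρ (andT ψ (ltT
    (countT 6 .size (inT 0 (.const 0) (.const 0) 6)) (countT 6 .size φ))) ↔ Holds I α ρ ψ ∧
      #(st I.n α 0 0 0) < #{k ∈ range I.n | Holds I α (Function.update ρ 6 k) φ} := by
  rw [holds_and, holds_lt, eval_card (i := 0) (j := 0) (by simp [Term.eval]) (by simp [Term.eval]),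
    eval_count]
  rfl

open Classical in
theorem st_imprS {ψ φ : Term} : st I.n ((imprS ψ φ).run I ρ α) 0 0 0 =
    if Holds I α ρ ψ ∧ #(st I.n α 0 0 0) < #{k ∈ range I.n | Holds I α (Function.update ρ 6 k) φ}
    then {k ∈ range I.n | Holds I α (Function.update ρ 6 k) φ} else st I.n α 0 0 0 := by
  have hc := holds_improvement (I := I) (α := α) (ρ := ρ) (ψ := ψ) (φ := φ)
  by_cases h : Holds I α ρ ψ ∧
      #(st I.n α 0 0 0) < #{k ∈ range I.n | Holds I α (Function.update ρ 6 k) φ}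
  · rw [imprS, run_cond, if_pos (hc.2 h), if_pos h]
    exact st_setS rfl rfl
  · rw [imprS, run_cond, if_neg (fun h' => h (hc.1 h')), if_neg h]

-- Only array 0 is overwritten. The selections, although made for the old clique, remain cliques and
-- can be used for further improvements.
open Classical in
theorem improves_imprS {ψ φ : Term} (h : ∀ α, AllCliques I α → Holds I α ρ ψ →
    I.segs.Clique {k ∈ range I.n | Holds I α (Function.update ρ 6 k) φ}) :
    Improves I (imprS ψ φ) ρ := by
  intro α hα
  have hW := fun A i j => (writes_imprS (I := I) (ρ := ρ) ψ φ).run α (A := A) (i := i) (j := j)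
  have h0 := st_imprS (I := I) (α := α) (ρ := ρ) (ψ := ψ) (φ := φ)
  split_ifs at h0 with h1
  · refine ⟨⟨?_, fun u hu v hv => ?_, ?_⟩, Or.inr ?_⟩
    · rw [h0]; exact h α hα h1.1
    · rw [st_congr (hW _ _ _ (by omega))]; exact hα.skew u hu v hv
    · have : chains I.n ((imprS ψ φ).run I ρ α) = chains I.n α := by
        simp only [chains]
        refine biUnion_congr rfl fun u _ => biUnion_congr rfl fun v _ => ?_
        exact st_congr (hW _ _ _ (by omega))
      rw [this]; exact hα.chains
    · rw [h0]; exact h1.2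
  · have : (imprS ψ φ).run I ρ α = α := by
      rw [imprS, run_cond, if_neg fun h' => h1 (holds_improvement.1 h')]
    rw [this]
    exact ⟨hα, Or.inl rfl⟩

open Classical in
theorem card_le_of_imprS_eq {ψ φ : Term} (h : (imprS ψ φ).run I ρ α = α) (hψ : Holds I α ρ ψ) :
    #{k ∈ range I.n | Holds I α (Function.update ρ 6 k) φ} ≤ #(st I.n α 0 0 0) := by
  have h0 := st_imprS (I := I) (α := α) (ρ := ρ) (ψ := ψ) (φ := φ)
  rw [h] at h0
  by_contra h1
  rw [if_pos ⟨hψ, not_le.1 h1⟩] at h0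
  rw [← h0] at h1
  exact h1 le_rfl

def skewS : Stmt := imprS (.const 1) (inT 1 (.var 1) (.var 2) 6)

def unionS : Stmt :=
  imprS (.const 1) (exT 20 .size (exT 21 .size (inT 2 (.var 20) (.var 21) 6)))

/-- Replace one segment by two. -/
def swapS : Stmt := imprS
  (andT (orT (eqT (.var 2) (.var 3)) (notT (meetT 2 3)))
    (notT (exK 20 (andT (neT 20 1) (orT (meetT 2 20) (meetT 3 20))))))
  (orT (andT (kT 6) (neT 6 1)) (orT (eqT (.var 6) (.var 2)) (eqT (.var 6) (.var 3))))

theorem holds_one : Holds I α ρ (.const 1) := one_ne_zero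

open Classical in
theorem skew_set : {k ∈ range I.n | Holds I α (Function.update ρ 6 k) (inT 1 (.var 1) (.var 2) 6)} =
    st I.n α 1 (ρ 1) (ρ 2) := by
  ext k
  simp only [mem_filter, mem_range, holds_in, Term.eval, Function.update_self, ne_eq,
    Nat.reduceEqDiff, not_false_eq_true, Function.update_of_ne, OfNat.one_ne_ofNat]
  exact ⟨fun h => h.2, fun h => ⟨(mem_st.1 h).1, h⟩⟩

open Classical in
theorem union_set : {k ∈ range I.n | Holds I α (Function.update ρ 6 k)
    (exT 20 .size (exT 21 .size (inT 2 (.var 20) (.var 21) 6)))} = chains I.n α := by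
  ext k
  simp only [mem_filter, mem_range, holds_in, holds_ex, Term.eval, Function.update_self, ne_eq,
    Nat.reduceEqDiff, not_false_eq_true, Function.update_of_ne, chains, mem_biUnion]
  exact ⟨fun h => h.2, fun h => ⟨by obtain ⟨_, _, _, _, h⟩ := h; exact (mem_st.1 h).1, h⟩⟩

/-- The set obtained from a clique by exchanging `u` for `t` and `t'`. -/
def swapSet (K : Finset ℕ) (u t t' : ℕ) : Finset ℕ := insert t (insert t' (K.erase u))

open Classical in
theorem swap_set (h2 : ρ 2 < I.n) (h3 : ρ 3 < I.n) :
    {k ∈ range I.n | Holds I α (Function.update ρ 6 k)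
      (orT (andT (kT 6) (neT 6 1)) (orT (eqT (.var 6) (.var 2)) (eqT (.var 6) (.var 3))))} =
    swapSet (st I.n α 0 0 0) (ρ 1) (ρ 2) (ρ 3) := by
  ext k
  simp only [mem_filter, mem_range, holds_k, holds_or, holds_and, neT, holds_not, holds_eq,
    Term.eval, Function.update_self, ne_eq, Nat.reduceEqDiff, not_false_eq_true,
    Function.update_of_ne, OfNat.one_ne_ofNat, swapSet, mem_insert, mem_erase]
  constructor
  · rintro ⟨-, h | h | h⟩
    · exact Or.inr (Or.inr ⟨h.2, h.1⟩)
    · exact Or.inl h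
    · exact Or.inr (Or.inl h)
  · rintro (h | h | h)
    · exact ⟨h ▸ h2, Or.inr (Or.inl h)⟩
    · exact ⟨h ▸ h3, Or.inr (Or.inr h)⟩
    · exact ⟨(mem_st.1 h.2).1, Or.inl ⟨h.2, h.1⟩⟩

theorem holds_swap : Holds I α ρ (andT (orT (eqT (.var 2) (.var 3)) (notT (meetT 2 3)))
      (notT (exK 20 (andT (neT 20 1) (orT (meetT 2 20) (meetT 3 20)))))) ↔
    (ρ 2 = ρ 3 ∨ ¬ I.segs.Meets (ρ 2) (ρ 3)) ∧ ∀ w ∈ st I.n α 0 0 0, w ≠ ρ 1 →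
      ¬ I.segs.Meets (ρ 2) w ∧ ¬ I.segs.Meets (ρ 3) w := by
  simp only [holds_and, holds_or, holds_not, holds_eq, holds_exK, neT,
    holds_meet (by norm_num : 2 < 40) (by norm_num : 3 < 40),
    holds_meet (by norm_num : 2 < 40) (by norm_num : 20 < 40),
    holds_meet (by norm_num : 3 < 40) (by norm_num : 20 < 40),
    Term.eval, Function.update_self, ne_eq, Nat.reduceEqDiff, not_false_eq_true,
    Function.update_of_ne, OfNat.one_ne_ofNat]
  refine and_congr_right fun _ => ?_
  constructor
  · intro h w hw hne
    exact not_or.1 fun h' => h ⟨w, hw, hne, h'⟩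
  · rintro h ⟨w, hw, hne, h'⟩
    exact not_or.2 (h w hw hne) h'

theorem clique_swapSet {S : Segs} {K : Finset ℕ} (hK : S.Clique K) {u t t' : ℕ}
    (h : t = t' ∨ ¬ S.Meets t t')
    (h' : ∀ w ∈ K, w ≠ u → ¬ S.Meets t w ∧ ¬ S.Meets t' w) : S.Clique (swapSet K u t t') := by
  intro x hx y hy hne
  simp only [swapSet, mem_insert, mem_erase] at hx hy
  rcases hx with rfl | rfl | hx <;> rcases hy with rfl | rfl | hy
  · exact absurd rfl hne
  · exact h.resolve_left hne
  · exact (h' y hy.2 hy.1).1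
  · exact fun hm => h.resolve_left hne.symm hm.symm
  · exact absurd rfl hne
  · exact (h' y hy.2 hy.1).2
  · exact fun hm => (h' x hx.2 hx.1).1 hm.symm
  · exact fun hm => (h' x hx.2 hx.1).2 hm.symm
  · exact hK x hx.2 y hy.2 hne

theorem improves_unionS : Improves I unionS ρ := by
  classical
  refine improves_imprS fun α hα _ => ?_
  rw [union_set]
  exact hα.chains

theorem improves_skewS (h1 : ρ 1 < I.n) (h2 : ρ 2 < I.n) : Improves I skewS ρ := by
  classical
  refine improves_imprS fun α hα _ => ?_
  rw [skew_set]
  exact hα.skew _ h1 _ h2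

theorem improves_swapS (h2 : ρ 2 < I.n) (h3 : ρ 3 < I.n) : Improves I swapS ρ := by
  classical
  refine improves_imprS fun α hα h => ?_
  rw [holds_swap] at h
  rw [swap_set h2 h3]
  exact clique_swapSet hα.clique h.1 h.2

/-- Try all improvements. -/
def improveS : Stmt := .seq (.rep 1 .size (.rep 2 .size skewS)) <|
  .seq unionS (.rep 1 (.add .size (.const 1)) (.rep 2 .size (.rep 3 .size swapS)))

theorem improves_skew : Improves I (.rep 1 .size (.rep 2 .size skewS)) ρ :=
  .rep (m := I.n) (fun _ => rfl) fun u hu => .rep (m := I.n) (fun _ => rfl) fun v hv =>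
    improves_skewS (by simpa using hu) (by simpa using hv)

theorem improves_swap :
    Improves I (.rep 1 (.add .size (.const 1)) (.rep 2 .size (.rep 3 .size swapS))) ρ :=
  .rep (m := I.n + 1) (fun _ => rfl) fun u _ => .rep (m := I.n) (fun _ => rfl) fun t ht =>
    .rep (m := I.n) (fun _ => rfl) fun t' ht' => improves_swapS (by simpa using ht) (by simpa using ht')

theorem improves_improveS : Improves I improveS ρ :=
  improves_skew.seq (improves_unionS.seq improves_swap)

theorem writes_improveS : improveS.Writes I (fun A _ _ => A = 0) ρ :=
  ⟨fun _ _ => writes_imprS _ _, writes_imprS _ _, fun _ _ _ => writes_imprS _ _⟩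

/-- The clique cannot be improved. -/
theorem of_improveS_eq (h : AllCliques I α) (he : improveS.run I ρ α = α) :
    (∀ u < I.n, ∀ v < I.n, #(st I.n α 1 u v) ≤ #(st I.n α 0 0 0)) ∧
    #(chains I.n α) ≤ #(st I.n α 0 0 0) ∧
    ∀ u ≤ I.n, ∀ t < I.n, ∀ t' < I.n, (t = t' ∨ ¬ I.segs.Meets t t') →
      (∀ w ∈ st I.n α 0 0 0, w ≠ u → ¬ I.segs.Meets t w ∧ ¬ I.segs.Meets t' w) →
      #(swapSet (st I.n α 0 0 0) u t t') ≤ #(st I.n α 0 0 0) := by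
  classical
  obtain ⟨h1, h2⟩ := improves_skew.of_seq_eq (improves_unionS.seq improves_swap) h he
  obtain ⟨h2, h3⟩ := improves_unionS.of_seq_eq improves_swap h h2
  refine ⟨fun u hu v hv => ?_, ?_, fun u hu t ht t' ht' h4 h5 => ?_⟩
  · have e1 := Improves.of_rep_eq (m := I.n) (fun _ => rfl) (fun u hu => .rep (m := I.n)
      (fun _ => rfl) fun v hv => improves_skewS (by simpa using hu) (by simpa using hv)) h h1 hu
    have e2 := Improves.of_rep_eq (m := I.n) (fun _ => rfl)
      (fun v hv => improves_skewS (by simpa using hu) (by simpa using hv)) h e1 hv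
    have := card_le_of_imprS_eq e2 holds_one
    rw [skew_set] at this
    simpa using this
  · have := card_le_of_imprS_eq h2 holds_one
    rwa [union_set] at this
  · have e1 := Improves.of_rep_eq (m := I.n + 1) (fun _ => rfl) (fun u _ => .rep (m := I.n)
      (fun _ => rfl) fun t ht => .rep (m := I.n) (fun _ => rfl) fun t' ht' =>
      improves_swapS (by simpa using ht) (by simpa using ht')) h h3 (Nat.lt_succ_of_le hu)
    have e2 := Improves.of_rep_eq (m := I.n) (fun _ => rfl) (fun t ht => .rep (m := I.n)
      (fun _ => rfl) fun t' ht' => improves_swapS (by simpa using ht) (by simpa using ht')) h e1 ht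
    have e3 := Improves.of_rep_eq (m := I.n) (fun _ => rfl)
      (fun t' ht' => improves_swapS (by simpa using ht) (by simpa using ht')) h e2 ht'
    have := card_le_of_imprS_eq e3 (holds_swap.2 (by simpa using ⟨h4, h5⟩))
    rw [swap_set (by simpa using ht) (by simpa using ht')] at this
    simpa using this

/-- A clique that cannot be improved. -/
def GoodState (I : Inp) (α : Arrays) : Prop :=
  I.segs.Good I.n (st I.n α 0 0 0) (st I.n α 2) (st I.n α 1) (hgt I.n α)

theorem good_of_improveS_eq (hK : I.segs.Clique (st I.n α 0 0 0)) (h : ∀ u < I.n, ∀ v < I.n,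
    I.segs.PairOk I.n (st I.n α 0 0 0) (st I.n α 2) (st I.n α 1) (hgt I.n α) u v)
    (he : improveS.run I ρ α = α) : GoodState I α := by
  obtain ⟨h1, h2, h3⟩ := of_improveS_eq (allCliques_of_pairOk hK rfl h) he
  have hn : ∀ u ∈ st I.n α 0 0 0, u < I.n := fun u hu => (mem_st.1 hu).1
  have hp := fun u hu v hv => h u (hn u hu) v (hn v hv)
  refine ⟨fun u hu => mem_range.2 (hn u hu), hK, fun u hu v hv => (hp u hu v hv).skew_of_mem,
    fun u hu v hv => (hp u hu v hv).not_shared, fun u hu v hv => (hp u hu v hv).exists_shared,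
    fun u hu v hv => (hp u hu v hv).free_of_mem, fun u hu v hv => (hp u hu v hv).height_lt,
    fun u hu v hv => (hp u hu v hv).height_mono, fun u hu v hv => (hp u hu v hv).disjoint_of_mem,
    fun u hu v hv => h1 u (hn u hu) v (hn v hv), ?_, fun t ht => ?_, fun u hu t ht t' ht' hw => ?_⟩
  · refine (card_le_card fun x hx => ?_).trans h2
    simp only [mem_biUnion] at hx
    obtain ⟨u, hu, v, hv, hx⟩ := hx
    exact mem_biUnion.2 ⟨u, mem_range.2 (hn u hu), mem_biUnion.2 ⟨v, mem_range.2 (hn v hv), hx⟩⟩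
  · by_contra h4
    push Not at h4
    -- The index `n` is not in the clique, so this exchange removes nothing and just adds `t`. This
    -- is why the loop over `u` has `n + 1` passes.
    have h5 := h3 I.n le_rfl t ht t ht (Or.inl rfl) fun w hw _ => ⟨h4 w hw, h4 w hw⟩
    have h6 : t ∉ st I.n α 0 0 0 := fun h7 => h4 t h7 (Segs.Meets.refl _ t)
    rw [swapSet, insert_eq_of_mem (mem_insert_self _ _),
      erase_eq_of_notMem fun h7 => lt_irrefl _ (hn _ h7), card_insert_of_notMem h6] at h5
    omega
  · by_contra hm
    have h5 := h3 u (hn u hu).le t ht t' ht' (Or.inr hm) hw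
    have h6 : t' ∉ (st I.n α 0 0 0).erase u := fun h7 =>
      (hw t' (mem_erase.1 h7).2 (mem_erase.1 h7).1).2 (Segs.Meets.refl _ t')
    have h7 : t ∉ insert t' ((st I.n α 0 0 0).erase u) := by
      rw [mem_insert]
      rintro (rfl | h7)
      · exact hm (Segs.Meets.refl _ t)
      · exact (hw t (mem_erase.1 h7).2 (mem_erase.1 h7).1).1 (Segs.Meets.refl _ t)
    rw [swapSet, card_insert_of_notMem h7, card_insert_of_notMem h6, card_erase_of_mem hu] at h5
    have := card_pos.2 ⟨u, hu⟩
    omega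

/-! ### The algorithm -/

/-- One round: keep a copy of the clique, compute the selections, try to improve. -/
def roundS : Stmt := .seq (setS 5 (.const 0) (.const 0) 6 (inT 0 (.const 0) (.const 0) 6)) <|
  .seq computeS improveS

/-- Rounds are executed until there is no improvement. -/
def mainS : Stmt := .rep 8 (.add .size (.const 1)) (.cond (orT (eqT (.var 8) (.const 0))
  (ltT (countT 6 .size (inT 5 (.const 0) (.const 0) 6))
    (countT 6 .size (inT 0 (.const 0) (.const 0) 6)))) roundS)

/-- Array 5 keeps the clique for which the selections were made. If the clique has not grown, it is
still this one, so the selections fit it and witness that it cannot be improved. -/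
theorem roundS_spec (hK : I.segs.Clique (st I.n α 0 0 0)) :
    I.segs.Clique (st I.n (roundS.run I ρ α) 0 0 0) ∧
    ((#(st I.n (roundS.run I ρ α) 0 0 0) = #(st I.n (roundS.run I ρ α) 5 0 0) ∧
      GoodState I (roundS.run I ρ α)) ∨
     (#(st I.n (roundS.run I ρ α) 5 0 0) < #(st I.n (roundS.run I ρ α) 0 0 0) ∧
      #(st I.n α 0 0 0) < #(st I.n (roundS.run I ρ α) 0 0 0))) := by
  classical
  set α₁ := (setS 5 (.const 0) (.const 0) 6 (inT 0 (.const 0) (.const 0) 6)).run I ρ α with hα₁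
  set α₂ := computeS.run I ρ α₁ with hα₂
  set β := roundS.run I ρ α with hβ
  have hβ' : β = improveS.run I ρ α₂ := rfl
  have e₁ : st I.n α₁ 0 0 0 = st I.n α 0 0 0 :=
    st_congr (Stmt.Writes.run (W := fun A _ _ => A = 5) (by simp [setS, Stmt.Writes]) _ (by simp))
  have e₁' : st I.n α₁ 5 0 0 = st I.n α 0 0 0 := by
    rw [hα₁, st_setS (i := 0) (j := 0) rfl rfl]
    ext k
    simp only [mem_filter, mem_range, holds_in, Term.eval, Function.update_self]
    exact ⟨fun h => h.2, fun h => ⟨(mem_st.1 h).1, h⟩⟩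
  have e₂ : st I.n α₂ 0 0 0 = st I.n α 0 0 0 :=
    (st_congr (writes_computeS.run _ (by simp))).trans e₁
  have e₂' : st I.n α₂ 5 0 0 = st I.n α 0 0 0 :=
    (st_congr (writes_computeS.run _ (by simp))).trans e₁'
  have e₃ : st I.n β 5 0 0 = st I.n α 0 0 0 :=
    (st_congr (writes_improveS.run _ (by simp))).trans e₂'
  have hp : ∀ u < I.n, ∀ v < I.n,
      I.segs.PairOk I.n (st I.n α₂ 0 0 0) (st I.n α₂ 2) (st I.n α₂ 1) (hgt I.n α₂) u v := by
    intro u hu v hv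
    rw [e₂, ← e₁]
    exact pairOk_computeS (e₁ ▸ hK) hu hv
  have hK₂ : I.segs.Clique (st I.n α₂ 0 0 0) := e₂ ▸ hK
  obtain ⟨h1, h2⟩ := improves_improveS (ρ := ρ) α₂ (allCliques_of_pairOk hK₂ rfl hp)
  rw [← hβ'] at h1 h2
  refine ⟨h1.clique, ?_⟩
  rcases h2 with h2 | h2
  · left
    rw [e₃, h2, e₂]
    exact ⟨rfl, good_of_improveS_eq hK₂ hp (hβ'.symm.trans h2)⟩
  · right
    rw [e₂] at h2
    exact ⟨e₃ ▸ h2, h2⟩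

/-- As long as the final state is not reached, each round adds at least one member. After `n + 1`
rounds the clique would have more than `n` members. -/
theorem good_mainS : GoodState I (mainS.run I ρ fun _ _ _ _ => 0) := by
  classical
  rw [mainS, Stmt.run]
  have key := iter_induction (f := fun i => Stmt.run I (.cond (orT (eqT (.var 8) (.const 0))
    (ltT (countT 6 .size (inT 5 (.const 0) (.const 0) 6))
      (countT 6 .size (inT 0 (.const 0) (.const 0) 6)))) roundS) (Function.update ρ 8 i))
    (a := fun _ _ _ _ => 0) (fun s (β : Arrays) => I.segs.Clique (st I.n β 0 0 0) ∧
      (s = 0 ∨ (#(st I.n β 0 0 0) = #(st I.n β 5 0 0) ∧ GoodState I β) ∨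
        (#(st I.n β 5 0 0) < #(st I.n β 0 0 0) ∧ s ≤ #(st I.n β 0 0 0)))) ?_ (I.n + 1) ?_
  · obtain ⟨-, h | h | h⟩ := key
    · omega
    · exact h.2
    · have h1 := h.2.trans (card_filter_le _ _)
      rw [card_range] at h1
      omega
  · exact ⟨fun u hu => absurd (mem_st.1 hu).2 (by simp), Or.inl rfl⟩
  · rintro s β - ⟨h1, h2⟩
    simp only [run_cond, holds_or, holds_eq, holds_lt]
    rw [eval_card (i := 0) (j := 0) (by simp [Term.eval]) (by simp [Term.eval]),
      eval_card (i := 0) (j := 0) (by simp [Term.eval]) (by simp [Term.eval])]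
    simp only [Term.eval, Function.update_self]
    split_ifs with hc
    · obtain ⟨h3, h4⟩ := roundS_spec (ρ := Function.update ρ 8 s) h1
      refine ⟨h3, Or.inr (h4.imp_right fun h4 => ⟨h4.1, ?_⟩)⟩
      rcases h2 with h2 | h2 | h2 <;> omega
    · refine ⟨h1, Or.inr ?_⟩
      rw [not_or] at hc
      rcases h2 with h2 | h2 | h2
      · exact absurd h2 hc.1
      · exact Or.inl h2
      · exact absurd h2.1 hc.2

end SegAlg

namespace SegAlg

open RealRAM

/-! ### Segments of a Euclidean space -/

section Input

variable {n d : ℕ} (a b : Fin n → EuclideanSpace ℝ (Fin d))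

theorem inp_a (i : Fin n) (r : Fin d) : (inp a b).segs.a i r = a i r := by
  have hd : 0 < d := r.pos
  have h1 : ((i : ℕ) * d + r) / d = i := by
    rw [mul_comm, Nat.mul_add_div hd, Nat.div_eq_of_lt r.2, add_zero]
  have h2 : ((i : ℕ) * d + r) % d = r := by
    rw [mul_comm, Nat.mul_add_mod, Nat.mod_eq_of_lt r.2]
  simp [Inp.segs, Inp.a, inp, inputStore, h1, h2]

theorem inp_b (i : Fin n) (r : Fin d) : (inp a b).segs.b i r = b i r := by
  have hd : 0 < d := r.pos
  have h1 : ((i : ℕ) * d + r) / d = i := by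
    rw [mul_comm, Nat.mul_add_div hd, Nat.div_eq_of_lt r.2, add_zero]
  have h2 : ((i : ℕ) * d + r) % d = r := by
    rw [mul_comm, Nat.mul_add_mod, Nat.mod_eq_of_lt r.2]
  simp [Inp.segs, Inp.b, inp, inputStore, h1, h2]

theorem mem_segment_iff {x y z : EuclideanSpace ℝ (Fin d)} : z ∈ segment ℝ x y ↔
    ∃ l : ℝ, 0 ≤ l ∧ l ≤ 1 ∧ ∀ r, z r = x r + l * (y r - x r) := by
  rw [segment_eq_image', Set.mem_image]
  constructor
  · rintro ⟨l, ⟨h0, h1⟩, rfl⟩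
    exact ⟨l, h0, h1, fun r => by simp⟩
  · rintro ⟨l, h0, h1, h⟩
    refine ⟨l, ⟨h0, h1⟩, ?_⟩
    ext r
    simp [h]

/-- Points are sequences here, and those on a segment vanish from coordinate `d` on. -/
theorem onSeg_inp {P : ℕ → ℝ} (i : Fin n) : (inp a b).segs.OnSeg P i ↔
    (∀ r, d ≤ r → P r = 0) ∧
      (WithLp.toLp 2 fun r : Fin d => P r) ∈ segment ℝ (a i) (b i) := by
  rw [mem_segment_iff]
  have hz : ∀ {r l}, d ≤ r → (inp a b).segs.pt i l r = 0 := by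
    intro r l hr
    rw [Segs.pt, Inp.a_eq_zero (I := inp a b) hr, Inp.dir_eq_zero (I := inp a b) hr]
    ring
  have hp : ∀ {l} (r : Fin d), (inp a b).segs.pt i l r = a i r + l * (b i r - a i r) := by
    intro l r
    rw [Segs.pt, Segs.dir, inp_a, inp_b]
  constructor
  · rintro ⟨l, h0, h1, h⟩
    exact ⟨fun r hr => (h r).trans (hz hr), l, h0, h1, fun r => (h r).trans (hp r)⟩
  · rintro ⟨h', l, h0, h1, h⟩
    refine ⟨l, h0, h1, fun r => ?_⟩
    rcases Nat.lt_or_ge r d with hr | hr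
    · exact (h ⟨r, hr⟩).trans (hp ⟨r, hr⟩).symm
    · rw [h' r hr, hz hr]

theorem adj_iff (i j : Fin n) :
    (disjointnessGraph a b).Adj i j ↔ ¬ (inp a b).segs.Meets i j := by
  change Disjoint _ _ ↔ _
  rw [Set.disjoint_left, Segs.Meets]
  push Not
  constructor
  · intro h P h1 h2
    exact h ((onSeg_inp a b i).1 h1).2 ((onSeg_inp a b j).1 h2).2
  · intro h x h1 h2
    have hx : (WithLp.toLp 2 fun r : Fin d => if hr : (r : ℕ) < d then x ⟨r, hr⟩ else 0) = x :=
      PiLp.ext fun r => dif_pos r.2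
    refine h (fun r => if hr : r < d then x ⟨r, hr⟩ else 0) ?_ ?_ <;> rw [onSeg_inp] <;>
    refine ⟨fun r hr => dif_neg (by omega), ?_⟩
    · rwa [hx]
    · rwa [hx]

end Input

theorem eval_mono (p : Polynomial ℕ) {m m' : ℕ} (h : m ≤ m') : p.eval m ≤ p.eval m' := by
  rw [Polynomial.eval_eq_sum_range, Polynomial.eval_eq_sum_range]
  exact sum_le_sum fun i _ => Nat.mul_le_mul_left _ (Nat.pow_le_pow_left h i)

/-- The program that computes a clique and a coloring. -/
theorem exists_coloring_program : ∃ (P : Program) (p : Polynomial ℕ),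
    ∀ (d n : ℕ) (a b : Fin n → EuclideanSpace ℝ (Fin d)), ∃ τ,
      (∀ w, RunsWithin w P (inputStore a b) τ (p.eval (n + d))) ∧
      (disjointnessGraph a b).IsClique (outputSet n τ : Set (Fin n)) ∧
      (∀ i j, (disjointnessGraph a b).Adj i j → outputColor n τ i ≠ outputColor n τ j) ∧
      #(univ.image (outputColor n τ)) ≤ #(outputSet n τ) ^ 4 + #(outputSet n τ) ^ 3 := by
  obtain ⟨P, p, h⟩ := exists_program mainS (.arr 0 (.const 0) (.const 0) (.var 0)) outputT
  refine ⟨P, p, fun d n a b => ?_⟩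
  obtain ⟨τ, h1, h2, h3⟩ := h d n a b _ rfl
  set α := mainS.run (inp a b) (fun _ => 0) (fun _ _ _ _ => 0) with hα
  have hG : GoodState (inp a b) α := good_mainS
  have hn : (inp a b).n = n := rfl
  set K := st (inp a b).n α 0 0 0 with hK
  have hcol : ∀ i : Fin n, (inp a b).segs.Color K (st (inp a b).n α 2) (st (inp a b).n α 1)
      (hgt (inp a b).n α) i (outputColor n τ i) := by
    intro i
    rw [outputColor, h3 i i.2]
    have := color_output (I := inp a b) (α := α) (ρ := Function.update (fun _ => 0) 0 (i : ℕ)) rfl hG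
      (by rw [Function.update_self]; exact i.2)
    rwa [Function.update_self] at this
  have hmem : ∀ i : Fin n, i ∈ outputSet n τ ↔ (i : ℕ) ∈ K := by
    intro i
    rw [outputSet, mem_filter, h2 i i.2, hK, mem_st]
    simp only [Term.eval, Function.update_self, mem_univ, true_and]
    exact ⟨fun h => ⟨i.2, h⟩, fun h => h.2⟩
  have hcard : #(outputSet n τ) = #K := by
    rw [← card_map Fin.valEmbedding]
    congr 1
    ext k
    simp only [Finset.mem_map, Fin.valEmbedding_apply]
    constructor
    · rintro ⟨i, hi, rfl⟩
      exact (hmem i).1 hi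
    · intro hk
      exact ⟨⟨k, (mem_st.1 hk).1⟩, (hmem _).2 hk, rfl⟩
  refine ⟨τ, h1, ?_, fun i j hij he => ?_, ?_⟩
  · intro i hi j hj hne
    rw [adj_iff]
    exact hG.clique i ((hmem i).1 hi) j ((hmem j).1 hj) fun h => hne (Fin.ext h)
  · rw [adj_iff] at hij
    exact hij (hG.meets i.2 j.2 (hcol i) (he ▸ hcol j))
  · rw [hcard]
    refine hG.card_le fun c hc => ?_
    obtain ⟨i, -, rfl⟩ := mem_image.1 hc
    exact ⟨i, i.2, hcol i⟩

/-! ### Consequences -/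

section Consequences

variable {d : ℕ} {ι : Type*} [Fintype ι] (a b : ι → EuclideanSpace ℝ (Fin d))

/-- The output of the algorithm, transported along an enumeration of the segments. -/
theorem exists_coloring : ∃ (K : Finset ι) (c : ι → ℕ),
    (disjointnessGraph a b).IsClique (K : Set ι) ∧
    (∀ i j, (disjointnessGraph a b).Adj i j → c i ≠ c j) ∧
    #(univ.image c) ≤ #K ^ 4 + #K ^ 3 := by
  classical
  obtain ⟨P, p, h⟩ := exists_coloring_program
  have e := Fintype.equivFin ι
  obtain ⟨τ, -, h1, h2, h3⟩ := h d (Fintype.card ι) (a ∘ e.symm) (b ∘ e.symm)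
  have hadj : ∀ i j, (disjointnessGraph a b).Adj i j ↔
      (disjointnessGraph (a ∘ e.symm) (b ∘ e.symm)).Adj (e i) (e j) := by
    intro i j
    simp [disjointnessGraph]
  refine ⟨(outputSet _ τ).map e.symm.toEmbedding, fun i => outputColor _ τ (e i), ?_, ?_, ?_⟩
  · intro i hi j hj hne
    rw [mem_coe, mem_map_equiv, Equiv.symm_symm] at hi hj
    rw [hadj]
    exact h1 hi hj fun h => hne (e.injective h)
  · intro i j hij
    exact h2 _ _ ((hadj i j).1 hij)
  · rw [card_map]
    refine le_trans (card_le_card fun c hc => ?_) h3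
    obtain ⟨i, -, rfl⟩ := mem_image.1 hc
    exact mem_image_of_mem _ (mem_univ _)

theorem exists_coloring_cliqueNum : ∃ c : ι → ℕ,
    (∀ i j, (disjointnessGraph a b).Adj i j → c i ≠ c j) ∧
    #(univ.image c) ≤ (disjointnessGraph a b).cliqueNum ^ 4 +
      (disjointnessGraph a b).cliqueNum ^ 3 := by
  obtain ⟨K, c, h1, h2, h3⟩ := exists_coloring a b
  have h4 := h1.card_le_cliqueNum
  exact ⟨c, h2, h3.trans (add_le_add (Nat.pow_le_pow_left h4 4) (Nat.pow_le_pow_left h4 3))⟩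

theorem chromaticNumber_le : (disjointnessGraph a b).chromaticNumber ≤
    (((disjointnessGraph a b).cliqueNum ^ 4 + (disjointnessGraph a b).cliqueNum ^ 3 : ℕ) : ℕ∞) := by
  classical
  obtain ⟨c, h1, h2⟩ := exists_coloring_cliqueNum a b
  let C : (disjointnessGraph a b).Coloring (univ.image c) := SimpleGraph.Coloring.mk
    (fun i => ⟨c i, mem_image_of_mem _ (mem_univ _)⟩)
    fun {i j} hij he => h1 i j hij (congrArg Subtype.val he)
  have h3 := C.colorable.chromaticNumber_le
  rw [Fintype.card_coe] at h3
  exact h3.trans (by exact_mod_cast h2)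

/-- Color classes are independent sets, so the number of segments is at most the independence number
times the number of colors. -/
theorem card_le_ramsey : Fintype.card ι ≤
    max (disjointnessGraph a b).indepNum (disjointnessGraph a b).cliqueNum ^ 5 +
      max (disjointnessGraph a b).indepNum (disjointnessGraph a b).cliqueNum ^ 4 := by
  classical
  obtain ⟨c, h1, h2⟩ := exists_coloring_cliqueNum a b
  set G := disjointnessGraph a b
  set m := max G.indepNum G.cliqueNum
  have hα : G.indepNum ≤ m := le_max_left _ _
  have hω : G.cliqueNum ≤ m := le_max_right _ _
  have h3 : #(univ : Finset ι) ≤ G.indepNum * #(univ.image c) := by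
    refine card_le_mul_card_image _ _ fun k _ => ?_
    refine SimpleGraph.IsIndepSet.card_le_indepNum ?_
    intro i hi j hj _ hij
    simp only [coe_filter, mem_univ, true_and, Set.mem_ofPred_eq] at hi hj
    exact h1 i j hij (hi.trans hj.symm)
  calc Fintype.card ι ≤ G.indepNum * #(univ.image c) := h3
    _ ≤ m * (m ^ 4 + m ^ 3) := Nat.mul_le_mul hα (h2.trans
        (add_le_add (Nat.pow_le_pow_left hω 4) (Nat.pow_le_pow_left hω 3)))
    _ = _ := by ring

theorem rpow_le_of_le_pow {n m : ℕ} (h : n ≤ m ^ 5) : (n : ℝ) ^ (1 / 5 : ℝ) ≤ m := by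
  have h1 : (n : ℝ) ≤ (m : ℝ) ^ 5 := by exact_mod_cast h
  calc (n : ℝ) ^ (1 / 5 : ℝ) ≤ ((m : ℝ) ^ 5) ^ (1 / 5 : ℝ) :=
        Real.rpow_le_rpow (Nat.cast_nonneg _) h1 (by norm_num)
    _ = m := by
        rw [← Real.rpow_natCast, ← Real.rpow_mul (Nat.cast_nonneg _)]
        norm_num

/-- The form `m ^ 5 + m ^ 4 ≤ (m + 1) ^ 5` loses only an additive constant in `m`. -/
theorem rpow_card_le : (Fintype.card ι : ℝ) ^ (1 / 5 : ℝ) ≤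
    ((max (disjointnessGraph a b).indepNum (disjointnessGraph a b).cliqueNum : ℕ) : ℝ) + 1 := by
  have h := card_le_ramsey a b
  set m := max (disjointnessGraph a b).indepNum (disjointnessGraph a b).cliqueNum
  have h1 : Fintype.card ι ≤ (m + 1) ^ 5 := h.trans (by ring_nf; omega)
  exact_mod_cast rpow_le_of_le_pow h1

theorem one_le_max [Nonempty ι] : 1 ≤
    max (disjointnessGraph a b).indepNum (disjointnessGraph a b).cliqueNum := by
  have h := card_le_ramsey a b
  have h1 : 0 < Fintype.card ι := Fintype.card_pos
  by_contra h2
  rw [show max (disjointnessGraph a b).indepNum (disjointnessGraph a b).cliqueNum = 0 by omega] at h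
  omega

end Consequences

end SegAlg

/-! ### The main theorem -/

theorem theorem1 :
    -- the bound on the chromatic number
    (∀ (d : ℕ), 2 ≤ d → ∀ (ι : Type*) [Fintype ι] (a b : ι → EuclideanSpace ℝ (Fin d)),
      (disjointnessGraph a b).chromaticNumber ≤
        (((disjointnessGraph a b).cliqueNum ^ 4 + (disjointnessGraph a b).cliqueNum ^ 3 : ℕ) : ℕ∞)) ∧
    -- one program, polynomial both in the number of real operations and in the bit model
    (∃ (P : RealRAM.Program) (p : Polynomial ℕ),
      ∀ (d n : ℕ), 2 ≤ d → ∀ (a b : Fin n → EuclideanSpace ℝ (Fin d)),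
        ∃ τ : RealRAM.Store,
          RealRAM.RunsWithin RealRAM.unitCost P (RealRAM.inputStore a b) τ (p.eval (n + d)) ∧
          (RealRAM.IsRationalInput a b →
            RealRAM.RunsWithin RealRAM.bitLength P (RealRAM.inputStore a b) τ
              (p.eval (n + d + RealRAM.inputBits a b))) ∧
          (disjointnessGraph a b).IsClique (RealRAM.outputSet n τ : Set (Fin n)) ∧
          (∀ i j, (disjointnessGraph a b).Adj i j →
            RealRAM.outputColor n τ i ≠ RealRAM.outputColor n τ j) ∧
          (Finset.univ.image (RealRAM.outputColor n τ)).card ≤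
            (RealRAM.outputSet n τ).card ^ 4 + (RealRAM.outputSet n τ).card ^ 3) ∧
    -- the Ramsey-type bound, with a constant that depends neither on `d` nor on the segments
    (∃ c : ℝ, 0 < c ∧
      ∀ (d : ℕ), 2 ≤ d → ∀ (ι : Type*) [Fintype ι] (a b : ι → EuclideanSpace ℝ (Fin d)),
        c * (Fintype.card ι : ℝ) ^ (1 / 5 : ℝ) ≤
          ((max (disjointnessGraph a b).indepNum (disjointnessGraph a b).cliqueNum : ℕ) : ℝ)) ∧
    -- the same with a constant that tends to one
    (∃ δ : ℕ → ℝ, Tendsto δ atTop (𝓝 0) ∧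
      ∀ (d : ℕ), 2 ≤ d → ∀ (ι : Type*) [Fintype ι] (a b : ι → EuclideanSpace ℝ (Fin d)),
        (1 - δ (Fintype.card ι)) * (Fintype.card ι : ℝ) ^ (1 / 5 : ℝ) ≤
          ((max (disjointnessGraph a b).indepNum (disjointnessGraph a b).cliqueNum : ℕ) : ℝ)) := by
  refine ⟨fun d _ ι _ a b => SegAlg.chromaticNumber_le a b, ?_, ?_, ?_⟩
  · obtain ⟨P, p, h⟩ := SegAlg.exists_coloring_program
    refine ⟨P, p, fun d n _ a b => ?_⟩
    obtain ⟨τ, h1, h2⟩ := h d n a b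
    refine ⟨τ, h1 _, fun _ => ?_, h2⟩
    obtain ⟨t, ht, he⟩ := h1 RealRAM.bitLength
    exact ⟨t, ht.trans (SegAlg.eval_mono p (Nat.le_add_right _ _)), he⟩
  -- The maximum is at least 1 for a nonempty family, so adding 1 at most doubles it.
  · refine ⟨1 / 2, by norm_num, fun d _ ι _ a b => ?_⟩
    rcases isEmpty_or_nonempty ι with hι | hι
    · rw [Fintype.card_eq_zero, Nat.cast_zero, Real.zero_rpow (by norm_num), mul_zero]
      exact Nat.cast_nonneg _
    · have h1 := SegAlg.rpow_card_le a b
      have h2 : (1 : ℝ) ≤ _ := Nat.one_le_cast.2 (SegAlg.one_le_max a b)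
      linarith
  -- With this choice the correction `δ n * n ^ (1 / 5)` is exactly the additive constant 1.
  · refine ⟨fun n => (n : ℝ) ^ (-(1 / 5 : ℝ)),
      (tendsto_rpow_neg_atTop (by norm_num)).comp tendsto_natCast_atTop_atTop,
      fun d _ ι _ a b => ?_⟩
    rcases isEmpty_or_nonempty ι with hι | hι
    · rw [Fintype.card_eq_zero, Nat.cast_zero, Real.zero_rpow (x := 1 / 5) (by norm_num), mul_zero]
      exact Nat.cast_nonneg _
    · have h1 := SegAlg.rpow_card_le a b
      have h2 : (0 : ℝ) < Fintype.card ι := Nat.cast_pos.2 Fintype.card_pos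
      rw [sub_mul, one_mul, ← Real.rpow_add h2, neg_add_cancel, Real.rpow_zero]
      linarith
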